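/- **Setting.** A dynamic vector commitment consists of probabilistic polynomial-time (PPT) algorithms $\mathsf{KeyGen}(1^\lambda,N)\to pp$ (which defines a message space $\mathcal M$), $\mathsf{Commit}_{pp}(m_0,\dots,m_{N-1})\to(C,\mathsf{aux})$, $\mathsf{Open}_{pp}(m,i,\mathsf{aux})\to\pi_i$, $\mathsf{Verify}_{pp}(C,m,i,\pi)\in\{0,1\}$, $\mathsf{Update}_{pp}(C,(m_i)_i,(m'_i)_i,\mathsf{aux})\to(C',U,\mathsf{aux}')$ and $\mathsf{ProofUpdate}_{pp}$. By the last one, the holder of an opening proof $\pi_i$ for index $i$, who knows $C$ and the new message $m'_i$ and has random access to the old and new messages, to the list of changes and to the update information $U$ (a bit string), computes the new commitment $C'$ and a new proof $\pi'_i$. Here $N=N(\lambda)$ is bounded by a polynomial. The scheme is correct: for all honestly generated $pp$, after a commitment to any vector and polynomially many updates, a proof obtained from $\mathsf{Open}$ or $\mathsf{ProofUpdate}$ is accepted, and the user's commitment is the current one, with overwhelming probability. The message space has exponential size and can be sampled: some PPT algorithm, given $(1^\lambda,1^N,pp)$, outputs elements of $\mathcal M$, each with probability at most $e^{-\Omega(\lambda)}$.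 The *running time of proof updates* for $k$ changed messages is the maximal number of operations of $\mathsf{ProofUpdate}$, over all honest updates of exactly $k$ of the $N$ messages of a freshly committed vector and all indices $i\in\{0,\dots,N-1\}$. An operation is one memory access (to an old message, a new message, an entry of the list of changes, or a $\lambda$-bit word of $U$) together with the polynomial-time local computation up to the next access. $|U|$ is measured in bits, in the worst case over the same updates. **Theorem.** Suppose that such a scheme * is *proof-binding*: every PPT adversary that is given $pp$ outputs only with negligible probability $\pi$, an index $i^*$ and two different vectors of messages $\mathbf m\ne\mathbf m'$ with $m_{i^*}=m'_{i^*}$ such that $\mathsf{Verify}_{pp}(C,m_{i^*},i^*,\pi)=\mathsf{Verify}_{pp}(C',m_{i^*},i^*,\pi)=1$ for the commitments $C=\mathsf{Commit}_{pp}(\mathbf m)$ and $C'=\mathsf{Commit}_{pp}(\mathbf m')$; * has position-binding error $e^{-\Omega(\lambda)}$: for every PPT adversary $\mathcal A$ there is $c>0$ such that for all large $\lambda$ and all $i\in\{0,\dots,N-1\}$, the probability that $\mathcal A(pp,i)$ outputs $(C,m,m',\pi,\pi')$ with $m\neq m'$ in $\mathcal M$ and $\mathsf{Verify}_{pp}(C,m,i,\pi)=\mathsf{Verify}_{pp}(C,m',i,\pi')=1$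 is at most $e^{-c\lambda}$. Let $\nu\in(0,1)$. 1. If the running time of proof updates is $O(k^{1-\nu})$, i.e. at most $\alpha k^{1-\nu}$ for all large $\lambda$ and all large $k\le N(\lambda)$, with a constant $\alpha$ that does not depend on $\lambda$ and $k$, then $|U|=\Omega(k^{\nu}\lambda)$: there are $c>0$, $k_0$, $\lambda_0$ such that $|U|\ge c\,k^\nu\lambda$ for all $\lambda\ge\lambda_0$ and $k_0\le k\le N(\lambda)$. So if $|U|\le g_1(k)\lambda$, then $g_1(k)=\Omega(k^\nu)$. 2. More generally, let $\tau\colon\mathbb N\to[1,\infty)$ be any function (for instance polylogarithmic). If the running time of proof updates is at most $\tau(\lambda)k^{1-\nu}$ for all large $\lambda$ and all large $k\le N(\lambda)$, then there are $c>0$, $K$, $\lambda_0$ such that $|U|\ge c\,k^\nu\lambda/\tau(\lambda)$ for all $\lambda\ge\lambda_0$ and all $k\le N(\lambda)$ with $k^\nu\ge K\,\tau(\lambda)$. -/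

import Mathlib

open Filter Topology

namespace VecCom

/-! ### Data, programs and their cost -/

/-- Finite data: nested lists. `cons a b` is the list with head `a` and tail `b`. -/
inductive Val : Type
  | nil : Val
  | cons : Val → Val → Val
  deriving DecidableEq

namespace Val

/-- Number of nodes of a piece of data. -/
def size : Val → ℕ
  | nil => 1
  | cons a b => a.size + b.size + 1

/-- First component (`nil` for `nil`). -/
def head : Val → Val
  | nil => nil
  | cons a _ => a

/-- Second component (`nil` for `nil`). -/
def tail : Val → Val
  | nil => nil
  | cons _ b => b

/-- The entries of a piece of data, seen as a list. -/
def toList : Val → List Val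
  | nil => []
  | cons a b => a :: b.toList

/-- A list as a piece of data. -/
def ofList : List Val → Val
  | [] => nil
  | a :: l => cons a (ofList l)

/-- Length of a piece of data, seen as a list. -/
def len (x : Val) : ℕ := x.toList.length

/-- The number `n` in unary, the string `1^n`. -/
def ofNat (n : ℕ) : Val := ofList (List.replicate n nil)

/-- A bit as a piece of data: `nil` is 0. -/
def ofBool (b : Bool) : Val := if b then cons nil nil else nil

/-- A bit string as a piece of data. -/
def ofBits (l : List Bool) : Val := ofList (l.map ofBool)

/-- The bit string given by a piece of data, one bit for each entry. -/
def toBits (x : Val) : List Bool := x.toList.map (fun y => decide (y ≠ nil))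

end Val

/-- Programs: a first-order language with pairing, branching, fair coins, loops and one
instruction `ask` that reads from an external random access memory. -/
inductive Prog : Type
  | skip : Prog
  | nil : Prog
  | head : Prog
  | tail : Prog
  /-- a fair coin toss -/
  | coin : Prog
  /-- one access to the external memory; the input is the address -/
  | ask : Prog
  /-- first `f`, then `g` -/
  | seq (f g : Prog) : Prog
  | pair (f g : Prog) : Prog
  /-- if `c` returns `nil` then `g` else `f` -/
  | ite (c f g : Prog) : Prog
  /-- on input `(n, s)`: apply `f` to `s` as many times as `n` has entries -/
  | loop (f : Prog) : Prog

/-- Result of a run: returned value, running time, number of accesses to the memory. -/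
structure Outcome where
  val : Val
  time : ℕ
  accesses : ℕ

/-- Iterate a randomized step, adding up the costs. -/
noncomputable def iterate (step : Val → PMF Outcome) : ℕ → Val → PMF Outcome
  | 0, s => PMF.pure ⟨s, 0, 0⟩
  | n + 1, s =>
      (step s).bind fun a =>
      (iterate step n a.val).bind fun b =>
      PMF.pure ⟨b.val, a.time + b.time, a.accesses + b.accesses⟩

/-- Distribution of the result of running a program on `x` with memory `mem`. Every executed
instruction costs one plus the size of the data it is applied to (and of the data it creates or reads), so
that the size of every value computed is at most the time spent. Loops are bounded by the length
of a value that has been computed before, which is no loss for algorithms with a polynomial time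
bound. -/
noncomputable def Prog.run (mem : Val → Val) : Prog → Val → PMF Outcome
  | .skip, x => PMF.pure ⟨x, 1 + x.size, 0⟩
  | .nil, x => PMF.pure ⟨Val.nil, 1 + x.size, 0⟩
  | .head, x => PMF.pure ⟨x.head, 1 + x.size, 0⟩
  | .tail, x => PMF.pure ⟨x.tail, 1 + x.size, 0⟩
  | .coin, x => (PMF.uniformOfFintype Bool).bind fun b =>
      PMF.pure ⟨Val.ofBool b, 1 + x.size + (Val.ofBool b).size, 0⟩
  | .ask, x => PMF.pure ⟨mem x, 1 + x.size + (mem x).size, 1⟩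
  | .seq f g, x =>
      (f.run mem x).bind fun a => (g.run mem a.val).bind fun b =>
      PMF.pure ⟨b.val, 1 + x.size + a.time + b.time, a.accesses + b.accesses⟩
  | .pair f g, x =>
      (f.run mem x).bind fun a => (g.run mem x).bind fun b =>
      PMF.pure ⟨Val.cons a.val b.val, 1 + x.size + a.time + b.time, a.accesses + b.accesses⟩
  | .ite c f g, x =>
      (c.run mem x).bind fun a =>
      (if a.val = Val.nil then g.run mem x else f.run mem x).bind fun b =>
      PMF.pure ⟨b.val, 1 + x.size + a.time + b.time, a.accesses + b.accesses⟩
  | .loop f, x =>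
      (iterate (f.run mem) x.head.len x.tail).bind fun b =>
      PMF.pure ⟨b.val, 1 + x.size + b.time, b.accesses⟩

/-- The empty memory. -/
def noMem : Val → Val := fun _ => Val.nil

/-- Output distribution of a program without external memory. -/
noncomputable def Prog.dist (p : Prog) (x : Val) : PMF Val := (p.run noMem x).map Outcome.val

/-- Probabilistic polynomial time. -/
def Prog.IsPPT (p : Prog) : Prop :=
  ∃ q : Polynomial ℕ, ∀ x, ∀ o ∈ (p.run noMem x).support, o.time ≤ q.eval x.size

/-- The indices at which two vectors differ, in increasing order. -/
def changed (old new : List Val) : List ℕ :=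
  (List.range old.length).filter
    fun i => decide (old.getD i Val.nil ≠ new.getD i Val.nil)

/-- The memory from which a proof is updated. An address consists of a tag and a unary number.
One access yields an old message (tag 0), a new message (tag 1), one of the
changes, as a triple of index, old and new message (tag 2), or a word of `lam` bits of the update
information `u` (other tags). -/
def updateMem (lam : ℕ) (old new : List Val) (u : List Bool) (address : Val) : Val :=
  match address.head.len with
  | 0 => old.getD address.tail.len Val.nil
  | 1 => new.getD address.tail.len Val.nil
  | 2 =>
    match (changed old new)[address.tail.len]? with
    | some i => Val.ofList [Val.ofNat i, old.getD i Val.nil, new.getD i Val.nil]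
    | none => Val.nil
  | _ => Val.ofBits ((u.drop (lam * address.tail.len)).take lam)

/-- Probabilistic polynomial time for programs that work on the memory `updateMem`. -/
def Prog.IsUpdatePPT (p : Prog) : Prop :=
  ∃ q : Polynomial ℕ, ∀ lam old new u x,
    ∀ o ∈ (p.run (updateMem lam old new u) x).support,
      o.time ≤ q.eval
        (lam + (Val.ofList old).size + (Val.ofList new).size + u.length + x.size)

/-- Probability that the random proposition `g` holds. -/
noncomputable def prob (g : PMF Prop) : ℝ := (g True).toReal

/-- `f` tends to zero faster than the inverse of every polynomial. -/
def Negligible (f : ℕ → ℝ) : Prop :=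
  Asymptotics.SuperpolynomialDecay atTop (fun n : ℕ => (n : ℝ)) f

/-! ### Dynamic vector commitments -/

/-- The algorithms of a dynamic vector commitment scheme, together with the message space
that the public parameters define. -/
structure DynamicVC where
  keyGen : Prog
  commit : Prog
  openProof : Prog
  verify : Prog
  update : Prog
  proofUpdate : Prog
  messages : Val → Set Val
  keyGen_ppt : keyGen.IsPPT
  commit_ppt : commit.IsPPT
  openProof_ppt : openProof.IsPPT
  verify_ppt : verify.IsPPT
  update_ppt : update.IsPPT
  proofUpdate_ppt : proofUpdate.IsUpdatePPT

namespace DynamicVC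

variable (vc : DynamicVC)

/-- `v` is a vector of `n` messages. -/
def IsVector (n : ℕ) (pp : Val) (v : List Val) : Prop :=
  v.length = n ∧ ∀ x ∈ v, x ∈ vc.messages pp

/-- `KeyGen(1^lam, n)`, which returns `pp`. -/
noncomputable def keyGenDist (lam n : ℕ) : PMF Val :=
  vc.keyGen.dist (Val.ofList [Val.ofNat lam, Val.ofNat n])

/-- `Commit`, which returns the pair `(C, aux)`. -/
noncomputable def commitDist (pp : Val) (v : List Val) : PMF (Val × Val) :=
  (vc.commit.dist (Val.ofList [pp, Val.ofList v])).map fun r => (r.head, r.tail)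

/-- `Open`, which returns an opening proof for the message `m` at index `i`. -/
noncomputable def openDist (pp m : Val) (i : ℕ) (aux : Val) : PMF Val :=
  vc.openProof.dist (Val.ofList [pp, m, Val.ofNat i, aux])

/-- `Verify`, which accepts if it does not return `nil`. -/
noncomputable def verifyDist (pp C m : Val) (i : ℕ) (π : Val) : PMF Prop :=
  (vc.verify.dist (Val.ofList [pp, C, m, Val.ofNat i, π])).map fun r => r ≠ Val.nil

/-- `Update`, which returns the new commitment, the update information (a bit string) and the
new auxiliary data. -/
noncomputable def updateDist (pp C : Val) (old new : List Val) (aux : Val) :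
    PMF (Val × List Bool × Val) :=
  (vc.update.dist (Val.ofList [pp, C, Val.ofList old, Val.ofList new, aux])).map
    fun r => (r.head, r.tail.head.toBits, r.tail.tail)

/-- A run of `ProofUpdate` by the holder of the proof `π` for index `i`, who knows the old
commitment `C` and the new message at index `i`, and has random access to the old and new messages,
to the list of changes, and to the update information `u`. It returns a pair: the new commitment and
the new proof. -/
noncomputable def proofUpdateRun (lam : ℕ) (pp C π : Val) (i : ℕ) (old new : List Val)
    (u : List Bool) : PMF Outcome :=
  vc.proofUpdate.run (updateMem lam old new u)
    (Val.ofList [pp, C, π, new.getD i Val.nil, Val.ofNat i])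

/-- State of an honest execution, as far as the holder of one proof is concerned: commitment and
auxiliary data of the committer, commitment and opening proof of the user. -/
structure State where
  com : Val
  aux : Val
  userCom : Val
  proof : Val

/-- Commit to `v` and open index `i`. -/
noncomputable def start (pp : Val) (i : ℕ) (v : List Val) : PMF State :=
  (vc.commitDist pp v).bind fun c =>
  (vc.openDist pp (v.getD i Val.nil) i c.2).bind fun π =>
  PMF.pure ⟨c.1, c.2, c.1, π⟩

/-- Update the vector `old` to `new`; then the user either gets a newly opened proof
(`reopen = true`), or updates the old one. -/
noncomputable def step (lam : ℕ) (pp : Val) (i : ℕ) (old : List Val) (s : State)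
    (reopen : Bool) (new : List Val) : PMF State :=
  (vc.updateDist pp s.com old new s.aux).bind fun r =>
  if reopen then
    (vc.openDist pp (new.getD i Val.nil) i r.2.2).bind fun π =>
    PMF.pure ⟨r.1, r.2.2, r.1, π⟩
  else
    (vc.proofUpdateRun lam pp s.com s.proof i old new r.2.1).bind fun o =>
    PMF.pure ⟨r.1, r.2.2, o.val.head, o.val.tail⟩

/-- A sequence of updates, followed by the verification of the user's proof. The experiment
succeeds if the proof is accepted and the user knows the current commitment. -/
noncomputable def correctnessGame (lam : ℕ) (pp : Val) (i : ℕ) :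
    List Val → State → List (Bool × List Val) → PMF Prop
  | v, s, [] =>
      (vc.verifyDist pp s.com (v.getD i Val.nil) i s.proof).map
        fun accepted => accepted ∧ s.userCom = s.com
  | v, s, (reopen, new) :: rest =>
      (vc.step lam pp i v s reopen new).bind fun s' => correctnessGame lam pp i new s' rest

/-- Correctness: for all honestly generated parameters, after a commitment to any vector and
polynomially many updates, opening proofs from `Open` and `ProofUpdate` are accepted with
overwhelming probability. -/
def Correct (N : ℕ → ℕ) : Prop :=
  ∀ d : ℕ, ∃ ε : ℕ → ℝ, Negligible ε ∧
    ∀ lam, ∀ pp ∈ (vc.keyGenDist lam (N lam)).support, ∀ i < N lam,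
    ∀ v, vc.IsVector (N lam) pp v →
    ∀ steps : List (Bool × List Val), steps.length ≤ lam ^ d + d →
      (∀ st ∈ steps, vc.IsVector (N lam) pp st.2) →
      1 - ε lam ≤ prob ((vc.start pp i v).bind fun s => vc.correctnessGame lam pp i v s steps)

/-- The position-binding experiment: the adversary returns `[C, m, m', π, π']` and wins if both
openings of index `i` are accepted and `m ≠ m'`. -/
noncomputable def positionBindingGame (A : Prog) (lam n i : ℕ) : PMF Prop :=
  (vc.keyGenDist lam n).bind fun pp =>
  (A.dist (Val.ofList [Val.ofNat lam, Val.ofNat n, pp, Val.ofNat i])).bind fun r =>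
  let C := r.toList.getD 0 Val.nil
  let m := r.toList.getD 1 Val.nil
  let m' := r.toList.getD 2 Val.nil
  let π := r.toList.getD 3 Val.nil
  let π' := r.toList.getD 4 Val.nil
  (vc.verifyDist pp C m i π).bind fun b =>
  (vc.verifyDist pp C m' i π').bind fun b' =>
  PMF.pure (b ∧ b' ∧ m ≠ m' ∧ m ∈ vc.messages pp ∧ m' ∈ vc.messages pp)

/-- Every PPT adversary breaks position-binding with probability at most `e^{-Ω(lam)}`. -/
def ExpPositionBinding (N : ℕ → ℕ) : Prop :=
  ∀ A : Prog, A.IsPPT → ∃ c : ℝ, 0 < c ∧ ∀ᶠ lam : ℕ in atTop, ∀ i < N lam,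
    prob (vc.positionBindingGame A lam (N lam) i) ≤ Real.exp (-(c * lam))

/-- The proof-binding experiment: the adversary returns `[π, i, v, v']`, where the vectors `v` and
`v'` have the same message at index `i` and differ elsewhere, and wins if `π` is accepted as an
opening proof at index `i` for the (honestly computed) commitments to both. -/
noncomputable def proofBindingGame (A : Prog) (lam n : ℕ) : PMF Prop :=
  (vc.keyGenDist lam n).bind fun pp =>
  (A.dist (Val.ofList [Val.ofNat lam, Val.ofNat n, pp])).bind fun r =>
  let π := r.toList.getD 0 Val.nil
  let i := (r.toList.getD 1 Val.nil).len
  let v := (r.toList.getD 2 Val.nil).toList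
  let v' := (r.toList.getD 3 Val.nil).toList
  (vc.commitDist pp v).bind fun c =>
  (vc.commitDist pp v').bind fun c' =>
  (vc.verifyDist pp c.1 (v.getD i Val.nil) i π).bind fun b =>
  (vc.verifyDist pp c'.1 (v'.getD i Val.nil) i π).bind fun b' =>
  PMF.pure (b ∧ b' ∧ i < n ∧ vc.IsVector n pp v ∧ vc.IsVector n pp v' ∧
    v.getD i Val.nil = v'.getD i Val.nil ∧ v ≠ v')

/-- Proof-binding: every PPT adversary wins with negligible probability. -/
def ProofBinding (N : ℕ → ℕ) : Prop :=
  ∀ A : Prog, A.IsPPT → Negligible fun lam => prob (vc.proofBindingGame A lam (N lam))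

/-- The message space has exponential size and can be sampled: a PPT algorithm returns random
messages, each with probability at most `e^{-Ω(lam)}`. -/
def LargeMessageSpace (N : ℕ → ℕ) : Prop :=
  ∃ S : Prog, S.IsPPT ∧ ∃ c : ℝ, 0 < c ∧ ∀ᶠ lam : ℕ in atTop,
    ∀ pp ∈ (vc.keyGenDist lam (N lam)).support,
    ∀ x ∈ (S.dist (Val.ofList [Val.ofNat lam, Val.ofNat (N lam), pp])).support,
      x ∈ vc.messages pp ∧
      ((S.dist (Val.ofList [Val.ofNat lam, Val.ofNat (N lam), pp])) x).toReal ≤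
        Real.exp (-(c * lam))

/-- An honest update of exactly `k` messages in a vector of `n` messages: a possible outcome
of `KeyGen`, `Commit` and `Update`, with update information `info`. -/
structure Batch (n lam k : ℕ) where
  pp : Val
  old : List Val
  new : List Val
  com : Val
  aux : Val
  newCom : Val
  info : List Bool
  newAux : Val
  pp_mem : pp ∈ (vc.keyGenDist lam n).support
  old_vector : vc.IsVector n pp old
  new_vector : vc.IsVector n pp new
  card_changed : (changed old new).length = k
  commit_mem : (com, aux) ∈ (vc.commitDist pp old).support
  update_mem : (newCom, info, newAux) ∈ (vc.updateDist pp com old new aux).support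

/-- After an update of `k` messages, every user can update the opening proof in at most `T`
operations. An operation is one access to the memory (a message, a change, or a word of the update
information), together with the polynomial-time local computation up to the next access. -/
def ProofUpdateTimeLE (n lam k : ℕ) (T : ℝ) : Prop :=
  ∀ b : vc.Batch n lam k, ∀ i < n,
    ∀ π ∈ (vc.openDist b.pp (b.old.getD i Val.nil) i b.aux).support,
    ∀ o ∈ (vc.proofUpdateRun lam b.pp b.com π i b.old b.new b.info).support,
      (o.accesses : ℝ) ≤ T

/-- In the worst case, an update of `k` messages has at least `B` bits of update information. -/
def UpdateInfoGE (n lam k : ℕ) (B : ℝ) : Prop :=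
  ∃ b : vc.Batch n lam k, B ≤ (b.info.length : ℝ)

end DynamicVC

end VecCom

/-!
Why the bound holds. If updates are fast and their information `u` is short, then the users, taken
together, turn `u` into a succinct approximate membership filter for the new messages, and a filter
that is too small has so many false positives that one of them breaks position binding.

Consider an update that replaces the first `k` messages of a random vector by fresh random ones. User
`i` gets the new message `y` at index `i` and makes at most `T = τ k^(1-ν)` accesses. In the directed
graph of who reads whose new message all out-degrees are at most `T`, so there is a set `L` of about
`k / T` users who hardly read each other's new messages (`exists_sparse_subset`). For `i ∈ L` consider
the event that user `i`, started with the message `y`, obtains the new commitment `c` and a proof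
that is accepted for `y`, without reading the new messages at the other indices in `L`. Its probability
`g i c u m y` (`DynamicVC.obliviousSuccess`) does not depend on the entries of the fresh vector `m` in
`L` (`agreeOn_trace`: a program cannot tell memories apart before it reads a difference). By
correctness `g i c u m (m i)` is large for most `i ∈ L`.

Suppose that `g i c u m y` averages to less than `θ = e^(-ηλ)` over random `y`, for most `i ∈ L`. By
independence, the true messages all pass the test with probability at most about `θ^(|L| / 4)`, for
fixed `u` and summed over all commitments `c`; that sum costs nothing, because a user arrives at one
commitment only (`filter_bound`). There are fewer than `2^(l+1)` strings `u` of
length at most `l`, so this is impossible unless `l` is at least of the order of `λ |L|`, hence of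
`λ k^ν / τ`. So for shorter information some user `i` accepts a random wrong message `y` with
probability about `θ` (`exists_index_of_filter_bound`,
`DynamicVC.exists_le_expect_attackSuccess`).

This gives an adversary against position binding at index `i`: it commits to a random vector, updates
a prefix of it, opens the new message at index `i` honestly, and obtains a proof for a wrong message `y`
from `ProofUpdate`, run on a memory in which the new message at index `i` has been replaced by `y`
(`DynamicVC.attack`). The only thing that it does not know is `k`, which it guesses
with probability at least `1 / (8 N^2)` (`guess_ge`). Most of the programming goes into showing that the attack is
computed by a program in polynomial time (`DynamicVC.samplable_attack`). For this, `Samplable` and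
`Computable` functions are closed under the usual list operations, and a program with a memory can be
simulated by one without, given a description of the memory (`Samplable.sim`).
-/

namespace VecCom

/-! ### Values computed by programs, and the time they take -/

theorem eval_monotone (q : Polynomial ℕ) : Monotone fun n => q.eval n := by
  intro a b h
  simp only [Polynomial.eval_eq_sum]
  exact Finset.sum_le_sum fun i _ => Nat.mul_le_mul_left _ (Nat.pow_le_pow_left h i)

namespace Val

@[simp] theorem head_cons (a b : Val) : (cons a b).head = a := rfl

@[simp] theorem tail_cons (a b : Val) : (cons a b).tail = b := rfl

@[simp] theorem head_nil : nil.head = nil := rfl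

@[simp] theorem tail_nil : nil.tail = nil := rfl

theorem size_pos (x : Val) : 1 ≤ x.size := by
  cases x <;> simp [size]

theorem size_head_le (x : Val) : x.head.size ≤ x.size := by
  cases x <;> simp [size, head]; omega

theorem size_tail_le (x : Val) : x.tail.size ≤ x.size := by
  cases x <;> simp [size, tail]; omega

theorem size_le_head_tail (x : Val) : x.size ≤ x.head.size + x.tail.size + 1 := by
  cases x <;> simp [size, head, tail]

theorem len_le_size (x : Val) : x.len ≤ x.size := by
  induction x with
  | nil => simp [len, toList]
  | cons a b _ ih => simp only [len, toList, size, List.length_cons] at *; omega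

end Val

/-- The distribution of the value that a program returns when it runs with memory `mem`. -/
noncomputable def Prog.value (mem : Val → Val) (p : Prog) (x : Val) : PMF Val :=
  (p.run mem x).map Outcome.val

/-- `n` iterations of a randomized step, without costs. -/
noncomputable def iterateValue (κ : Val → PMF Val) : ℕ → Val → PMF Val
  | 0, s => PMF.pure s
  | n + 1, s => (κ s).bind (iterateValue κ n)

theorem iterate_map_val (step : Val → PMF Outcome) (n : ℕ) (s : Val) :
    (iterate step n s).map Outcome.val =
      iterateValue (fun s => (step s).map Outcome.val) n s := by
  induction n generalizing s with
  | zero => simp [iterate, iterateValue, PMF.pure_map]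
  | succ n ih =>
    simp only [iterate, iterateValue, PMF.map_bind, PMF.pure_map, PMF.bind_map]
    congr 1
    funext a
    rw [Function.comp_apply, ← ih]
    exact PMF.bind_pure_comp _ _

section value

variable (mem : Val → Val)

theorem value_skip (x : Val) : Prog.skip.value mem x = PMF.pure x := by
  simp [Prog.value, Prog.run, PMF.pure_map]

theorem value_nil (x : Val) : Prog.nil.value mem x = PMF.pure Val.nil := by
  simp [Prog.value, Prog.run, PMF.pure_map]

theorem value_head (x : Val) : Prog.head.value mem x = PMF.pure x.head := by
  simp [Prog.value, Prog.run, PMF.pure_map]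

theorem value_tail (x : Val) : Prog.tail.value mem x = PMF.pure x.tail := by
  simp [Prog.value, Prog.run, PMF.pure_map]

theorem value_ask (x : Val) : Prog.ask.value mem x = PMF.pure (mem x) := by
  simp [Prog.value, Prog.run, PMF.pure_map]

theorem value_coin (x : Val) :
    Prog.coin.value mem x = (PMF.uniformOfFintype Bool).map Val.ofBool := by
  simp only [Prog.value, Prog.run, PMF.map_bind, PMF.pure_map]
  rfl

theorem value_seq (f g : Prog) (x : Val) :
    (Prog.seq f g).value mem x = (f.value mem x).bind (g.value mem) := by
  simp only [Prog.value, Prog.run, PMF.map_bind, PMF.pure_map, PMF.bind_map]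
  rfl

theorem value_pair (f g : Prog) (x : Val) :
    (Prog.pair f g).value mem x =
      (f.value mem x).bind fun a => (g.value mem x).bind fun b => PMF.pure (Val.cons a b) := by
  simp only [Prog.value, Prog.run, PMF.map_bind, PMF.pure_map, PMF.bind_map]
  rfl

theorem value_ite (c f g : Prog) (x : Val) :
    (Prog.ite c f g).value mem x =
      (c.value mem x).bind fun a => if a = Val.nil then g.value mem x else f.value mem x := by
  simp only [Prog.value, Prog.run, PMF.map_bind, PMF.pure_map, PMF.bind_map]
  congr 1
  funext a
  simp only [Function.comp]
  split_ifs <;> rfl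

theorem value_loop (f : Prog) (x : Val) :
    (Prog.loop f).value mem x = iterateValue (f.value mem) x.head.len x.tail := by
  simp only [Prog.value, Prog.run, PMF.map_bind, PMF.pure_map]
  exact iterate_map_val _ _ _

end value

theorem mem_support_iterate {step : Val → PMF Outcome} {n : ℕ} {s : Val} {o : Outcome}
    (h : o ∈ (iterate step (n + 1) s).support) :
    ∃ a ∈ (step s).support, ∃ b ∈ (iterate step n a.val).support,
      o = ⟨b.val, a.time + b.time, a.accesses + b.accesses⟩ := by
  simpa only [iterate, PMF.mem_support_bind_iff, PMF.mem_support_pure_iff] using h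

theorem size_le_time_iterate {step : Val → PMF Outcome}
    (hstep : ∀ s, ∀ o ∈ (step s).support, o.val.size ≤ o.time) (n : ℕ) (s : Val) :
    ∀ o ∈ (iterate step n s).support, o.val.size ≤ s.size + o.time := by
  induction n generalizing s with
  | zero =>
    intro o ho
    simp only [iterate, PMF.mem_support_pure_iff] at ho
    subst ho
    simp
  | succ n ih =>
    intro o ho
    obtain ⟨a, ha, b, hb, rfl⟩ := mem_support_iterate ho
    have := hstep s a ha
    have := ih a.val b hb
    simp only
    omega

/-- The size of the value returned, and that of the input, are at most the time spent. -/
theorem size_le_time (mem : Val → Val) (p : Prog) (x : Val) :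
    ∀ o ∈ (p.run mem x).support, o.val.size ≤ o.time ∧ x.size + 1 ≤ o.time := by
  induction p generalizing x with
  | skip => intro o ho; simp only [Prog.run, PMF.mem_support_pure_iff] at ho; subst ho; simp
  | nil =>
    intro o ho
    simp only [Prog.run, PMF.mem_support_pure_iff] at ho
    subst ho
    simp [Val.size]
  | head =>
    intro o ho
    simp only [Prog.run, PMF.mem_support_pure_iff] at ho
    subst ho
    have := x.size_head_le
    simp; omega
  | tail =>
    intro o ho
    simp only [Prog.run, PMF.mem_support_pure_iff] at ho
    subst ho
    have := x.size_tail_le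
    simp; omega
  | coin =>
    intro o ho
    simp only [Prog.run, PMF.mem_support_bind_iff, PMF.mem_support_pure_iff] at ho
    obtain ⟨b, -, rfl⟩ := ho
    simp; omega
  | ask =>
    intro o ho
    simp only [Prog.run, PMF.mem_support_pure_iff] at ho
    subst ho
    simp; omega
  | seq f g ihf ihg =>
    intro o ho
    simp only [Prog.run, PMF.mem_support_bind_iff, PMF.mem_support_pure_iff] at ho
    obtain ⟨a, ha, b, hb, rfl⟩ := ho
    have := ihf x a ha
    have := ihg _ b hb
    simp only; omega
  | pair f g ihf ihg =>
    intro o ho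
    simp only [Prog.run, PMF.mem_support_bind_iff, PMF.mem_support_pure_iff] at ho
    obtain ⟨a, ha, b, hb, rfl⟩ := ho
    have := ihf x a ha
    have := ihg _ b hb
    simp only [Val.size]; omega
  | ite c f g ihc ihf ihg =>
    intro o ho
    simp only [Prog.run, PMF.mem_support_bind_iff, PMF.mem_support_pure_iff] at ho
    obtain ⟨a, ha, b, hb, rfl⟩ := ho
    have : b.val.size ≤ b.time ∧ x.size + 1 ≤ b.time := by
      split_ifs at hb
      exacts [ihg _ b hb, ihf _ b hb]
    simp only; omega
  | loop f ihf =>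
    intro o ho
    simp only [Prog.run, PMF.mem_support_bind_iff, PMF.mem_support_pure_iff] at ho
    obtain ⟨b, hb, rfl⟩ := ho
    have := size_le_time_iterate (fun s o ho => (ihf s o ho).1) _ _ b hb
    have := x.size_tail_le
    simp only; omega

/-! ### Polynomial-time computable distributions -/

theorem Prog.IsPPT.size_dist_le {p : Prog} {q : Polynomial ℕ}
    (hq : ∀ x, ∀ o ∈ (p.run noMem x).support, o.time ≤ q.eval x.size) (x : Val) :
    ∀ y ∈ (p.dist x).support, y.size ≤ q.eval x.size := by
  intro y hy
  obtain ⟨o, ho, rfl⟩ := (PMF.mem_support_map_iff _ _ _).1 hy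
  exact (size_le_time _ _ _ o ho).1.trans (hq x o ho)

/-- `f` is bounded by a polynomial in the size of its argument. -/
def PolyBounded (f : Val → ℕ) : Prop := ∃ q : Polynomial ℕ, ∀ x, f x ≤ q.eval x.size

namespace PolyBounded

theorem const (c : ℕ) : PolyBounded fun _ => c := ⟨Polynomial.C c, fun x => by simp⟩

theorem size : PolyBounded Val.size := ⟨Polynomial.X, fun x => by simp⟩

theorem add {f g : Val → ℕ} (hf : PolyBounded f) (hg : PolyBounded g) :
    PolyBounded fun x => f x + g x := by
  obtain ⟨q, hq⟩ := hf
  obtain ⟨r, hr⟩ := hg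
  exact ⟨q + r, fun x => by simpa using add_le_add (hq x) (hr x)⟩

theorem mul {f g : Val → ℕ} (hf : PolyBounded f) (hg : PolyBounded g) :
    PolyBounded fun x => f x * g x := by
  obtain ⟨q, hq⟩ := hf
  obtain ⟨r, hr⟩ := hg
  exact ⟨q * r, fun x => by simpa using Nat.mul_le_mul (hq x) (hr x)⟩

theorem eval {f : Val → ℕ} (hf : PolyBounded f) (q : Polynomial ℕ) :
    PolyBounded fun x => q.eval (f x) := by
  obtain ⟨r, hr⟩ := hf
  exact ⟨q.comp r, fun x => by simpa using eval_monotone q (hr x)⟩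

end PolyBounded

/-- `κ` is the output distribution of a probabilistic polynomial-time program. -/
def Samplable (κ : Val → PMF Val) : Prop := ∃ p : Prog, p.IsPPT ∧ ∀ x, p.dist x = κ x

/-- `f` is computed by a polynomial-time program. -/
def Computable (f : Val → Val) : Prop := Samplable fun x => PMF.pure (f x)

theorem Samplable.size_le {κ : Val → PMF Val} (h : Samplable κ) :
    ∃ q : Polynomial ℕ, ∀ x, ∀ y ∈ (κ x).support, y.size ≤ q.eval x.size := by
  obtain ⟨p, ⟨q, hq⟩, hd⟩ := h
  exact ⟨q, fun x y hy => Prog.IsPPT.size_dist_le hq x y (by rwa [hd])⟩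

theorem Computable.size_le {f : Val → Val} (h : Computable f) :
    ∃ q : Polynomial ℕ, ∀ x, (f x).size ≤ q.eval x.size := by
  obtain ⟨q, hq⟩ := Samplable.size_le h
  exact ⟨q, fun x => hq x _ (by simp)⟩

theorem Computable.polyBounded {f : Val → Val} (h : Computable f) :
    PolyBounded fun x => (f x).size := h.size_le

theorem samplable_dist {p : Prog} (hp : p.IsPPT) : Samplable p.dist := ⟨p, hp, fun _ => rfl⟩

theorem Computable.id : Computable fun x => x :=
  ⟨.skip, ⟨1 + Polynomial.X, fun x o ho => by
    simp only [Prog.run, PMF.mem_support_pure_iff] at ho; subst ho; simp⟩,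
    fun x => value_skip _ x⟩

theorem Computable.nil : Computable fun _ => Val.nil :=
  ⟨.nil, ⟨1 + Polynomial.X, fun x o ho => by
    simp only [Prog.run, PMF.mem_support_pure_iff] at ho; subst ho; simp⟩,
    fun x => value_nil _ x⟩

theorem computable_head : Computable Val.head :=
  ⟨.head, ⟨1 + Polynomial.X, fun x o ho => by
    simp only [Prog.run, PMF.mem_support_pure_iff] at ho; subst ho; simp⟩,
    fun x => value_head _ x⟩

theorem computable_tail : Computable Val.tail :=
  ⟨.tail, ⟨1 + Polynomial.X, fun x o ho => by
    simp only [Prog.run, PMF.mem_support_pure_iff] at ho; subst ho; simp⟩,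
    fun x => value_tail _ x⟩

theorem samplable_coin : Samplable fun _ => (PMF.uniformOfFintype Bool).map Val.ofBool :=
  ⟨.coin, ⟨4 + Polynomial.X, fun x o ho => by
    simp only [Prog.run, PMF.mem_support_bind_iff, PMF.mem_support_pure_iff] at ho
    obtain ⟨b, -, rfl⟩ := ho
    have : (Val.ofBool b).size ≤ 3 := by rcases b with _ | _ <;> simp [Val.ofBool, Val.size]
    simp only [Polynomial.eval_add, Polynomial.eval_ofNat, Polynomial.eval_X]
    omega⟩,
    fun x => value_coin _ x⟩

theorem Samplable.congr {κ κ' : Val → PMF Val} (h : Samplable κ) (he : ∀ x, κ x = κ' x) :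
    Samplable κ' := by
  rwa [show κ' = κ from funext fun x => (he x).symm]

theorem Computable.congr {f g : Val → Val} (h : Computable f) (he : ∀ x, f x = g x) :
    Computable g := by
  rwa [show g = f from funext fun x => (he x).symm]

theorem Samplable.seq {κ κ' : Val → PMF Val} (h : Samplable κ) (h' : Samplable κ') :
    Samplable fun x => (κ x).bind κ' := by
  obtain ⟨p, ⟨q, hq⟩, hd⟩ := h
  obtain ⟨p', ⟨q', hq'⟩, hd'⟩ := h'
  refine ⟨.seq p p', ⟨1 + Polynomial.X + q + q'.comp q, fun x o ho => ?_⟩, fun x => ?_⟩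
  · simp only [Prog.run, PMF.mem_support_bind_iff, PMF.mem_support_pure_iff] at ho
    obtain ⟨a, ha, b, hb, rfl⟩ := ho
    have h1 := hq x a ha
    have h2 := hq' _ b hb
    have h3 : q'.eval a.val.size ≤ q'.eval (q.eval x.size) :=
      eval_monotone q' ((size_le_time _ _ _ a ha).1.trans h1)
    simp only [Polynomial.eval_add, Polynomial.eval_one, Polynomial.eval_X, Polynomial.eval_comp]
    omega
  · change _ = (κ x).bind κ'
    rw [← hd, show κ' = p'.dist from funext fun x => (hd' x).symm]
    exact value_seq _ _ _ _

theorem Samplable.pair {κ κ' : Val → PMF Val} (h : Samplable κ) (h' : Samplable κ') :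
    Samplable fun x => (κ x).bind fun a => (κ' x).bind fun b => PMF.pure (Val.cons a b) := by
  obtain ⟨p, ⟨q, hq⟩, hd⟩ := h
  obtain ⟨p', ⟨q', hq'⟩, hd'⟩ := h'
  refine ⟨.pair p p', ⟨1 + Polynomial.X + q + q', fun x o ho => ?_⟩, fun x => ?_⟩
  · simp only [Prog.run, PMF.mem_support_bind_iff, PMF.mem_support_pure_iff] at ho
    obtain ⟨a, ha, b, hb, rfl⟩ := ho
    have h1 := hq x a ha
    have h2 := hq' _ b hb
    simp only [Polynomial.eval_add, Polynomial.eval_one, Polynomial.eval_X]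
    omega
  · change _ = (κ x).bind fun a => (κ' x).bind fun b => PMF.pure (Val.cons a b)
    rw [← hd, ← hd']
    exact value_pair _ _ _ _

theorem Samplable.comp {κ : Val → PMF Val} {f : Val → Val} (h : Samplable κ) (hf : Computable f) :
    Samplable fun x => κ (f x) :=
  (Samplable.seq hf h).congr fun x => by simp

theorem Computable.comp {g f : Val → Val} (h : Computable g) (hf : Computable f) :
    Computable fun x => g (f x) :=
  Samplable.comp (κ := fun x => PMF.pure (g x)) h hf

theorem Samplable.map {κ : Val → PMF Val} {f : Val → Val} (hf : Computable f) (h : Samplable κ) :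
    Samplable fun x => (κ x).map f :=
  (Samplable.seq h hf).congr fun _ => PMF.bind_pure_comp _ _

theorem Computable.cons {f g : Val → Val} (hf : Computable f) (hg : Computable g) :
    Computable fun x => Val.cons (f x) (g x) :=
  (Samplable.pair hf hg).congr fun x => by simp

theorem Computable.head {f : Val → Val} (hf : Computable f) : Computable fun x => (f x).head :=
  computable_head.comp hf

theorem Computable.tail {f : Val → Val} (hf : Computable f) : Computable fun x => (f x).tail :=
  computable_tail.comp hf

theorem Computable.const (v : Val) : Computable fun _ => v := by
  induction v with
  | nil => exact Computable.nil
  | cons a b iha ihb => exact iha.cons ihb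

/-- Sampling in sequence: the second sampler gets the input together with the first sample. -/
theorem Samplable.bind {κ κ' : Val → PMF Val} (h : Samplable κ) (h' : Samplable κ') :
    Samplable fun x => (κ x).bind fun a => κ' (Val.cons a x) :=
  (Samplable.seq (Samplable.pair h Computable.id) h').congr fun x => by
    simp [PMF.bind_bind]

theorem Samplable.ite {c : Val → Val} {κ κ' : Val → PMF Val} (hc : Computable c)
    (h : Samplable κ) (h' : Samplable κ') :
    Samplable fun x => if c x = Val.nil then κ x else κ' x := by
  obtain ⟨p₀, ⟨q₀, hq₀⟩, hd₀⟩ := hc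
  obtain ⟨p, ⟨q, hq⟩, hd⟩ := h
  obtain ⟨p', ⟨q', hq'⟩, hd'⟩ := h'
  refine ⟨.ite p₀ p' p, ⟨1 + Polynomial.X + q₀ + q + q', fun x o ho => ?_⟩, fun x => ?_⟩
  · simp only [Prog.run, PMF.mem_support_bind_iff, PMF.mem_support_pure_iff] at ho
    obtain ⟨a, ha, b, hb, rfl⟩ := ho
    have h1 := hq₀ x a ha
    have h2 : b.time ≤ q.eval x.size + q'.eval x.size := by
      split_ifs at hb
      · have := hq x b hb; omega
      · have := hq' x b hb; omega
    simp only [Polynomial.eval_add, Polynomial.eval_one, Polynomial.eval_X]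
    omega
  · have := value_ite noMem p₀ p' p x
    change Prog.dist _ _ = (Prog.dist _ _).bind fun a =>
      if a = Val.nil then Prog.dist _ _ else Prog.dist _ _ at this
    rw [this, hd₀, hd, hd']
    simp

theorem Computable.ite {c f g : Val → Val} (hc : Computable c)
    (hf : Computable f) (hg : Computable g) :
    Computable fun x => if c x = Val.nil then f x else g x :=
  (Samplable.ite hc hf hg).congr fun x => by dsimp only; split_ifs <;> rfl

theorem time_iterate_le {step : Val → PMF Outcome} {P : ℕ → Val → Prop} {t : ℕ}
    (hP : ∀ n s, P (n + 1) s → ∀ o ∈ (step s).support, o.time ≤ t ∧ P n o.val) (n : ℕ) (s : Val)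
    (hs : P n s) : ∀ o ∈ (iterate step n s).support, o.time ≤ n * t := by
  induction n generalizing s with
  | zero =>
    intro o ho
    simp only [iterate, PMF.mem_support_pure_iff] at ho
    subst ho
    simp
  | succ n ih =>
    intro o ho
    obtain ⟨a, ha, b, hb, rfl⟩ := mem_support_iterate ho
    have h1 := hP n s hs a ha
    have h2 := ih a.val h1.2 b hb
    simp only
    linarith

/-- A loop takes polynomial time if the states that it reaches have polynomial size. -/
theorem Samplable.iterate {κ : Val → PMF Val} (h : Samplable κ)
    (hgrow : ∃ q : Polynomial ℕ, ∀ n s, ∀ s' ∈ (iterateValue κ n s).support,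
      s'.size ≤ q.eval (n + s.size)) :
    Samplable fun x => iterateValue κ x.head.len x.tail := by
  obtain ⟨p, ⟨q, hq⟩, hd⟩ := h
  obtain ⟨r, hr⟩ := hgrow
  obtain rfl : p.dist = κ := funext hd
  refine ⟨.loop p, ⟨1 + Polynomial.X + Polynomial.X * q.comp (r.comp (2 * Polynomial.X)),
    fun x o ho => ?_⟩, fun x => value_loop _ _ _⟩
  simp only [Prog.run, PMF.mem_support_bind_iff, PMF.mem_support_pure_iff] at ho
  obtain ⟨b, hb, rfl⟩ := ho
  -- all states that can be reached in at most the prescribed number of iterations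
  set m := x.head.len with hm
  have key := time_iterate_le (step := p.run noMem)
    (P := fun n s => n ≤ m ∧ s ∈ (iterateValue p.dist (m - n) x.tail).support)
    (t := q.eval (r.eval (2 * x.size))) ?_ m x.tail ⟨le_rfl, by simp [iterateValue]⟩ b hb
  · have hmx : m ≤ x.size := (Val.len_le_size _).trans x.size_head_le
    have := Nat.mul_le_mul_right (q.eval (r.eval (2 * x.size))) hmx
    simp only [Polynomial.eval_add, Polynomial.eval_one, Polynomial.eval_X, Polynomial.eval_mul,
      Polynomial.eval_comp, Polynomial.eval_ofNat]
    omega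
  · rintro n s ⟨hn, hs⟩ o ho
    have hmx : m ≤ x.size := (Val.len_le_size _).trans x.size_head_le
    refine ⟨(hq s o ho).trans (eval_monotone q ((hr _ _ _ hs).trans (eval_monotone r ?_))),
      by omega, ?_⟩
    · have := x.size_tail_le
      omega
    · have hstep : ∀ j v, s ∈ (iterateValue p.dist j v).support →
          o.val ∈ (iterateValue p.dist (j + 1) v).support := by
        intro j
        induction j with
        | zero =>
          intro v hv
          simp only [iterateValue, PMF.mem_support_pure_iff] at hv
          subst hv
          simp only [iterateValue, PMF.mem_support_bind_iff, PMF.mem_support_pure_iff]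
          exact ⟨o.val, (PMF.mem_support_map_iff _ _ _).2 ⟨o, ho, rfl⟩, rfl⟩
        | succ j ih =>
          intro v hv
          rw [iterateValue, PMF.mem_support_bind_iff] at hv ⊢
          obtain ⟨a, ha, hv⟩ := hv
          exact ⟨a, ha, ih a hv⟩
      have := hstep _ _ hs
      rwa [show m - (n + 1) + 1 = m - n by omega] at this

theorem iterateValue_pure (f : Val → Val) (n : ℕ) (s : Val) :
    iterateValue (fun x => PMF.pure (f x)) n s = PMF.pure (f^[n] s) := by
  induction n generalizing s with
  | zero => rfl
  | succ n ih => simp [iterateValue, ih]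

theorem Computable.iterate {f : Val → Val} (h : Computable f)
    (hgrow : ∃ q : Polynomial ℕ, ∀ n s, (f^[n] s).size ≤ q.eval (n + s.size)) :
    Computable fun x => f^[x.head.len] x.tail := by
  refine (Samplable.iterate h ?_).congr fun x => iterateValue_pure _ _ _
  obtain ⟨q, hq⟩ := hgrow
  refine ⟨q, fun n s s' hs' => ?_⟩
  rw [iterateValue_pure, PMF.mem_support_pure_iff] at hs'
  exact hs' ▸ hq n s

/-- A loop whose state grows by at most a constant in each iteration takes polynomial time. -/
theorem Computable.iterate_of_size_le {f : Val → Val} (h : Computable f) (c : ℕ)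
    (hc : ∀ s, (f s).size ≤ s.size + c) :
    Computable fun x => f^[x.head.len] x.tail := by
  have key : ∀ n s, (f^[n] s).size ≤ s.size + n * c := by
    intro n
    induction n with
    | zero => simp
    | succ n ih =>
      intro s
      have := ih (f s)
      have := hc s
      rw [Function.iterate_succ_apply]
      linarith
  refine h.iterate ⟨(1 + Polynomial.C c) * Polynomial.X, fun n s => (key n s).trans ?_⟩
  simp only [Polynomial.eval_mul, Polynomial.eval_add, Polynomial.eval_one, Polynomial.eval_C,
    Polynomial.eval_X]
  nlinarith

/-! ### Polynomial-time list processing -/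

namespace Val

@[simp] theorem toList_ofList (l : List Val) : (ofList l).toList = l := by
  induction l with
  | nil => rfl
  | cons a l ih => simp [ofList, toList, ih]

@[simp] theorem ofList_toList (x : Val) : ofList x.toList = x := by
  induction x with
  | nil => rfl
  | cons a b _ ih => simp [ofList, toList, ih]

@[simp] theorem len_ofList (l : List Val) : (ofList l).len = l.length := by simp [len]

@[simp] theorem len_ofNat (n : ℕ) : (ofNat n).len = n := by simp [ofNat]

theorem size_ofNat (n : ℕ) : (ofNat n).size = 2 * n + 1 := by
  induction n with
  | zero => rfl
  | succ n ih =>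
    change (cons nil (ofNat n)).size = _
    simp only [size, ih]
    omega

theorem tail_ofNat (n : ℕ) : (ofNat n).tail = ofNat (n - 1) := by
  cases n <;> rfl

theorem ofNat_eq_nil {n : ℕ} : ofNat n = nil ↔ n = 0 := by
  cases n <;> simp [ofNat, ofList, List.replicate_succ]

theorem toList_iterate_tail (n : ℕ) (x : Val) : (tail^[n] x).toList = x.toList.drop n := by
  induction n generalizing x with
  | zero => rfl
  | succ n ih =>
    rw [Function.iterate_succ_apply, ih]
    cases x <;> simp [tail, toList]

theorem iterate_tail_ofList (n : ℕ) (l : List Val) :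
    tail^[n] (ofList l) = ofList (l.drop n) := by
  rw [← ofList_toList (tail^[n] _), toList_iterate_tail, toList_ofList]

theorem head_eq_getD (x : Val) : x.head = x.toList.getD 0 nil := by
  cases x <;> rfl

/-- The entry at position `n` of a list, `nil` beyond its end. -/
def nth (n : ℕ) (x : Val) : Val := (tail^[n] x).head

theorem nth_eq (n : ℕ) (x : Val) : nth n x = x.toList.getD n nil := by
  rw [nth, head_eq_getD, toList_iterate_tail]
  simp [List.getD_eq_getElem?_getD]

@[simp] theorem nth_ofList (n : ℕ) (l : List Val) : nth n (ofList l) = l.getD n nil := by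
  simp [nth_eq]

end Val

open Val

theorem Computable.drop {n f : Val → Val} (hn : Computable n) (hf : Computable f) :
    Computable fun x => Val.tail^[(n x).len] (f x) :=
  (computable_tail.iterate_of_size_le 0 fun s => s.size_tail_le).comp (hn.cons hf)

theorem Computable.nth {n f : Val → Val} (hn : Computable n) (hf : Computable f) :
    Computable fun x => Val.nth (n x).len (f x) :=
  (hn.drop hf).head

/-- Moves the first entry of the first list to the front of the second one. -/
def moveHead (s : Val) : Val := cons s.head.tail (cons s.head.head s.tail)

theorem iterate_moveHead (l r : List Val) :
    moveHead^[l.length] (cons (ofList l) (ofList r)) = cons nil (ofList (l.reverse ++ r)) := by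
  induction l generalizing r with
  | nil => simp [ofList]
  | cons a l ih =>
    rw [List.length_cons, Function.iterate_succ_apply]
    have : moveHead (cons (ofList (a :: l)) (ofList r)) = cons (ofList l) (ofList (a :: r)) := rfl
    rw [this, ih]
    simp

theorem computable_moveHead : Computable moveHead :=
  Computable.id.head.tail.cons (Computable.id.head.head.cons Computable.id.tail)

theorem Computable.reverseAppend {f g : Val → Val} (hf : Computable f) (hg : Computable g) :
    Computable fun x => ofList ((f x).toList.reverse ++ (g x).toList) := by
  have := (computable_moveHead.iterate_of_size_le 4 fun s => by
    rcases s with _ | ⟨_ | ⟨a, b⟩, c⟩ <;> simp [moveHead, Val.size, Val.head, Val.tail] <;> omega).comp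
    (hf.cons (hf.cons hg))
  refine this.tail.congr fun x => ?_
  have := iterate_moveHead (f x).toList (g x).toList
  simp only [ofList_toList] at this
  simp only [Val.head, Val.tail, len, this]

theorem Computable.reverse {f : Val → Val} (hf : Computable f) :
    Computable fun x => ofList (f x).toList.reverse :=
  (hf.reverseAppend Computable.nil).congr fun x => by simp [toList]

theorem Computable.append {f g : Val → Val} (hf : Computable f) (hg : Computable g) :
    Computable fun x => ofList ((f x).toList ++ (g x).toList) :=
  (hf.reverse.reverseAppend hg).congr fun x => by simp

/-- Independent samples, one for each entry of a list. -/
noncomputable def sampleList (h : Val → PMF Val) : List Val → PMF (List Val)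
  | [] => PMF.pure []
  | a :: l => (h a).bind fun b => (sampleList h l).map (b :: ·)

theorem sampleList_pure (f : Val → Val) (l : List Val) :
    sampleList (fun a => PMF.pure (f a)) l = PMF.pure (l.map f) := by
  induction l with
  | nil => rfl
  | cons a l ih => simp [sampleList, ih, PMF.pure_map]

/-- One iteration of the loop that samples from `κ (ctx, a)` for the entries `a` of a list. The
state consists of `ctx`, the remaining entries and the samples in reverse order. -/
noncomputable def sampleStep (κ : Val → PMF Val) (s : Val) : PMF Val :=
  (κ (cons s.head s.tail.head.head)).bind fun b =>
    PMF.pure (cons s.head (cons s.tail.head.tail (cons b s.tail.tail)))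

theorem iterateValue_sampleStep (κ : Val → PMF Val) (ctx : Val) (l r : List Val) :
    iterateValue (sampleStep κ) l.length (cons ctx (cons (ofList l) (ofList r))) =
      (sampleList (fun a => κ (cons ctx a)) l).map fun m =>
        cons ctx (cons nil (ofList (m.reverse ++ r))) := by
  induction l generalizing r with
  | nil => simp [iterateValue, sampleList, PMF.pure_map, ofList]
  | cons a l ih =>
    simp only [List.length_cons, iterateValue, sampleStep, sampleList, PMF.bind_bind,
      PMF.pure_bind, PMF.map_bind, PMF.map_comp]
    simp only [Val.head, Val.tail, ofList]
    congr 1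
    funext b
    have := ih (b :: r)
    simp only [ofList] at this
    rw [this]
    congr 1
    funext m
    simp

theorem size_iterateValue_sampleStep {κ : Val → PMF Val} {q : Polynomial ℕ}
    (hq : ∀ x, ∀ y ∈ (κ x).support, y.size ≤ q.eval x.size) (n : ℕ) (s : Val) :
    ∀ s' ∈ (iterateValue (sampleStep κ) n s).support,
      s'.size ≤ s.size + n * (q.eval (2 * s.size + 1) + 5) := by
  have key : ∀ m n : ℕ, ∀ s : Val, s.head.size + s.tail.head.size ≤ m →
      ∀ s' ∈ (iterateValue (sampleStep κ) n s).support,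
      s'.size ≤ s.size + n * (q.eval (m + 1) + 5) := by
    intro m n
    induction n with
    | zero =>
      intro s _ s' hs'
      simp only [iterateValue, PMF.mem_support_pure_iff] at hs'
      subst hs'
      simp
    | succ n ih =>
      intro s hs s' hs'
      rw [iterateValue, PMF.mem_support_bind_iff] at hs'
      obtain ⟨s₁, h₁, hs'⟩ := hs'
      simp only [sampleStep, PMF.mem_support_bind_iff, PMF.mem_support_pure_iff] at h₁
      obtain ⟨b, hb, rfl⟩ := h₁
      have h2 := ih _ (by
        have := s.tail.head.size_tail_le
        change s.head.size + s.tail.head.tail.size ≤ m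
        omega) s' hs'
      have h3 := hq _ b hb
      have h4 : q.eval (cons s.head s.tail.head.head).size ≤ q.eval (m + 1) :=
        eval_monotone q (by
          have := s.tail.head.size_head_le
          simp only [Val.size]
          omega)
      have h5 : s.head.size + s.tail.head.tail.size + s.tail.tail.size ≤ s.size + 2 := by
        rcases s with _ | ⟨a, _ | ⟨_ | ⟨c, d⟩, e⟩⟩ <;>
          simp [Val.size, Val.head, Val.tail] <;> omega
      simp only [Val.size] at h2
      rw [add_one_mul]
      omega
  intro s' hs'
  have h1 := key (2 * s.size) n s (by
    have := s.size_head_le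
    have := s.tail.size_head_le
    have := s.size_tail_le
    omega) s' hs'
  exact h1

/-- Independent samples from a samplable distribution can be drawn for all entries of a list. -/
theorem Samplable.sampleList {κ : Val → PMF Val} {c f : Val → Val} (h : Samplable κ)
    (hc : Computable c) (hf : Computable f) :
    Samplable fun x =>
      (sampleList (fun a => κ (cons (c x) a)) (f x).toList).map ofList := by
  have hstep : Samplable (sampleStep κ) := by
    have h1 : Samplable fun s : Val => κ (cons s.head s.tail.head.head) :=
      h.comp (Computable.id.head.cons Computable.id.tail.head.head)
    have h2 : Computable fun s : Val => cons s.tail.head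
        (cons s.tail.tail.head.tail (cons s.head s.tail.tail.tail)) :=
      Computable.id.tail.head.cons
        (Computable.id.tail.tail.head.tail.cons (Computable.id.head.cons Computable.id.tail.tail.tail))
    exact h1.bind h2
  obtain ⟨q, hq⟩ := h.size_le
  have hloop := (hstep.iterate ⟨Polynomial.X + Polynomial.X *
      (q.comp (2 * Polynomial.X + 1) + 5), fun n s s' hs' => by
    refine (size_iterateValue_sampleStep hq n s s' hs').trans ?_
    simp only [Polynomial.eval_add, Polynomial.eval_mul, Polynomial.eval_X, Polynomial.eval_comp,
      Polynomial.eval_one, Polynomial.eval_ofNat]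
    have h1 : q.eval (2 * s.size + 1) ≤ q.eval (2 * (n + s.size) + 1) :=
      eval_monotone q (by omega)
    have h2 : n * (q.eval (2 * s.size + 1) + 5) ≤ (n + s.size) * (q.eval (2 * (n + s.size) + 1) + 5) :=
      Nat.mul_le_mul (by omega) (by omega)
    omega⟩).comp (hf.cons (hc.cons (hf.cons Computable.nil)))
  refine (hloop.map Computable.id.tail.tail.reverse).congr fun x => ?_
  have := iterateValue_sampleStep κ (c x) (f x).toList []
  simp only [ofList_toList, ofList] at this
  simp only [Val.head, Val.tail, len, this, PMF.map_comp]
  congr 1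
  funext m
  simp

theorem Computable.map {h c f : Val → Val} (hh : Computable h) (hc : Computable c)
    (hf : Computable f) :
    Computable fun x => ofList ((f x).toList.map fun a => h (Val.cons (c x) a)) :=
  (Samplable.sampleList hh hc hf).congr fun x => by
    rw [sampleList_pure (fun a => h (Val.cons (c x) a)), PMF.pure_map]

theorem Computable.unary {f : Val → Val} (hf : Computable f) :
    Computable fun x => ofNat (f x).len :=
  (Computable.map Computable.nil Computable.nil hf).congr fun x => by
    simp [ofNat, len]

/-- Moves the first entry of the first list to the front of the second one, unless it is `nil`. -/
def moveHeadIf (s : Val) : Val :=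
  if s.head.head = nil then cons s.head.tail s.tail else moveHead s

theorem iterate_moveHeadIf (l r : List Val) :
    moveHeadIf^[l.length] (cons (ofList l) (ofList r)) =
      cons nil (ofList ((l.filter fun a => decide (a ≠ nil)).reverse ++ r)) := by
  induction l generalizing r with
  | nil => simp [ofList]
  | cons a l ih =>
    rw [List.length_cons, Function.iterate_succ_apply]
    by_cases ha : a = nil
    · have : moveHeadIf (cons (ofList (a :: l)) (ofList r)) = cons (ofList l) (ofList r) := by
        simp [moveHeadIf, ofList, Val.head, Val.tail, ha]
      rw [this, ih]
      simp [ha]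
    · have : moveHeadIf (cons (ofList (a :: l)) (ofList r)) = cons (ofList l) (ofList (a :: r)) := by
        simp [moveHeadIf, moveHead, ofList, Val.head, Val.tail, ha]
      rw [this, ih]
      simp [ha]

theorem Computable.filter_ne_nil {f : Val → Val} (hf : Computable f) :
    Computable fun x => ofList ((f x).toList.filter fun a => decide (a ≠ Val.nil)) := by
  have h1 : Computable moveHeadIf :=
    Computable.id.head.head.ite (Computable.id.head.tail.cons Computable.id.tail)
      computable_moveHead
  have h2 := ((h1.iterate_of_size_le 4 fun s => by
    rcases s with _ | ⟨_ | ⟨_ | a, b⟩, c⟩ <;>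
      simp [moveHeadIf, moveHead, Val.size, Val.head, Val.tail] <;> omega).comp
    (hf.cons (hf.cons Computable.nil))).tail.reverse
  refine h2.congr fun x => ?_
  have := iterate_moveHeadIf (f x).toList []
  simp only [ofList_toList, ofList] at this
  simp [Val.head, Val.tail, len, this]

/-- One iteration of the loop that lists the numbers below `n`. -/
def iotaStep (s : Val) : Val := cons s.head.tail (cons s.head.tail s.tail)

theorem iterate_iotaStep (n : ℕ) (l : List Val) :
    iotaStep^[n] (cons (ofNat n) (ofList l)) =
      cons nil (ofList ((List.range n).map ofNat ++ l)) := by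
  induction n generalizing l with
  | zero => simp [ofNat, ofList]
  | succ n ih =>
    have : iotaStep (cons (ofNat (n + 1)) (ofList l)) = cons (ofNat n) (ofList (ofNat n :: l)) := rfl
    rw [Function.iterate_succ_apply, this, ih, List.range_succ]
    simp

theorem Computable.range {f : Val → Val} (hf : Computable f) :
    Computable fun x => ofList ((List.range (f x).len).map ofNat) := by
  have h1 : Computable iotaStep :=
    Computable.id.head.tail.cons (Computable.id.head.tail.cons Computable.id.tail)
  have hsize : ∀ n s, (iotaStep^[n] s).size ≤ s.size + n * (s.head.size + 4) := by
    intro n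
    induction n with
    | zero => simp
    | succ n ih =>
      intro s
      have h2 := ih (iotaStep s)
      have h3 : (iotaStep s).head.size ≤ s.head.size := s.head.size_tail_le
      have h4 : (iotaStep s).size ≤ s.size + s.head.size + 4 := by
        rcases s with _ | ⟨_ | ⟨a, b⟩, c⟩ <;> simp [iotaStep, Val.size, Val.head, Val.tail] <;>
          omega
      rw [Function.iterate_succ_apply]
      have h5 := Nat.mul_le_mul_left n (add_le_add_left h3 4)
      rw [add_one_mul]
      omega
  have h2 := h1.iterate ⟨Polynomial.X + Polynomial.X * (Polynomial.X + 4), fun n s => by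
    refine (hsize n s).trans ?_
    have := s.size_head_le
    simp only [Polynomial.eval_add, Polynomial.eval_mul, Polynomial.eval_X,
      Polynomial.eval_ofNat]
    have : n * (s.head.size + 4) ≤ (n + s.size) * (n + s.size + 4) :=
      Nat.mul_le_mul (by omega) (by omega)
    omega⟩
  refine (h2.comp (hf.unary.cons (hf.unary.cons Computable.nil))).tail.congr fun x => ?_
  have := iterate_iotaStep (f x).len []
  simp only [ofList] at this
  simp [Val.head, Val.tail, this]

/-! ### Unary arithmetic -/

theorem Computable.unary_add {f g : Val → Val} (hf : Computable f) (hg : Computable g) :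
    Computable fun x => ofNat ((f x).len + (g x).len) :=
  (hf.append hg).unary.congr fun x => by simp [len]

theorem Computable.unary_mul {f g : Val → Val} (hf : Computable f) (hg : Computable g) :
    Computable fun x => ofNat ((f x).len * (g x).len) := by
  -- the state consists of a factor and the partial product
  have h1 : Computable fun s : Val => Val.cons s.head (ofNat (s.head.len + s.tail.len)) :=
    Computable.id.head.cons (Computable.id.head.unary_add Computable.id.tail)
  have hit : ∀ n s, (fun s : Val => Val.cons s.head (ofNat (s.head.len + s.tail.len)))^[n + 1] s =
      Val.cons s.head (ofNat ((n + 1) * s.head.len + s.tail.len)) := by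
    intro n
    induction n with
    | zero => intro s; simp
    | succ n ih =>
      intro s
      rw [Function.iterate_succ_apply, ih]
      simp only [Val.head, Val.tail, len_ofNat]
      congr 2
      ring
  have h2 := h1.iterate ⟨Polynomial.X + Polynomial.X + 2 * (Polynomial.X * Polynomial.X +
      Polynomial.X) + 2, fun n s => by
    have h3 := s.size_head_le
    have h4 := s.head.len_le_size
    have h5 := s.tail.len_le_size
    have h6 := s.size_tail_le
    simp only [Polynomial.eval_add, Polynomial.eval_mul, Polynomial.eval_X,
      Polynomial.eval_ofNat]
    cases n with
    | zero => simp; omega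
    | succ n =>
      rw [hit]
      simp only [Val.size, size_ofNat]
      have : (n + 1) * s.head.len ≤ (n + 1 + s.size) * (n + 1 + s.size) :=
        Nat.mul_le_mul (by omega) (by omega)
      omega⟩
  refine (h2.comp (hg.cons (hf.cons Computable.nil))).tail.unary.congr fun x => ?_
  simp only [head_cons, tail_cons]
  cases h : (g x).len with
  | zero => simp [len, toList]
  | succ n =>
    rw [hit]
    simp only [head_cons, tail_cons, len_ofNat]
    simp [len, toList, mul_comm]

theorem Computable.unary_eval {f : Val → Val} (hf : Computable f) (q : Polynomial ℕ) :
    Computable fun x => ofNat (q.eval (f x).len) := by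
  induction q using Polynomial.induction_on' with
  | add p q hp hq => exact (hp.unary_add hq).congr fun x => by simp
  | monomial n a =>
    induction n with
    | zero => exact (Computable.const (ofNat a)).congr fun x => by simp
    | succ n ih => exact (ih.unary_mul hf).congr fun x => by simp [pow_succ, mul_assoc]

/-- Comparison of unary numbers: the result is `nil` if and only if `m ≤ n`. -/
theorem iterate_tail_ofNat (m n : ℕ) : Val.tail^[n] (ofNat m) = ofNat (m - n) := by
  induction n generalizing m with
  | zero => rfl
  | succ n ih => rw [Function.iterate_succ_apply, tail_ofNat, ih]; congr 1; omega

theorem Computable.ite_le {f g u v : Val → Val} (hf : Computable f) (hg : Computable g)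
    (hu : Computable u) (hv : Computable v) :
    Computable fun x => if (f x).len ≤ (g x).len then u x else v x :=
  (Computable.ite (hg.drop hf.unary) hu hv).congr fun x => by
    simp [iterate_tail_ofNat, ofNat_eq_nil, Nat.sub_eq_zero_iff_le]

theorem Samplable.ite_le {f g : Val → Val} {u v : Val → PMF Val} (hf : Computable f)
    (hg : Computable g) (hu : Samplable u) (hv : Samplable v) :
    Samplable fun x => if (f x).len ≤ (g x).len then u x else v x :=
  (Samplable.ite (hg.drop hf.unary) hu hv).congr fun x => by
    simp [iterate_tail_ofNat, ofNat_eq_nil, Nat.sub_eq_zero_iff_le]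

/-! ### Simulation of programs with a memory -/

/-- The program that runs on `(ctx, x)` as `p` does on `x`, where the answers of the memory are
computed by `M` from `(ctx, address)`. -/
def Prog.sim (p M : Prog) : Prog :=
  match p with
  | .skip => .tail
  | .nil => .nil
  | .head => .seq .tail .head
  | .tail => .seq .tail .tail
  | .coin => .coin
  | .ask => M
  | .seq f g => .seq (.pair .head (f.sim M)) (g.sim M)
  | .pair f g => .pair (f.sim M) (g.sim M)
  | .ite c f g => .ite (c.sim M) (f.sim M) (g.sim M)
  | .loop f => .seq
      (.seq (.pair (.seq .tail .head) (.pair .head (.seq .tail .tail)))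
        (.loop (.pair .head (f.sim M))))
      .tail

theorem value_sim {M : Prog} {mem : Val → Val → Val}
    (hM : ∀ ctx a, M.value noMem (cons ctx a) = PMF.pure (mem ctx a)) (p : Prog) (ctx x : Val) :
    (p.sim M).value noMem (cons ctx x) = p.value (mem ctx) x := by
  induction p generalizing x with
  | skip => simp [Prog.sim, value_tail, value_skip]
  | nil => simp [Prog.sim, value_nil]
  | head => simp [Prog.sim, value_seq, value_tail, value_head]
  | tail => simp [Prog.sim, value_seq, value_tail]
  | coin => simp [Prog.sim, value_coin]
  | ask => simp [Prog.sim, value_ask, hM]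
  | seq f g ihf ihg =>
    simp [Prog.sim, value_seq, value_pair, value_head, ihf, PMF.bind_bind, ihg]
  | pair f g ihf ihg => simp [Prog.sim, value_pair, ihf, ihg]
  | ite c f g ihc ihf ihg => simp [Prog.sim, value_ite, ihc, ihf, ihg]
  | loop f ihf =>
    have key : ∀ n s, iterateValue ((Prog.pair .head (f.sim M)).value noMem) n (cons ctx s) =
        (iterateValue (f.value (mem ctx)) n s).map (cons ctx) := by
      intro n
      induction n with
      | zero => intro s; simp [iterateValue, PMF.pure_map]
      | succ n ih =>
        intro s
        simp [iterateValue, value_pair, value_head, ihf, PMF.bind_bind, PMF.map_bind, ih]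
    simp only [Prog.sim, value_seq, value_pair, value_tail, value_head, value_loop, PMF.pure_bind,
      head_cons, tail_cons, key, PMF.bind_map]
    rw [show Prog.tail.value noMem ∘ cons ctx = PMF.pure from funext fun s => value_tail _ _]
    exact PMF.bind_pure _

/-- The time bound for one instruction of a simulated program: `s` bounds the sizes of the data,
and `qM` the time that a memory access takes. -/
def simCost (qM : Polynomial ℕ) (s : ℕ) : ℕ := 30 * (s + 1) + qM.eval (s + 1)

theorem simCost_mono (qM : Polynomial ℕ) {s t : ℕ} (h : s ≤ t) : simCost qM s ≤ simCost qM t := by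
  have := eval_monotone qM (Nat.succ_le_succ h)
  simp only [simCost, Nat.succ_eq_add_one] at *
  omega

/-- A run of the simulated program corresponds to one of the original program, with a polynomial
slowdown. The summand `3 * (...)` leaves room for the overhead of one iteration of a loop. -/
theorem time_sim {M : Prog} {mem : Val → Val → Val} {qM : Polynomial ℕ}
    (hM : ∀ ctx a, M.value noMem (cons ctx a) = PMF.pure (mem ctx a))
    (hq : ∀ x, ∀ o ∈ (M.run noMem x).support, o.time ≤ qM.eval x.size)
    (p : Prog) (ctx x : Val) :
    ∀ o' ∈ ((p.sim M).run noMem (cons ctx x)).support, ∃ o ∈ (p.run (mem ctx) x).support,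
      o'.val = o.val ∧ ∀ B, o.time ≤ B →
        o'.time + 3 * (ctx.size + x.size + 2) ≤ o.time * simCost qM (ctx.size + B) := by
  have hleaf : ∀ (B t' t s : ℕ), s + 1 ≤ t → t ≤ B → t' ≤ 4 * (ctx.size + s + 2) →
      t' + 3 * (ctx.size + s + 2) ≤ t * simCost qM (ctx.size + B) := by
    intro B t' t s h1 h2 h3
    have : simCost qM (ctx.size + B) ≤ t * simCost qM (ctx.size + B) :=
      Nat.le_mul_of_pos_left _ (by omega)
    simp only [simCost] at *
    omega
  induction p generalizing x with
  | skip =>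
    intro o' ho'
    simp only [Prog.sim, Prog.run, PMF.mem_support_pure_iff] at ho' ⊢
    subst ho'
    refine ⟨_, rfl, rfl, fun B hB => hleaf B _ _ _ ?_ hB ?_⟩ <;> simp [Val.size]
    omega
  | nil =>
    intro o' ho'
    simp only [Prog.sim, Prog.run, PMF.mem_support_pure_iff] at ho' ⊢
    subst ho'
    refine ⟨_, rfl, rfl, fun B hB => hleaf B _ _ _ ?_ hB ?_⟩ <;> simp [Val.size]
    omega
  | head =>
    intro o' ho'
    simp only [Prog.sim, Prog.run, PMF.mem_support_pure_iff, PMF.pure_bind] at ho' ⊢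
    subst ho'
    refine ⟨_, rfl, rfl, fun B hB => hleaf B _ _ _ ?_ hB ?_⟩ <;> simp [Val.size]
    omega
  | tail =>
    intro o' ho'
    simp only [Prog.sim, Prog.run, PMF.mem_support_pure_iff, PMF.pure_bind] at ho' ⊢
    subst ho'
    refine ⟨_, rfl, rfl, fun B hB => hleaf B _ _ _ ?_ hB ?_⟩ <;> simp [Val.size]
    omega
  | coin =>
    intro o' ho'
    simp only [Prog.sim, Prog.run, PMF.mem_support_bind_iff, PMF.mem_support_pure_iff] at ho' ⊢
    obtain ⟨b, hb, rfl⟩ := ho'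
    have : (Val.ofBool b).size ≤ 3 := by rcases b with _ | _ <;> simp [Val.ofBool, Val.size]
    refine ⟨_, ⟨b, hb, rfl⟩, rfl, fun B hB => hleaf B _ _ _ ?_ hB ?_⟩ <;> simp [Val.size] <;> omega
  | ask =>
    intro o' ho'
    simp only [Prog.sim] at ho'
    have h1 : o'.val = mem ctx x := by
      have : o'.val ∈ (M.value noMem (cons ctx x)).support :=
        (PMF.mem_support_map_iff _ _ _).2 ⟨o', ho', rfl⟩
      rwa [hM, PMF.mem_support_pure_iff] at this
    have h2 := hq _ o' ho'
    simp only [Prog.run, PMF.mem_support_pure_iff]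
    refine ⟨_, rfl, h1, fun B hB => ?_⟩
    simp only at hB ⊢
    have h3 : qM.eval (cons ctx x).size ≤ qM.eval (ctx.size + B + 1) :=
      eval_monotone qM (by simp only [Val.size]; omega)
    have : simCost qM (ctx.size + B) ≤
        (1 + x.size + (mem ctx x).size) * simCost qM (ctx.size + B) :=
      Nat.le_mul_of_pos_left _ (by omega)
    simp only [simCost] at *
    omega
  | seq f g ihf ihg =>
    intro o' ho'
    simp only [Prog.sim, Prog.run, PMF.mem_support_bind_iff, PMF.mem_support_pure_iff,
      PMF.pure_bind, head_cons] at ho' ⊢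
    obtain ⟨_, ⟨a', ha', rfl⟩, b', hb', rfl⟩ := ho'
    obtain ⟨a, ha, hav, hat⟩ := ihf x a' ha'
    obtain ⟨b, hb, hbv, hbt⟩ := ihg a'.val b' hb'
    refine ⟨_, ⟨a, ha, b, hav ▸ hb, rfl⟩, hbv, fun B hB => ?_⟩
    simp only at hB ⊢
    have h1 := hat B (by omega)
    have h2 := hbt B (by omega)
    have h3 := hleaf B (3 * (ctx.size + x.size + 2)) (1 + x.size) x.size (by omega) (by omega)
      (by omega)
    simp only [add_mul, Val.size] at *
    omega
  | pair f g ihf ihg =>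
    intro o' ho'
    simp only [Prog.sim, Prog.run, PMF.mem_support_bind_iff, PMF.mem_support_pure_iff] at ho' ⊢
    obtain ⟨a', ha', b', hb', rfl⟩ := ho'
    obtain ⟨a, ha, hav, hat⟩ := ihf x a' ha'
    obtain ⟨b, hb, hbv, hbt⟩ := ihg x b' hb'
    refine ⟨_, ⟨a, ha, b, hb, rfl⟩, by simp only [hav, hbv], fun B hB => ?_⟩
    simp only at hB ⊢
    have h1 := hat B (by omega)
    have h2 := hbt B (by omega)
    have h3 := hleaf B (3 * (ctx.size + x.size + 2)) (1 + x.size) x.size (by omega) (by omega)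
      (by omega)
    simp only [add_mul, Val.size] at *
    omega
  | ite c f g ihc ihf ihg =>
    intro o' ho'
    simp only [Prog.sim, Prog.run, PMF.mem_support_bind_iff, PMF.mem_support_pure_iff] at ho' ⊢
    obtain ⟨a', ha', b', hb', rfl⟩ := ho'
    obtain ⟨a, ha, hav, hat⟩ := ihc x a' ha'
    have : ∃ b ∈ (if a.val = Val.nil then g.run (mem ctx) x else f.run (mem ctx) x).support,
        b'.val = b.val ∧ ∀ B, b.time ≤ B →
        b'.time + 3 * (ctx.size + x.size + 2) ≤ b.time * simCost qM (ctx.size + B) := by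
      rw [← hav]
      split_ifs at hb' ⊢
      · exact ihg x b' hb'
      · exact ihf x b' hb'
    obtain ⟨b, hb, hbv, hbt⟩ := this
    refine ⟨_, ⟨a, ha, b, hb, rfl⟩, hbv, fun B hB => ?_⟩
    simp only at hB ⊢
    have h1 := hat B (by omega)
    have h2 := hbt B (by omega)
    have h3 := hleaf B (3 * (ctx.size + x.size + 2)) (1 + x.size) x.size (by omega) (by omega)
      (by omega)
    simp only [add_mul, Val.size] at *
    omega
  | loop f ihf =>
    have key : ∀ n s, ∀ o' ∈ (iterate ((Prog.pair .head (f.sim M)).run noMem) n (cons ctx s)).support,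
        ∃ o ∈ (iterate (f.run (mem ctx)) n s).support, o'.val = cons ctx o.val ∧
          ∀ B, o.time ≤ B → o'.time ≤ o.time * simCost qM (ctx.size + B) := by
      intro n
      induction n with
      | zero =>
        intro s o' ho'
        simp only [iterate, PMF.mem_support_pure_iff] at ho' ⊢
        subst ho'
        exact ⟨_, rfl, rfl, fun B _ => by simp⟩
      | succ n ih =>
        intro s o' ho'
        obtain ⟨a', ha', b', hb', rfl⟩ := mem_support_iterate ho'
        simp only [Prog.run, PMF.mem_support_bind_iff, PMF.mem_support_pure_iff,
          PMF.pure_bind, head_cons] at ha'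
        obtain ⟨a', ha', rfl⟩ := ha'
        obtain ⟨a, ha, hav, hat⟩ := ihf s a' ha'
        obtain ⟨b, hb, hbv, hbt⟩ := ih a'.val b' hb'
        refine ⟨⟨b.val, a.time + b.time, a.accesses + b.accesses⟩, ?_, hbv, fun B hB => ?_⟩
        · simp only [iterate, PMF.mem_support_bind_iff, PMF.mem_support_pure_iff]
          exact ⟨a, ha, b, hav ▸ hb, rfl⟩
        · simp only at hB ⊢
          have h1 := hat B (by omega)
          have h2 := hbt B (by omega)
          simp only [add_mul, Val.size] at *
          omega
    intro o' ho'
    simp only [Prog.sim, Prog.run, PMF.mem_support_bind_iff, PMF.mem_support_pure_iff,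
      PMF.pure_bind, head_cons, tail_cons] at ho' ⊢
    obtain ⟨_, ⟨_, ⟨a', ha', rfl⟩, rfl⟩, rfl⟩ := ho'
    obtain ⟨a, ha, hav, hat⟩ := key x.head.len x.tail a' (by
      simpa only [Prog.run, PMF.pure_bind, head_cons] using ha')
    refine ⟨_, ⟨a, ha, rfl⟩, by simp only [hav, tail_cons], fun B hB => ?_⟩
    simp only [hav] at hB ⊢
    have h1 := hat B (by omega)
    have h2 : a.val.size ≤ x.tail.size + a.time :=
      size_le_time_iterate (fun s o ho => (size_le_time _ _ _ o ho).1) _ _ a ha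
    have h3 := x.size_head_le
    have h4 := x.size_tail_le
    have h5 : simCost qM (ctx.size + B) ≤ (1 + x.size) * simCost qM (ctx.size + B) :=
      Nat.le_mul_of_pos_left _ (by omega)
    simp only [add_mul, Val.size] at *
    simp only [simCost] at *
    omega

theorem Samplable.sim {p : Prog} {mem : Val → Val → Val} {c f : Val → Val}
    (hmem : Computable fun z => mem z.head z.tail) (hc : Computable c) (hf : Computable f)
    (hp : ∃ q : Polynomial ℕ, ∀ x, ∀ o ∈ (p.run (mem (c x)) (f x)).support,
      o.time ≤ q.eval x.size) :
    Samplable fun x => p.value (mem (c x)) (f x) := by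
  obtain ⟨M, ⟨qM, hqM⟩, hM⟩ := hmem
  have hM' : ∀ ctx a, M.value noMem (cons ctx a) = PMF.pure (mem ctx a) := fun ctx a => hM _
  obtain ⟨q, hq⟩ := hp
  obtain ⟨P, ⟨r, hr⟩, hP⟩ := hc.cons hf
  obtain ⟨qc, hqc⟩ := hc.size_le
  have hb : PolyBounded fun x =>
      1 + x.size + r.eval x.size + q.eval x.size * simCost qM (qc.eval x.size + q.eval x.size) := by
    have hs := PolyBounded.size
    have h1 := (hs.eval qc).add (hs.eval q)
    exact (((PolyBounded.const 1).add hs).add (hs.eval r)).add ((hs.eval q).mul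
      (((PolyBounded.const 30).mul (h1.add (.const 1))).add ((h1.add (.const 1)).eval qM)))
  obtain ⟨Q, hQ⟩ := hb
  refine ⟨.seq P (p.sim M), ⟨Q, fun x o ho => (?_ : _ ≤ _).trans (hQ x)⟩, fun x => ?_⟩
  · simp only [Prog.run, PMF.mem_support_bind_iff, PMF.mem_support_pure_iff] at ho
    obtain ⟨a, ha, b, hb, rfl⟩ := ho
    have h1 := hr x a ha
    have hav : a.val = cons (c x) (f x) := by
      have : a.val ∈ (P.dist x).support := (PMF.mem_support_map_iff _ _ _).2 ⟨a, ha, rfl⟩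
      rwa [hP, PMF.mem_support_pure_iff] at this
    rw [hav] at hb
    obtain ⟨o, ho, -, hot⟩ := time_sim hM' hqM p (c x) (f x) b hb
    have h2 := hot _ le_rfl
    have h3 := hq x o ho
    have h4 := simCost_mono qM (add_le_add (hqc x) h3)
    have h5 := Nat.mul_le_mul h3 h4
    simp only at *
    omega
  · have := value_seq noMem P (p.sim M) x
    change Prog.dist _ _ = (P.dist x).bind _ at this
    rw [this, hP, PMF.pure_bind]
    exact value_sim hM' p _ _

/-! ### The memory of an update, as a function of its description -/

theorem Computable.take {n f : Val → Val} (hn : Computable n) (hf : Computable f) :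
    Computable fun x => ofList ((f x).toList.take (n x).len) := by
  have h : Computable fun x => ofNat ((f x).len - (n x).len) :=
    (hn.drop hf.unary).congr fun x => iterate_tail_ofNat _ _
  refine (h.drop hf.reverse).reverse.congr fun x => ?_
  rw [iterate_tail_ofList, toList_ofList, len_ofNat, len, List.drop_reverse,
    List.reverse_reverse]
  congr 1
  rw [List.take_eq_take_iff]
  omega

theorem Computable.ofBits {f : Val → Val} (hf : Computable f) :
    Computable fun x => Val.ofBits (f x).toBits := by
  have h : Computable fun z : Val => if z.tail = Val.nil then Val.nil
      else Val.cons Val.nil Val.nil :=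
    Computable.id.tail.ite Computable.nil (Computable.const _)
  refine (h.map Computable.nil hf).congr fun x => ?_
  simp only [tail_cons, Val.ofBits, toBits, List.map_map]
  congr 1
  refine List.map_congr_left fun a _ => ?_
  by_cases ha : a = Val.nil <;> simp [ha, ofBool]

/-- The memory of an update, described by `lam` in unary, the old messages, the new messages, the
list of changes and the update information. -/
def describedMem (ctx a : Val) : Val :=
  if a.head = nil then nth a.tail.len ctx.tail.head else
  if a.head.tail = nil then nth a.tail.len ctx.tail.tail.head else
  if a.head.tail.tail = nil then nth a.tail.len ctx.tail.tail.tail.head else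
  Val.ofBits ((ctx.tail.tail.tail.tail.toBits.drop (ctx.head.len * a.tail.len)).take ctx.head.len)

theorem computable_describedMem : Computable fun z => describedMem z.head z.tail := by
  have hc : Computable fun z : Val => z.head := Computable.id.head
  have ha : Computable fun z : Val => z.tail := Computable.id.tail
  refine ha.head.ite (ha.tail.nth hc.tail.head) (ha.head.tail.ite (ha.tail.nth hc.tail.tail.head)
    (ha.head.tail.tail.ite (ha.tail.nth hc.tail.tail.tail.head) ?_))
  refine (Computable.take hc.head
    ((hc.head.unary_mul ha.tail).drop hc.tail.tail.tail.tail)).ofBits.congr fun z => ?_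
  simp [toBits, toList_iterate_tail, List.map_drop, List.map_take]

/-- The changes between two vectors, as triples of index, old and new message. -/
def changes (old new : List Val) : List Val :=
  (changed old new).map fun i => ofList [ofNat i, old.getD i nil, new.getD i nil]

theorem describedMem_eq (lam : Val) (old new : List Val) (u : Val) :
    describedMem (cons lam (cons (ofList old) (cons (ofList new)
      (cons (ofList (changes old new)) u)))) = updateMem lam.len old new u.toBits := by
  funext a
  simp only [describedMem, updateMem, head_cons, tail_cons, nth_ofList]
  rcases a.head with _ | ⟨a₁, _ | ⟨a₂, _ | ⟨a₃, a₄⟩⟩⟩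
  · simp [len, toList]
  · simp [len, toList]
  · simp only [reduceCtorEq, if_false, if_true, tail_cons, changes, len, toList, List.length_cons,
      List.length_nil, List.getD_eq_getElem?_getD, List.getElem?_map]
    cases (changed old new)[a.tail.toList.length]? <;> rfl
  · simp [len, toList]

/-! ### Comparison of messages -/

/-- One step of a comparison. The state consists of a flag, which is not `nil` once a difference has
been found, and of a list of pairs to be compared. -/
def diffStep (s : Val) : Val :=
  if s.tail = nil then s else
  if s.tail.head.head = nil then
    if s.tail.head.tail = nil then cons s.head s.tail.tail else cons (cons nil nil) s.tail.tail
  else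
    if s.tail.head.tail = nil then cons (cons nil nil) s.tail.tail else
    cons s.head (cons (cons s.tail.head.head.head s.tail.head.tail.head)
      (cons (cons s.tail.head.head.tail s.tail.head.tail.tail) s.tail.tail))

/-- Whether `t` steps of the comparison find a difference between `a` and `b`. The number of steps has
to be prescribed because a program repeats a loop as often as a list given in advance has entries.
If `t` is too small, then different messages may be regarded as equal, but never the other way
round. -/
def differ (t : ℕ) (a b : Val) : Prop := (diffStep^[t] (cons nil (cons (cons a b) nil))).head ≠ nil

instance (t : ℕ) (a b : Val) : Decidable (differ t a b) := inferInstanceAs (Decidable (_ ≠ _))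

theorem ne_of_differ {t : ℕ} {a b : Val} (h : differ t a b) : a ≠ b := by
  rintro rfl
  have key : ∀ t s, s.head = nil → (∀ p ∈ s.tail.toList, p.head = p.tail) →
      (diffStep^[t] s).head = nil := by
    intro t
    induction t with
    | zero => intro s h _; exact h
    | succ t ih =>
      intro s h1 h2
      rw [Function.iterate_succ_apply]
      rcases s with _ | ⟨f, _ | ⟨p, r⟩⟩
      · exact ih _ rfl (by simp [diffStep, toList])
      · exact ih _ h1 (by simp [diffStep, toList])
      · simp only [tail_cons, toList, List.mem_cons, forall_eq_or_imp, head_cons] at h1 h2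
        obtain ⟨hp, hr⟩ := h2
        by_cases hn : p.tail = nil
        · refine ih _ ?_ ?_ <;> simpa [diffStep, hp, hn]
        · refine ih _ ?_ ?_
          · simpa [diffStep, hp, hn] using h1
          · simpa [diffStep, hp, hn, toList] using hr
  exact h (key t _ rfl (by simp [toList]))

theorem differ_of_ne {t : ℕ} {a b : Val} (h : a ≠ b) (ht : a.size ≤ t) : differ t a b := by
  have key : ∀ t s, (s.tail.toList.map fun p => p.head.size).sum ≤ t →
      (s.head ≠ nil ∨ ∃ p ∈ s.tail.toList, p.head ≠ p.tail) → (diffStep^[t] s).head ≠ nil := by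
    intro t
    induction t with
    | zero =>
      intro s h1 h2
      rcases h2 with h2 | ⟨p, hp, -⟩
      · exact h2
      · have := List.single_le_sum (fun _ _ => Nat.zero_le _) _
          (List.mem_map_of_mem (f := fun p : Val => p.head.size) hp)
        have := p.head.size_pos
        omega
    | succ t ih =>
      intro s h1 h2
      rw [Function.iterate_succ_apply]
      rcases s with _ | ⟨f, _ | ⟨⟨⟩ | ⟨a, b⟩, r⟩⟩
      · simp [toList] at h2
      · exact ih _ (by simp [diffStep, toList]) (by simpa [diffStep, toList] using h2)
      · have h3 := (Val.nil).size_pos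
        simp only [tail_cons, toList, List.map_cons, List.sum_cons, head_nil] at h1
        refine ih _ ?_ ?_
        · simp [diffStep]
          omega
        · simpa [diffStep, toList] using h2
      · simp only [tail_cons, toList, List.map_cons, List.sum_cons, head_cons] at h1
        have h3 := a.size_pos
        refine ih _ ?_ ?_
        · rcases a with _ | ⟨a₁, a₂⟩ <;> rcases b with _ | ⟨b₁, b₂⟩ <;>
            simp [diffStep, toList, Val.size] at * <;> omega
        · rcases a with _ | ⟨a₁, a₂⟩ <;> rcases b with _ | ⟨b₁, b₂⟩ <;>
            simp [diffStep, toList] at *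
          · exact h2
          · tauto
  refine key t _ (by simpa [toList] using ht) (Or.inr ⟨cons a b, by simp [toList], h⟩)

theorem Computable.ite_differ {t a b u v : Val → Val} (ht : Computable t) (ha : Computable a)
    (hb : Computable b) (hu : Computable u) (hv : Computable v) :
    Computable fun x => if differ (t x).len (a x) (b x) then u x else v x := by
  have hi : Computable fun s : Val => s := Computable.id
  have h1 : Computable diffStep :=
    hi.tail.ite hi <| hi.tail.head.head.ite
      (hi.tail.head.tail.ite (hi.head.cons hi.tail.tail) ((Computable.const _).cons hi.tail.tail)) <|
      hi.tail.head.tail.ite ((Computable.const _).cons hi.tail.tail) <|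
      hi.head.cons ((hi.tail.head.head.head.cons hi.tail.head.tail.head).cons
        ((hi.tail.head.head.tail.cons hi.tail.head.tail.tail).cons hi.tail.tail))
  have h2 := h1.iterate_of_size_le 4 fun s => by
    rcases s with _ | ⟨f, _ | ⟨⟨⟩ | ⟨_ | ⟨a₁, a₂⟩, _ | ⟨b₁, b₂⟩⟩, r⟩⟩ <;>
      simp [diffStep, Val.size] <;> omega
  have h3 : Computable fun x => (diffStep^[(t x).len]
      (Val.cons Val.nil (Val.cons (Val.cons (a x) (b x)) Val.nil))).head :=
    (h2.comp (ht.cons (Computable.nil.cons ((ha.cons hb).cons Computable.nil)))).head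
  refine (h3.ite hv hu).congr fun x => ?_
  by_cases hd : differ (t x).len (a x) (b x)
  · rw [if_pos hd, if_neg hd]
  · rw [if_neg hd, if_pos (not_not.1 hd)]

/-! ### Changing messages -/

/-- The vector that results from `old` if the first `k` messages are replaced by those in `fresh`.
A message is replaced only if `t` steps of a comparison show that this changes it. -/
def replaceFirst (t k : ℕ) (old fresh : List Val) : List Val :=
  (List.range old.length).map fun j =>
    if j < k ∧ differ t (old.getD j nil) (fresh.getD j nil) then fresh.getD j nil
    else old.getD j nil

theorem getD_replaceFirst (t k : ℕ) (old fresh : List Val) (j : ℕ) :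
    (replaceFirst t k old fresh).getD j nil =
      if j < k ∧ j < old.length ∧ differ t (old.getD j nil) (fresh.getD j nil)
      then fresh.getD j nil else old.getD j nil := by
  by_cases hj : j < old.length
  · simp [replaceFirst, List.getD_eq_getElem?_getD, hj]
  · simp [replaceFirst, List.getD_eq_getElem?_getD, hj]

theorem changes_replaceFirst (t k : ℕ) (old fresh : List Val) :
    changes old (replaceFirst t k old fresh) =
      ((List.range old.length).map fun j =>
        if j < k ∧ differ t (old.getD j nil) (fresh.getD j nil) then
          ofList [ofNat j, old.getD j nil, fresh.getD j nil] else nil).filter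
        fun a => decide (a ≠ nil) := by
  rw [changes, changed, List.filter_map]
  have h1 : (List.range old.length).filter (fun i =>
      decide (old.getD i nil ≠ (replaceFirst t k old fresh).getD i nil)) =
      (List.range old.length).filter ((fun a => decide (a ≠ nil)) ∘ fun j =>
        if j < k ∧ differ t (old.getD j nil) (fresh.getD j nil) then
          ofList [ofNat j, old.getD j nil, fresh.getD j nil] else nil) := by
    refine List.filter_congr fun j hj => ?_
    rw [List.mem_range] at hj
    rw [getD_replaceFirst]
    simp only [Function.comp_apply, hj, true_and]
    by_cases hc : j < k ∧ differ t (old.getD j nil) (fresh.getD j nil)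
    · rw [if_pos hc, if_pos hc]
      simp only [ofList, ne_of_differ hc.2, ne_eq, not_false_eq_true, reduceCtorEq]
    · rw [if_neg hc, if_neg hc]
      simp only [ne_eq, not_true_eq_false]
  rw [h1]
  refine List.map_congr_left fun j hj => ?_
  rw [List.mem_filter, List.mem_range] at hj
  rw [getD_replaceFirst]
  by_cases hc : j < k ∧ differ t (old.getD j nil) (fresh.getD j nil)
  · rw [if_pos hc, if_pos ⟨hc.1, hj.1, hc.2⟩]
  · rw [Function.comp_apply, if_neg hc] at hj
    simp at hj

theorem Computable.map_range_ite_differ {t k old fresh u v : Val → Val} (hu : Computable u) (hv : Computable v)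
    (ht : Computable t) (hk : Computable k) (hold : Computable old) (hfresh : Computable fresh) :
    Computable fun x => ofList ((List.range (old x).toList.length).map fun j =>
      if j < (k x).len ∧ differ (t x).len ((old x).toList.getD j Val.nil)
        ((fresh x).toList.getD j Val.nil)
      then u (Val.cons (ofNat j) (Val.cons (old x) (fresh x)))
      else v (Val.cons (ofNat j) (Val.cons (old x) (fresh x)))) := by
  have hi : Computable fun s : Val => s := Computable.id
  -- the entries of the list are computed from `((t, k, old, fresh), j)`
  have harg : Computable fun z : Val => Val.cons z.tail z.head.tail.tail :=
    hi.tail.cons hi.head.tail.tail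
  have h1 : Computable fun z : Val => if z.head.tail.head.len ≤ z.tail.len then
      v (Val.cons z.tail z.head.tail.tail) else
      if differ z.head.head.len (Val.nth z.tail.len z.head.tail.tail.head)
        (Val.nth z.tail.len z.head.tail.tail.tail)
      then u (Val.cons z.tail z.head.tail.tail) else v (Val.cons z.tail z.head.tail.tail) :=
    hi.head.tail.head.ite_le hi.tail (hv.comp harg) (hi.head.head.ite_differ
      (hi.tail.nth hi.head.tail.tail.head) (hi.tail.nth hi.head.tail.tail.tail)
      (hu.comp harg) (hv.comp harg))
  refine (h1.map (ht.cons (hk.cons (hold.cons hfresh))) hold.range).congr fun x => ?_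
  simp only [toList_ofList, List.map_map]
  congr 1
  refine List.map_congr_left fun j _ => ?_
  simp only [Function.comp_apply, nth_eq, len_ofNat, head_cons, tail_cons]
  by_cases hj : j < (k x).len
  · rw [if_neg hj.not_ge]
    simp only [hj, true_and]
  · rw [if_pos (not_lt.1 hj), if_neg fun h => hj h.1]

theorem Computable.replaceFirst {t k old fresh : Val → Val} (ht : Computable t)
    (hk : Computable k) (hold : Computable old) (hfresh : Computable fresh) :
    Computable fun x => ofList
      (replaceFirst (t x).len (k x).len (old x).toList (fresh x).toList) := by
  have hi : Computable fun s : Val => s := Computable.id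
  refine (Computable.map_range_ite_differ (hi.head.nth hi.tail.tail) (hi.head.nth hi.tail.head)
    ht hk hold hfresh).congr fun x => ?_
  simp [VecCom.replaceFirst, nth_eq]

theorem Computable.changes_replaceFirst {t k old fresh : Val → Val} (ht : Computable t)
    (hk : Computable k) (hold : Computable old) (hfresh : Computable fresh) :
    Computable fun x => ofList (changes (old x).toList
      (VecCom.replaceFirst (t x).len (k x).len (old x).toList (fresh x).toList)) := by
  have hi : Computable fun s : Val => s := Computable.id
  refine (Computable.map_range_ite_differ (hi.head.cons ((hi.head.nth hi.tail.head).cons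
    ((hi.head.nth hi.tail.tail).cons Computable.nil))) Computable.nil
    ht hk hold hfresh).filter_ne_nil.congr fun x => ?_
  rw [VecCom.changes_replaceFirst]
  simp [nth_eq, ofList]

theorem Computable.set {i y f : Val → Val} (hi : Computable i) (hy : Computable y)
    (hf : Computable f) :
    Computable fun x => ofList ((f x).toList.set (i x).len (y x)) := by
  have hid : Computable fun s : Val => s := Computable.id
  -- the entries of the list are computed from `((i, y, f), j)`
  have h1 : Computable fun z : Val => if z.head.head.len ≤ z.tail.len then
      (if z.tail.len ≤ z.head.head.len then z.head.tail.head
        else Val.nth z.tail.len z.head.tail.tail)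
      else Val.nth z.tail.len z.head.tail.tail :=
    hid.head.head.ite_le hid.tail (hid.tail.ite_le hid.head.head hid.head.tail.head
      (hid.tail.nth hid.head.tail.tail)) (hid.tail.nth hid.head.tail.tail)
  refine (h1.map (hi.cons (hy.cons hf)) hf.range).congr fun x => ?_
  simp only [toList_ofList, List.map_map]
  congr 1
  refine List.ext_getElem (by simp [len]) fun j h₁ h₂ => ?_
  simp only [List.getElem_map, List.getElem_range, Function.comp, head_cons, tail_cons, len_ofNat,
    nth_eq, List.getElem_set]
  have h3 : j < (f x).toList.length := by simpa using h₂
  split_ifs <;> first | omega | simp [List.getD_eq_getElem?_getD, h3]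

/-! ### Guessing a number -/

/-- A fair coin. -/
noncomputable def coinFlip : PMF Val := (PMF.uniformOfFintype Bool).map Val.ofBool

theorem two_inv_le_coinFlip (b : Bool) : 2⁻¹ ≤ coinFlip (Val.ofBool b) := by
  rw [coinFlip, PMF.map_apply]
  refine le_trans ?_ (ENNReal.le_tsum b)
  simp

/-- One step of a random binary expansion: the state `(n, s)` is left as it is if `n ≤ s`;
otherwise, with probability `1 / 2` the first component is set to zero, which stops the process, and
else a random bit is appended to `s`. -/
noncomputable def doubleStep (st : Val) : PMF Val :=
  if st.head.len ≤ st.tail.len then PMF.pure st else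
  coinFlip.bind fun b => coinFlip.bind fun c => PMF.pure <|
    if b = nil then cons nil st.tail else
    if c = nil then cons st.head (ofNat (2 * st.tail.len)) else
    cons st.head (ofNat (2 * st.tail.len + 1))

/-- A random number that takes every value from `1` to `n` with at least inverse polynomial
probability. -/
noncomputable def guess (n : Val) : PMF Val :=
  (iterateValue doubleStep (n.len + 1) (cons n nil)).map Val.tail

theorem PMF.mul_le_bind {α β : Type*} (p : PMF α) (f : α → PMF β) (a : α) (b : β) :
    p a * f a b ≤ p.bind f b := by
  rw [PMF.bind_apply]
  exact ENNReal.le_tsum a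

theorem iterateValue_doubleStep_of_le {st : Val} (h : st.head.len ≤ st.tail.len) (m : ℕ) :
    iterateValue doubleStep m st = PMF.pure st := by
  induction m with
  | zero => rfl
  | succ m ih => simp [iterateValue, doubleStep, h, ih]

theorem doubleStep_stop_ge {st : Val} (h : ¬ st.head.len ≤ st.tail.len) :
    2⁻¹ ≤ doubleStep st (cons nil st.tail) := by
  rw [doubleStep, if_neg h]
  refine le_trans ?_ (PMF.mul_le_bind _ _ (Val.ofBool false) _)
  simpa [Val.ofBool] using two_inv_le_coinFlip false

theorem doubleStep_bit_ge {st : Val} (h : ¬ st.head.len ≤ st.tail.len) (c : Bool) :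
    4⁻¹ ≤ doubleStep st (cons st.head (ofNat (2 * st.tail.len + c.toNat))) := by
  rw [doubleStep, if_neg h]
  refine le_trans ?_ (PMF.mul_le_bind _ _ (Val.ofBool true) _)
  refine le_trans ?_ (mul_le_mul_right (PMF.mul_le_bind _ _ (Val.ofBool c) _) _)
  have h4 : (4⁻¹ : ENNReal) = 2⁻¹ * (2⁻¹ * 1) := by
    rw [mul_one, ← ENNReal.mul_inv (by simp) (by simp)]
    norm_num
  rw [h4]
  gcongr
  · exact two_inv_le_coinFlip true
  · exact two_inv_le_coinFlip c
  · cases c <;> simp [Val.ofBool]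

theorem iterateValue_doubleStep_ge {n k : ℕ} (hkn : k ≤ n) (j m : ℕ) (hjm : j + 1 ≤ m) :
    4⁻¹ ^ j * 2⁻¹ ≤ ((iterateValue doubleStep m (cons (ofNat n) (ofNat (k / 2 ^ j)))).map Val.tail)
      (ofNat k) := by
  have hle : (4⁻¹ : ENNReal) ^ j * 2⁻¹ ≤ 1 :=
    mul_le_one' (pow_le_one' (by simp) _) (by simp)
  have hstep : ∀ (m : ℕ) (st st' : Val), doubleStep st st' *
      ((iterateValue doubleStep m st').map Val.tail) (ofNat k) ≤
      ((iterateValue doubleStep (m + 1) st).map Val.tail) (ofNat k) := by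
    intro m st st'
    rw [iterateValue, PMF.map_bind]
    exact PMF.mul_le_bind _ _ _ _
  induction j generalizing m with
  | zero =>
    obtain ⟨m, rfl⟩ := Nat.exists_eq_add_of_le' hjm
    rw [pow_zero, pow_zero, Nat.div_one, one_mul]
    by_cases h : n ≤ k
    · rw [iterateValue_doubleStep_of_le (by simpa using h)]
      simp [PMF.pure_map]
    · refine le_trans ?_ (hstep m _ (cons nil (ofNat k)))
      rw [iterateValue_doubleStep_of_le (by simp [len, toList])]
      simpa [PMF.pure_map] using doubleStep_stop_ge (st := cons (ofNat n) (ofNat k)) (by simpa using h)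
  | succ j ih =>
    obtain ⟨m, rfl⟩ := Nat.exists_eq_add_of_le' (show 1 ≤ m by omega)
    by_cases h : n ≤ k / 2 ^ (j + 1)
    · -- this happens only if no bit has been removed, so that the process has reached `k`
      have h1 : k / 2 ^ (j + 1) = k :=
        le_antisymm (Nat.div_le_self _ _) (hkn.trans h)
      rw [iterateValue_doubleStep_of_le (by simpa using h), h1]
      simpa [PMF.pure_map] using hle
    · have h1 : 2 * (k / 2 ^ (j + 1)) + (decide (k / 2 ^ j % 2 = 1)).toNat = k / 2 ^ j := by
        rw [pow_succ, ← Nat.div_div_eq_div_mul]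
        rcases Nat.mod_two_eq_zero_or_one (k / 2 ^ j) with h2 | h2 <;> simp [h2] <;> omega
      refine le_trans ?_ (hstep m _ (cons (ofNat n) (ofNat (k / 2 ^ j))))
      rw [pow_succ', mul_assoc]
      gcongr
      · have := doubleStep_bit_ge (st := cons (ofNat n) (ofNat (k / 2 ^ (j + 1))))
          (by simpa using h) (decide (k / 2 ^ j % 2 = 1))
        simp only [head_cons, tail_cons, len_ofNat, h1] at this
        exact this
      · exact ih m (by omega) (mul_le_one' (pow_le_one' (by simp) _) (by simp))

theorem guess_ge {n k : ℕ} (hk : 1 ≤ k) (hkn : k ≤ n) :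
    ((8 * n ^ 2 : ℕ) : ENNReal)⁻¹ ≤ guess (ofNat n) (ofNat k) := by
  have h1 := iterateValue_doubleStep_ge hkn (Nat.log 2 k + 1) (n + 1) (by
    have := Nat.log_lt_self 2 (x := k) (by omega)
    omega)
  rw [Nat.div_eq_of_lt (Nat.lt_pow_succ_log_self (by norm_num) k)] at h1
  rw [guess, len_ofNat]
  refine le_trans ?_ h1
  have h2 : 2 ^ Nat.log 2 k ≤ n := (Nat.pow_log_le_self 2 (by omega)).trans hkn
  have h3 : 4 ^ (Nat.log 2 k + 1) * 2 ≤ 8 * n ^ 2 := by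
    rw [pow_succ, show 4 = 2 ^ 2 from rfl, ← pow_mul, mul_comm 2, pow_mul]
    nlinarith [Nat.pow_le_pow_left h2 2]
  rw [← ENNReal.inv_pow, ← ENNReal.mul_inv (by simp) (by simp)]
  refine ENNReal.inv_le_inv.2 ?_
  exact_mod_cast h3

theorem samplable_guess : Samplable guess := by
  have hi : Computable fun s : Val => s := Computable.id
  have hstep : Samplable doubleStep := by
    have h1 : Computable fun e : Val => if e.tail.head = nil then cons nil e.tail.tail.tail else
        if e.head = nil then cons e.tail.tail.head (ofNat ((2 * Polynomial.X).eval e.tail.tail.tail.len))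
        else cons e.tail.tail.head (ofNat ((2 * Polynomial.X + 1).eval e.tail.tail.tail.len)) :=
      hi.tail.head.ite (Computable.nil.cons hi.tail.tail.tail) <| hi.head.ite
        (hi.tail.tail.head.cons (hi.tail.tail.tail.unary_eval _))
        (hi.tail.tail.head.cons (hi.tail.tail.tail.unary_eval _))
    have h2 : Samplable fun st => coinFlip.bind fun b => coinFlip.bind fun c => PMF.pure <|
        if b = nil then cons nil st.tail else
        if c = nil then cons st.head (ofNat (2 * st.tail.len)) else
        cons st.head (ofNat (2 * st.tail.len + 1)) :=
      (samplable_coin.bind (samplable_coin.bind h1)).congr fun x => by simp [coinFlip]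
    exact Samplable.ite_le hi.head hi.tail hi h2
  have hgrow : ∀ (B n : ℕ) (s : Val), s.tail.size ≤ B → 4 * s.head.size + 3 ≤ B →
      ∀ s' ∈ (iterateValue doubleStep n s).support, s'.head.size ≤ s.head.size ∧ s'.tail.size ≤ B := by
    intro B n
    induction n with
    | zero =>
      intro s h1 h2 s' hs'
      simp only [iterateValue, PMF.mem_support_pure_iff] at hs'
      subst hs'
      omega
    | succ n ih =>
      intro s h1 h2 s' hs'
      rw [iterateValue, PMF.mem_support_bind_iff] at hs'
      obtain ⟨s₁, hs₁, hs'⟩ := hs'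
      have h3 : s₁.head.size ≤ s.head.size ∧ s₁.tail.size ≤ B := by
        rw [doubleStep] at hs₁
        split_ifs at hs₁ with hle
        · rw [PMF.mem_support_pure_iff] at hs₁
          subst hs₁
          exact ⟨le_rfl, h1⟩
        · simp only [PMF.mem_support_bind_iff, PMF.mem_support_pure_iff] at hs₁
          obtain ⟨b, -, c, -, rfl⟩ := hs₁
          have h4 := s.head.len_le_size
          have h5 := s.head.size_pos
          split_ifs <;> simp only [head_cons, tail_cons, size_ofNat, Val.size] <;> omega
      have h6 := ih s₁ h3.2 (by omega) s' hs'
      omega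
  have h := (hstep.iterate ⟨6 * Polynomial.X + 4, fun n s s' hs' => by
    have h1 := hgrow (s.tail.size + (4 * s.head.size + 3)) n s (by omega) (by omega) s' hs'
    have h2 := s'.size_le_head_tail
    have h3 := s.size_head_le
    have h4 := s.size_tail_le
    simp only [Polynomial.eval_add, Polynomial.eval_mul, Polynomial.eval_X, Polynomial.eval_ofNat]
    omega⟩).comp ((Computable.nil.cons hi).cons (hi.cons Computable.nil))
  exact (h.map computable_tail).congr fun x => by
    simp [guess, len, toList]

/-! ### The adversary -/

/-- The description of an update for `describedMem`. -/
def description (lam : Val) (old new : List Val) (u : Val) : Val :=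
  cons lam (cons (ofList old) (cons (ofList new) (cons (ofList (changes old new)) u)))

namespace DynamicVC

variable (vc : DynamicVC)

/-- The attack on the position-binding property. On input `(lam, n, pp, i)` it guesses a number `k`
of changes, and honestly commits to random messages and replaces the first `k` of them by other
random messages. Then it runs the algorithm for the update of the proof of user `i`, but claims that
the new message of user `i` is another one, `y`. If the resulting proof is valid for the honest new
commitment, then it opens this commitment to `y`, and `Open` opens it to the true message.
The polynomial `q` is used to bound the size of messages when these are compared. -/
noncomputable def attack (S : Prog) (q : Polynomial ℕ) (x : Val) : PMF Val :=
  (guess x.tail.head).bind fun k =>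
  ((sampleList (fun _ => S.dist (ofList [x.head, x.tail.head, x.tail.tail.head]))
    x.tail.head.toList).map ofList).bind fun old =>
  ((sampleList (fun _ => S.dist (ofList [x.head, x.tail.head, x.tail.tail.head]))
    x.tail.head.toList).map ofList).bind fun fresh =>
  (vc.commit.dist (ofList [x.tail.tail.head, old])).bind fun c =>
  (vc.update.dist (ofList [x.tail.tail.head, c.head, old,
    ofList (replaceFirst (q.eval (x.head.len + x.tail.head.len)) k.len old.toList fresh.toList),
    c.tail])).bind fun r =>
  (vc.openProof.dist (ofList [x.tail.tail.head, nth x.tail.tail.tail.head.len old,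
    x.tail.tail.tail.head, c.tail])).bind fun π =>
  (S.dist (ofList [x.head, x.tail.head, x.tail.tail.head])).bind fun y =>
  (vc.proofUpdate.value (describedMem (description x.head old.toList
      (replaceFirst (q.eval (x.head.len + x.tail.head.len)) k.len old.toList
        (fresh.toList.set x.tail.tail.tail.head.len y)) r.tail.head))
    (ofList [x.tail.tail.head, c.head, π,
      nth x.tail.tail.tail.head.len (ofList (replaceFirst (q.eval (x.head.len + x.tail.head.len))
        k.len old.toList (fresh.toList.set x.tail.tail.tail.head.len y))),
      x.tail.tail.tail.head])).bind fun o =>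
  (vc.openProof.dist (ofList [x.tail.tail.head,
    nth x.tail.tail.tail.head.len (ofList (replaceFirst (q.eval (x.head.len + x.tail.head.len))
      k.len old.toList fresh.toList)), x.tail.tail.tail.head, r.tail.tail])).bind fun π' =>
  PMF.pure (ofList [r.head,
    nth x.tail.tail.tail.head.len (ofList (replaceFirst (q.eval (x.head.len + x.tail.head.len))
      k.len old.toList fresh.toList)),
    nth x.tail.tail.tail.head.len (ofList (replaceFirst (q.eval (x.head.len + x.tail.head.len))
      k.len old.toList (fresh.toList.set x.tail.tail.tail.head.len y))),
    π', o.tail])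

end DynamicVC

/-- A variant of `Samplable.bind` that does not mention the environment. -/
theorem Samplable.bind' {κ : Val → PMF Val} {F : Val → Val → PMF Val} (h : Samplable κ)
    (h' : Samplable fun e => F e.tail e.head) : Samplable fun x => (κ x).bind fun a => F x a :=
  (h.bind h').congr fun _ => rfl

theorem Computable.ofList₃ {f g h : Val → Val} (hf : Computable f) (hg : Computable g)
    (hh : Computable h) : Computable fun x => ofList [f x, g x, h x] :=
  hf.cons (hg.cons (hh.cons Computable.nil))

theorem Computable.ofList₄ {f g h k : Val → Val} (hf : Computable f) (hg : Computable g)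
    (hh : Computable h) (hk : Computable k) : Computable fun x => ofList [f x, g x, h x, k x] :=
  hf.cons (hg.cons (hh.cons (hk.cons Computable.nil)))

theorem Computable.ofList₅ {f g h k l : Val → Val} (hf : Computable f) (hg : Computable g)
    (hh : Computable h) (hk : Computable k) (hl : Computable l) :
    Computable fun x => ofList [f x, g x, h x, k x, l x] :=
  hf.cons (hg.cons (hh.cons (hk.cons (hl.cons Computable.nil))))

/-- `replaceFirst` with a comparison bound that is polynomial in `m` and `n`. -/
theorem Computable.replaceFirst_eval (q : Polynomial ℕ) {m n k old fresh : Val → Val}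
    (hm : Computable m) (hn : Computable n) (hk : Computable k) (hold : Computable old)
    (hfresh : Computable fresh) :
    Computable fun x => ofList (VecCom.replaceFirst (q.eval ((m x).len + (n x).len)) (k x).len
      (old x).toList (fresh x).toList) :=
  (Computable.replaceFirst ((hm.unary_add hn).unary_eval q) hk hold hfresh).congr fun x => by simp

/-- The update of a proof can be simulated when the memory is given by its description. -/
theorem DynamicVC.samplable_proofUpdate (vc : DynamicVC) {lam u f : Val → Val}
    {old new : Val → List Val} (hlam : Computable lam) (hu : Computable u) (hf : Computable f)
    (hold : Computable fun x => ofList (old x)) (hnew : Computable fun x => ofList (new x))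
    (hch : Computable fun x => ofList (changes (old x) (new x))) :
    Samplable fun x =>
      vc.proofUpdate.value (describedMem (description (lam x) (old x) (new x) (u x))) (f x) := by
  have hdesc : Computable fun x => VecCom.description (lam x) (old x) (new x) (u x) :=
    hlam.cons (hold.cons (hnew.cons (hch.cons hu)))
  refine Samplable.sim computable_describedMem hdesc hf ?_
  obtain ⟨q, hq⟩ := vc.proofUpdate_ppt
  obtain ⟨r, hr⟩ := (((((hlam.polyBounded.add hold.polyBounded).add hnew.polyBounded).add
    hu.polyBounded).add hf.polyBounded).eval q)
  refine ⟨r, fun x o ho => le_trans ?_ (hr x)⟩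
  rw [description, describedMem_eq] at ho
  refine (hq _ _ _ _ _ o ho).trans (eval_monotone q ?_)
  have h1 := (lam x).len_le_size
  have h2 : (u x).toBits.length ≤ (u x).size := by
    simpa [toBits, len] using (u x).len_le_size
  omega

theorem DynamicVC.samplable_attack (vc : DynamicVC) {S : Prog} (hS : S.IsPPT) (q : Polynomial ℕ) :
    Samplable (vc.attack S q) := by
  have hi : Computable fun s : Val => s := Computable.id
  -- the input of the sampler, the first vector, and so on, relative to the current environment
  have hinp : ∀ {e : Val → Val}, Computable e →
      Computable fun x => ofList [(e x).head, (e x).tail.head, (e x).tail.tail.head] :=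
    fun he => he.head.ofList₃ he.tail.head he.tail.tail.head
  have hsample : ∀ {e : Val → Val}, Computable e → Samplable fun x =>
      (sampleList (fun _ => S.dist (ofList [(e x).head, (e x).tail.head, (e x).tail.tail.head]))
        (e x).tail.head.toList).map ofList := fun he =>
    (Samplable.sampleList ((samplable_dist hS).comp hi.head) (hinp he) he.tail.head).congr
      fun x => rfl
  unfold attack
  refine Samplable.bind' (samplable_guess.comp hi.tail.head) ?_
  refine Samplable.bind' (hsample hi.tail) ?_
  refine Samplable.bind' (hsample hi.tail.tail) ?_
  refine Samplable.bind' ((samplable_dist vc.commit_ppt).comp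
    (hi.tail.tail.tail.tail.tail.head.cons (hi.tail.head.cons .nil))) ?_
  have hx := hi.tail.tail.tail.tail
  refine Samplable.bind' ((samplable_dist vc.update_ppt).comp
    (hx.tail.tail.head.ofList₅ hi.head.head hi.tail.tail.head
      (.replaceFirst_eval q hx.head hx.tail.head hi.tail.tail.tail.head hi.tail.tail.head
        hi.tail.head) hi.head.tail)) ?_
  have hx := hx.tail
  refine Samplable.bind' ((samplable_dist vc.openProof_ppt).comp
    (hx.tail.tail.head.ofList₄ (hx.tail.tail.tail.head.nth hi.tail.tail.tail.head)
      hx.tail.tail.tail.head hi.tail.head.tail)) ?_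
  have hx := hx.tail
  refine Samplable.bind' ((samplable_dist hS).comp (hinp hx)) ?_
  have hx := hx.tail
  have hfresh := (hx.tail.tail.tail.head.set hi.head hi.tail.tail.tail.tail.head)
  have ht := (hx.head.unary_add hx.tail.head).unary_eval q
  have hk := hi.tail.tail.tail.tail.tail.tail.head
  have hold := hi.tail.tail.tail.tail.tail.head
  have hnew := (Computable.replaceFirst ht hk hold hfresh).congr fun x => by
    rw [len_ofNat, len_ofNat, toList_ofList]
  have hch := (Computable.changes_replaceFirst ht hk hold hfresh).congr fun x => by
    rw [len_ofNat, len_ofNat, toList_ofList]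
  refine Samplable.bind' (vc.samplable_proofUpdate hx.head hi.tail.tail.head.tail.head
    (hx.tail.tail.head.ofList₅ hi.tail.tail.tail.head.head hi.tail.head
      (hx.tail.tail.tail.head.nth hnew) hx.tail.tail.tail.head) (hold.congr fun x => by simp)
      hnew hch) ?_
  have hx := hx.tail
  have hhonest := Computable.replaceFirst_eval q hx.head hx.tail.head
    hi.tail.tail.tail.tail.tail.tail.tail.head hi.tail.tail.tail.tail.tail.tail.head
    hi.tail.tail.tail.tail.tail.head
  refine Samplable.bind' ((samplable_dist vc.openProof_ppt).comp
    (hx.tail.tail.head.ofList₄ (hx.tail.tail.tail.head.nth hhonest)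
      hx.tail.tail.tail.head hi.tail.tail.tail.head.tail.tail)) ?_
  exact hi.tail.tail.tail.tail.head.head.ofList₅
    (hx.tail.tail.tail.tail.head.nth (hhonest.comp hi.tail))
    (hx.tail.tail.tail.tail.head.nth (hnew.comp hi.tail.tail)) hi.head hi.tail.head.tail

open scoped ENNReal

/-! ### Expectations -/

/-- The expectation of `f` under `p`. -/
noncomputable def expect {α : Type*} (p : PMF α) (f : α → ℝ≥0∞) : ℝ≥0∞ := ∑' a, p a * f a

section expect

variable {α β : Type*}

theorem expect_pure (a : α) (f : α → ℝ≥0∞) : expect (PMF.pure a) f = f a := by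
  classical
  rw [expect, tsum_eq_single a]
  · simp
  · intro b hb
    simp [PMF.pure_apply, hb]

theorem expect_bind (p : PMF α) (k : α → PMF β) (f : β → ℝ≥0∞) :
    expect (p.bind k) f = expect p fun a => expect (k a) f := by
  simp only [expect, PMF.bind_apply, ← ENNReal.tsum_mul_right, ← ENNReal.tsum_mul_left, mul_assoc]
  exact ENNReal.tsum_comm

theorem expect_map (p : PMF α) (h : α → β) (f : β → ℝ≥0∞) :
    expect (p.map h) f = expect p fun a => f (h a) := by
  rw [PMF.map, expect_bind]
  simp [expect_pure]

theorem expect_mono_of_mem {p : PMF α} {f g : α → ℝ≥0∞} (h : ∀ a ∈ p.support, f a ≤ g a) :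
    expect p f ≤ expect p g := by
  refine ENNReal.tsum_le_tsum fun a => ?_
  by_cases ha : p a = 0
  · simp [ha]
  · exact mul_le_mul_right (h a ((PMF.mem_support_iff _ _).2 ha)) _

theorem expect_mono {p : PMF α} {f g : α → ℝ≥0∞} (h : ∀ a, f a ≤ g a) :
    expect p f ≤ expect p g :=
  expect_mono_of_mem fun a _ => h a

theorem expect_congr_of_mem {p : PMF α} {f g : α → ℝ≥0∞} (h : ∀ a ∈ p.support, f a = g a) :
    expect p f = expect p g :=
  le_antisymm (expect_mono_of_mem fun a ha => (h a ha).le)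
    (expect_mono_of_mem fun a ha => (h a ha).ge)

theorem expect_const (p : PMF α) (c : ℝ≥0∞) : (expect p fun _ => c) = c := by
  rw [expect, ENNReal.tsum_mul_right, p.tsum_coe, one_mul]

theorem expect_le_of_mem {p : PMF α} {f : α → ℝ≥0∞} {c : ℝ≥0∞} (h : ∀ a ∈ p.support, f a ≤ c) :
    expect p f ≤ c :=
  (expect_mono_of_mem h).trans (expect_const p c).le

theorem le_expect_of_mem {p : PMF α} {f : α → ℝ≥0∞} {c : ℝ≥0∞} (h : ∀ a ∈ p.support, c ≤ f a) :
    c ≤ expect p f :=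
  (expect_const p c).ge.trans (expect_mono_of_mem h)

theorem expect_add (p : PMF α) (f g : α → ℝ≥0∞) :
    (expect p fun a => f a + g a) = expect p f + expect p g := by
  simp only [expect, mul_add]
  exact ENNReal.tsum_add

theorem expect_const_mul (p : PMF α) (c : ℝ≥0∞) (f : α → ℝ≥0∞) :
    (expect p fun a => c * f a) = c * expect p f := by
  simp only [expect, ← ENNReal.tsum_mul_left]
  exact tsum_congr fun a => by ring

theorem expect_mul_const (p : PMF α) (f : α → ℝ≥0∞) (c : ℝ≥0∞) :
    (expect p fun a => f a * c) = expect p f * c := by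
  simp_rw [mul_comm _ c]
  exact expect_const_mul p c f

theorem expect_sum {ι : Type*} (s : Finset ι) (p : PMF α) (f : ι → α → ℝ≥0∞) :
    (expect p fun a => ∑ i ∈ s, f i a) = ∑ i ∈ s, expect p (f i) := by
  classical
  induction s using Finset.induction_on with
  | empty => simp [expect]
  | insert i s hi ih => simp only [Finset.sum_insert hi, ← ih, ← expect_add]

theorem expect_tsum {ι : Type*} (p : PMF α) (f : ι → α → ℝ≥0∞) :
    (expect p fun a => ∑' i, f i a) = ∑' i, expect p (f i) := by
  simp only [expect, ← ENNReal.tsum_mul_left]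
  exact ENNReal.tsum_comm

theorem expect_comm (p : PMF α) (p' : PMF β) (f : α → β → ℝ≥0∞) :
    (expect p fun a => expect p' (f a)) = expect p' fun b => expect p fun a => f a b := by
  have h := congrArg (fun r => expect r id)
    (PMF.bind_comm p p' fun a b => PMF.pure (f a b))
  simpa only [expect_bind, expect_pure, id] using h

theorem mul_le_expect (p : PMF α) (f : α → ℝ≥0∞) (a : α) : p a * f a ≤ expect p f :=
  ENNReal.le_tsum a

theorem expect_one_sub {p : PMF α} {f : α → ℝ≥0∞} (h : ∀ a, f a ≤ 1) :
    (expect p fun a => 1 - f a) = 1 - expect p f := by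
  refine ENNReal.eq_sub_of_add_eq ?_ ?_
  · exact ((expect_le_of_mem fun a _ => h a).trans_lt ENNReal.one_lt_top).ne
  · rw [← expect_add, show (fun a => 1 - f a + f a) = fun _ => 1 from
      funext fun a => tsub_add_cancel_of_le (h a), expect_const]

open Classical in
theorem expect_apply_true (p : PMF Prop) : p True = expect p fun b => if b then 1 else 0 := by
  rw [expect, tsum_eq_single True]
  · simp
  · intro b hb
    have : ¬ b := fun h => hb (eq_true h)
    simp [this]

theorem expect_ite_eq [DecidableEq α] (p : PMF α) (a : α) :
    (expect p fun b => if b = a then 1 else 0) = p a := by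
  rw [expect, tsum_eq_single a]
  · simp
  · intro b hb
    simp [hb]

end expect

/-! ### The addresses that a program reads -/

/-- Sequential composition of computations that record the addresses they read. -/
noncomputable def traceThen (P : PMF (Val × List Val)) (f : Val → PMF (Val × List Val))
    (h : Val → Val → Val) : PMF (Val × List Val) :=
  P.bind fun a => (f a.1).bind fun b => PMF.pure (h a.1 b.1, a.2 ++ b.2)

/-- Iterations of a step that records the addresses it reads. -/
noncomputable def iterateTrace (step : Val → PMF (Val × List Val)) :
    ℕ → Val → PMF (Val × List Val)
  | 0, s => PMF.pure (s, [])
  | n + 1, s => traceThen (step s) (iterateTrace step n) fun _ b => b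

/-- The joint distribution of the value that a program returns and the list of the addresses that it
reads. -/
noncomputable def Prog.trace (mem : Val → Val) : Prog → Val → PMF (Val × List Val)
  | .skip, x => PMF.pure (x, [])
  | .nil, _ => PMF.pure (Val.nil, [])
  | .head, x => PMF.pure (x.head, [])
  | .tail, x => PMF.pure (x.tail, [])
  | .coin, _ => (PMF.uniformOfFintype Bool).bind fun b => PMF.pure (Val.ofBool b, [])
  | .ask, x => PMF.pure (mem x, [x])
  | .seq f g, x => traceThen (f.trace mem x) (g.trace mem) fun _ b => b
  | .pair f g, x => traceThen (f.trace mem x) (fun _ => g.trace mem x) Val.cons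
  | .ite c f g, x => traceThen (c.trace mem x)
      (fun a => if a = Val.nil then g.trace mem x else f.trace mem x) fun _ b => b
  | .loop f, x => iterateTrace (f.trace mem) x.head.len x.tail

/-- Expectations of functions of the value and the number of accesses agree for `run` and `trace`. -/
theorem expect_run_eq_expect_trace (mem : Val → Val) (p : Prog) (x : Val) (F : Val → ℕ → ℝ≥0∞) :
    (expect (p.run mem x) fun o => F o.val o.accesses) =
      expect (p.trace mem x) fun w => F w.1 w.2.length := by
  induction p generalizing x F with
  | skip => simp [Prog.run, Prog.trace, expect_pure]
  | nil => simp [Prog.run, Prog.trace, expect_pure]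
  | head => simp [Prog.run, Prog.trace, expect_pure]
  | tail => simp [Prog.run, Prog.trace, expect_pure]
  | coin => simp [Prog.run, Prog.trace, expect_pure, expect_bind]
  | ask => simp [Prog.run, Prog.trace, expect_pure]
  | seq f g ihf ihg =>
    simp only [Prog.run, Prog.trace, traceThen, expect_pure, expect_bind, List.length_append]
    rw [← ihf x fun v m => expect (g.trace mem v) fun w => F w.1 (m + w.2.length)]
    congr 1
    funext a
    exact ihg a.val fun v m => F v (a.accesses + m)
  | pair f g ihf ihg =>
    simp only [Prog.run, Prog.trace, traceThen, expect_pure, expect_bind, List.length_append]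
    rw [← ihf x fun v m => expect (g.trace mem x) fun w => F (Val.cons v w.1) (m + w.2.length)]
    congr 1
    funext a
    exact ihg x fun v m => F (Val.cons a.val v) (a.accesses + m)
  | ite c f g ihc ihf ihg =>
    simp only [Prog.run, Prog.trace, traceThen, expect_pure, expect_bind, List.length_append]
    rw [← ihc x fun v m => expect (if v = Val.nil then g.trace mem x else f.trace mem x)
      fun w => F w.1 (m + w.2.length)]
    congr 1
    funext a
    split_ifs
    · exact ihg x fun v m => F v (a.accesses + m)
    · exact ihf x fun v m => F v (a.accesses + m)
  | loop f ihf =>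
    have key : ∀ n s (F : Val → ℕ → ℝ≥0∞),
        (expect (iterate (f.run mem) n s) fun o => F o.val o.accesses) =
          expect (iterateTrace (f.trace mem) n s) fun w => F w.1 w.2.length := by
      intro n
      induction n with
      | zero => intro s F; simp [iterate, iterateTrace, expect_pure]
      | succ n ih =>
        intro s F
        simp only [iterate, iterateTrace, traceThen, expect_pure, expect_bind, List.length_append]
        rw [← ihf s fun v m => expect (iterateTrace (f.trace mem) n v)
          fun w => F w.1 (m + w.2.length)]
        congr 1
        funext a
        exact ih a.val fun v m => F v (a.accesses + m)
    simp only [Prog.run, Prog.trace, expect_pure, expect_bind]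
    exact key _ _ F

/-- Two computations agree on the outcomes for which all addresses satisfy `G`. -/
def AgreeOn (G : Val → Prop) (P Q : PMF (Val × List Val)) : Prop :=
  ∀ w : Val × List Val, (∀ a ∈ w.2, G a) → P w = Q w

theorem AgreeOn.traceThen {G : Val → Prop} {P Q : PMF (Val × List Val)}
    {f g : Val → PMF (Val × List Val)} {h : Val → Val → Val} (hP : AgreeOn G P Q)
    (hf : ∀ v, AgreeOn G (f v) (g v)) : AgreeOn G (traceThen P f h) (traceThen Q g h) := by
  classical
  intro w hw
  simp only [VecCom.traceThen, PMF.bind_apply, PMF.pure_apply]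
  refine tsum_congr fun a => ?_
  by_cases ha : ∀ v ∈ a.2, G v
  · rw [hP a ha]
    congr 1
    refine tsum_congr fun b => ?_
    by_cases hb : w = (h a.1 b.1, a.2 ++ b.2)
    · rw [hf a.1 b fun v hv => hw v (by rw [hb]; simp [hv])]
    · simp [hb]
  · have : ∀ b : Val × List Val, w ≠ (h a.1 b.1, a.2 ++ b.2) := by
      rintro b rfl
      exact ha fun v hv => hw v (by simp [hv])
    simp [this]

/-- A program cannot distinguish between memories before it reads an address at which they
differ. -/
theorem agreeOn_trace {G : Val → Prop} {mem mem' : Val → Val} (hmem : ∀ a, G a → mem a = mem' a)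
    (p : Prog) (x : Val) : AgreeOn G (p.trace mem x) (p.trace mem' x) := by
  induction p generalizing x with
  | skip => intro w _; rfl
  | nil => intro w _; rfl
  | head => intro w _; rfl
  | tail => intro w _; rfl
  | coin => intro w _; rfl
  | ask =>
    classical
    intro w hw
    simp only [Prog.trace, PMF.pure_apply]
    by_cases hx : G x
    · rw [hmem x hx]
    · have : ∀ v, w ≠ (v, [x]) := by
        rintro v rfl
        exact hx (hw x (by simp))
      simp [this]
  | seq f g ihf ihg => exact (ihf x).traceThen ihg
  | pair f g ihf ihg => exact (ihf x).traceThen fun _ => ihg x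
  | ite c f g ihc ihf ihg =>
    refine (ihc x).traceThen fun v => ?_
    split_ifs
    exacts [ihg x, ihf x]
  | loop f ihf =>
    have key : ∀ n s, AgreeOn G (iterateTrace (f.trace mem) n s)
        (iterateTrace (f.trace mem') n s) := by
      intro n
      induction n with
      | zero => intro s w _; rfl
      | succ n ih => intro s; exact (ihf s).traceThen ih
    exact key _ _

theorem AgreeOn.expect_eq {G : Val → Prop} {P Q : PMF (Val × List Val)} (h : AgreeOn G P Q)
    {F : Val × List Val → ℝ≥0∞} (hF : ∀ w, (¬ ∀ a ∈ w.2, G a) → F w = 0) :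
    expect P F = expect Q F := by
  refine tsum_congr fun w => ?_
  by_cases hw : ∀ a ∈ w.2, G a
  · rw [h w hw]
  · simp [hF w hw]

/-- Every outcome of `trace` comes from one of `run`. -/
theorem length_le_of_mem_support_trace {mem : Val → Val} {p : Prog} {x : Val} {T : ℝ}
    (h : ∀ o ∈ (p.run mem x).support, (o.accesses : ℝ) ≤ T) :
    ∀ w ∈ (p.trace mem x).support, (w.2.length : ℝ) ≤ T := by
  classical
  intro w hw
  by_contra hT
  have h1 := expect_run_eq_expect_trace mem p x fun _ m => if (m : ℝ) ≤ T then 0 else 1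
  have h2 : (expect (p.run mem x) fun o => if (o.accesses : ℝ) ≤ T then (0 : ℝ≥0∞) else 1) = 0 :=
    le_antisymm (expect_le_of_mem fun o ho => by simp [h o ho]) zero_le
  have h3 := mul_le_expect (p.trace mem x) (fun w => if (w.2.length : ℝ) ≤ T then (0 : ℝ≥0∞) else 1) w
  rw [← h1, h2] at h3
  simp only [hT, if_false, mul_one, nonpos_iff_eq_zero] at h3
  exact (PMF.mem_support_iff _ _).1 hw h3

/-! ### Independent samples -/

theorem length_of_mem_sampleList {h : Val → PMF Val} {l m : List Val}
    (hm : m ∈ (sampleList h l).support) : m.length = l.length := by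
  induction l generalizing m with
  | nil => simp only [sampleList, PMF.mem_support_pure_iff] at hm; simp [hm]
  | cons a l ih =>
    simp only [sampleList, PMF.mem_support_bind_iff, PMF.mem_support_map_iff] at hm
    obtain ⟨b, -, m, hm, rfl⟩ := hm
    simp [ih hm]

theorem mem_support_of_mem_sampleList {D : PMF Val} {l m : List Val}
    (hm : m ∈ (sampleList (fun _ => D) l).support) : ∀ x ∈ m, x ∈ D.support := by
  induction l generalizing m with
  | nil => simp only [sampleList, PMF.mem_support_pure_iff] at hm; simp [hm]
  | cons a l ih =>
    simp only [sampleList, PMF.mem_support_bind_iff, PMF.mem_support_map_iff] at hm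
    obtain ⟨b, hb, m, hm, rfl⟩ := hm
    simp only [List.mem_cons, forall_eq_or_imp]
    exact ⟨hb, ih hm⟩

/-- Sampling one entry of a list of independent samples once more does not change the
distribution. -/
theorem expect_sampleList_set (D : PMF Val) (l : List Val) (i : ℕ) (F : List Val → ℝ≥0∞) :
    (expect (sampleList (fun _ => D) l) fun m => expect D fun y => F (m.set i y)) =
      expect (sampleList (fun _ => D) l) F := by
  induction l generalizing i F with
  | nil => simp [sampleList, expect_pure, expect_const]
  | cons a l ih =>
    simp only [sampleList, expect_bind, expect_map]
    cases i with
    | zero =>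
      simp only [List.set_cons_zero]
      rw [expect_const, expect_comm]
    | succ i =>
      simp only [List.set_cons_succ]
      congr 1
      funext b
      exact ih i fun m => F (b :: m)

/-- The probability that a given entry of a list of samples equals `v`. -/
theorem expect_sampleList_getD_eq_le {D : PMF Val} {δ : ℝ≥0∞} (hδ : ∀ x, D x ≤ δ) (l : List Val)
    {i : ℕ} (hi : i < l.length) (v : Val) :
    (expect (sampleList (fun _ => D) l) fun m => if m.getD i nil = v then 1 else 0) ≤ δ := by
  rw [← expect_sampleList_set D l i]
  refine expect_le_of_mem fun m hm => ?_
  have hm := length_of_mem_sampleList hm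
  simp only [List.getD_eq_getElem?_getD, List.getElem?_set_self (show i < m.length by omega),
    Option.getD_some]
  refine le_trans ?_ (hδ v)
  rw [← expect_ite_eq D v]

/-! ### Approximate membership filters -/

/-- Coordinates that a function of independent samples depends on in product form can be averaged
separately. -/
theorem expect_sampleList_prod (D : PMF Val) (l : List Val) (L B : Finset ℕ) (hBL : B ⊆ L)
    (hL : ∀ i ∈ L, i < l.length) (h : List Val → ℝ≥0∞)
    (hh : ∀ j ∈ L, ∀ m y, h (m.set j y) = h m) (g : ℕ → List Val → Val → ℝ≥0∞)
    (hg : ∀ i ∈ B, ∀ j ∈ L, ∀ m y v, g i (m.set j y) v = g i m v) :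
    (expect (sampleList (fun _ => D) l) fun m => h m * ∏ i ∈ B, g i m (m.getD i nil)) =
      expect (sampleList (fun _ => D) l) fun m => h m * ∏ i ∈ B, expect D (g i m) := by
  classical
  induction B using Finset.induction_on generalizing h with
  | empty => simp
  | insert i B hi ih =>
    have hiL : i ∈ L := hBL (Finset.mem_insert_self i B)
    have hBL' : B ⊆ L := (Finset.subset_insert i B).trans hBL
    have hg' : ∀ i ∈ B, ∀ j ∈ L, ∀ m y v, g i (m.set j y) v = g i m v := fun i' h' =>
      hg i' (Finset.mem_insert_of_mem h')
    rw [← expect_sampleList_set D l i]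
    have h1 : (expect (sampleList (fun _ => D) l) fun m => expect D fun y =>
        h (m.set i y) * ∏ j ∈ insert i B, g j (m.set i y) ((m.set i y).getD j nil)) =
        expect (sampleList (fun _ => D) l) fun m =>
          (h m * expect D (g i m)) * ∏ j ∈ B, g j m (m.getD j nil) := by
      refine expect_congr_of_mem fun m hm => ?_
      have hm : i < m.length := by
        rw [length_of_mem_sampleList hm]
        exact hL i hiL
      have h2 : ∀ y, h (m.set i y) * ∏ j ∈ insert i B, g j (m.set i y) ((m.set i y).getD j nil) =
          (h m * ∏ j ∈ B, g j m (m.getD j nil)) * g i m y := by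
        intro y
        rw [Finset.prod_insert hi, hh i hiL, hg i (Finset.mem_insert_self i B) i hiL]
        have h3 : (m.set i y).getD i nil = y := by simp [List.getD_eq_getElem?_getD, hm]
        have h4 : ∏ j ∈ B, g j (m.set i y) ((m.set i y).getD j nil) =
            ∏ j ∈ B, g j m (m.getD j nil) := by
          refine Finset.prod_congr rfl fun j hj => ?_
          have hij : i ≠ j := fun he => hi (he ▸ hj)
          rw [hg' j hj i hiL]
          simp [List.getD_eq_getElem?_getD, List.getElem?_set_ne hij]
        rw [h3, h4]
        ring
      simp only [h2, expect_const_mul]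
      ring
    rw [h1, ih hBL' (fun m => h m * expect D (g i m)) (fun j hj m y => ?_) hg']
    · refine expect_congr_of_mem fun m _ => ?_
      rw [Finset.prod_insert hi]
      ring
    · simp only [hh j hj]
      congr 2
      funext v
      exact hg i (Finset.mem_insert_self i B) j hj m y v

open Classical in
/-- Suppose that short data `u` is computed from independent samples, and that for each index in `B`
there is a test, which depends on `u` and on the samples outside of `L ⊇ B`, that proposes a value
`c`. It is unlikely that all tests accept the samples with the same correct value `c`, although each
of them accepts only a small fraction of all samples. The reason is that `u` would have to be one of
few strings, whereas the samples are independent of the fixed strings. -/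
theorem filter_bound {C U : Type*} (D : PMF Val) (l : List Val) (L B : Finset ℕ) (hBL : B ⊆ L)
    (hL : ∀ i ∈ L, i < l.length) (K : List Val → PMF (C × U))
    (g : ℕ → C → U → List Val → Val → ℝ≥0∞)
    (hg : ∀ i c u, ∀ j ∈ L, ∀ m y v, g i c u (m.set j y) v = g i c u m v)
    (hsum : ∀ i u m y, ∑' c, g i c u m y ≤ 1) (𝒰 : Finset U) (θ : ℝ≥0∞) (hB : B.Nonempty) :
    (expect (sampleList (fun _ => D) l) fun m => expect (K m) fun r =>
      if r.2 ∈ 𝒰 ∧ ∀ i ∈ B, expect D (g i r.1 r.2 m) < θ ∧ 2⁻¹ ≤ g i r.1 r.2 m (m.getD i nil)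
      then 1 else 0) ≤ 2 ^ B.card * 𝒰.card * θ ^ (B.card - 1) := by
  obtain ⟨i₀, hi₀⟩ := hB
  set P := sampleList (fun _ => D) l
  set H : C → U → List Val → ℝ≥0∞ := fun c u m =>
    if ∀ i ∈ B, expect D (g i c u m) < θ then 1 else 0 with hH
  have h1 : ∀ m, (expect (K m) fun r =>
      if r.2 ∈ 𝒰 ∧ ∀ i ∈ B, expect D (g i r.1 r.2 m) < θ ∧ 2⁻¹ ≤ g i r.1 r.2 m (m.getD i nil)
      then 1 else 0) ≤ ∑ u ∈ 𝒰, ∑' c, 2 ^ B.card *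
        (H c u m * ∏ i ∈ B, g i c u m (m.getD i nil)) := by
    intro m
    calc _ ≤ ∑' r : C × U, if r.2 ∈ 𝒰 then 2 ^ B.card *
        (H r.1 r.2 m * ∏ i ∈ B, g i r.1 r.2 m (m.getD i nil)) else 0 := by
          refine ENNReal.tsum_le_tsum fun r => ?_
          by_cases h2 : r.2 ∈ 𝒰 ∧ ∀ i ∈ B, expect D (g i r.1 r.2 m) < θ ∧
              2⁻¹ ≤ g i r.1 r.2 m (m.getD i nil)
          · have h4 : H r.1 r.2 m = 1 := if_pos fun i hi => (h2.2 i hi).1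
            have h5 : (2⁻¹ : ℝ≥0∞) ^ B.card ≤ ∏ i ∈ B, g i r.1 r.2 m (m.getD i nil) := by
              rw [← Finset.prod_const]
              exact Finset.prod_le_prod' fun i hi => (h2.2 i hi).2
            simp only [if_pos h2, if_pos h2.1, h4]
            calc K m r * 1 ≤ 1 := by rw [mul_one]; exact PMF.coe_le_one _ _
              _ = 2 ^ B.card * (1 * 2⁻¹ ^ B.card) := by
                rw [one_mul, ← mul_pow, ENNReal.mul_inv_cancel (by simp) (by simp), one_pow]
              _ ≤ _ := by gcongr
          · simp only [if_neg h2, mul_zero, zero_le]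
      _ = ∑' u, ∑' c, if u ∈ 𝒰 then 2 ^ B.card *
        (H c u m * ∏ i ∈ B, g i c u m (m.getD i nil)) else 0 := by
          rw [ENNReal.tsum_prod (f := fun c u => if u ∈ 𝒰 then 2 ^ B.card *
            (H c u m * ∏ i ∈ B, g i c u m (m.getD i nil)) else 0), ENNReal.tsum_comm]
      _ = _ := by
          rw [tsum_eq_sum (s := 𝒰)]
          · exact Finset.sum_congr rfl fun u hu => by simp only [hu, if_true]
          · intro u hu
            simp [hu]
  refine (expect_mono h1).trans ?_
  rw [expect_sum]
  have h2 : ∀ u, (expect P fun m => ∑' c, 2 ^ B.card *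
      (H c u m * ∏ i ∈ B, g i c u m (m.getD i nil))) ≤ 2 ^ B.card * θ ^ (B.card - 1) := by
    intro u
    calc _ = 2 ^ B.card * ∑' c, expect P fun m =>
          H c u m * ∏ i ∈ B, g i c u m (m.getD i nil) := by
          rw [expect_tsum, ← ENNReal.tsum_mul_left]
          exact tsum_congr fun c => expect_const_mul _ _ _
      _ = 2 ^ B.card * ∑' c, expect P fun m => H c u m * ∏ i ∈ B, expect D (g i c u m) := by
          congr 1
          refine tsum_congr fun c => ?_
          refine expect_sampleList_prod D l L B hBL hL (H c u) (fun j hj m y => ?_)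
            (fun i => g i c u) fun i _ j hj => hg i c u j hj
          have h3 : ∀ i, g i c u (m.set j y) = g i c u m := fun i => funext fun v =>
            hg i c u j hj m y v
          simp only [hH, h3]
      _ ≤ 2 ^ B.card * ∑' c, expect P fun m => θ ^ (B.card - 1) * expect D (g i₀ c u m) := by
          gcongr with c
          refine expect_mono fun m => ?_
          by_cases h3 : ∀ i ∈ B, expect D (g i c u m) < θ
          · rw [hH]
            simp only [if_pos h3, one_mul]
            rw [← Finset.mul_prod_erase B _ hi₀, mul_comm]
            gcongr
            rw [← Finset.card_erase_of_mem hi₀, ← Finset.prod_const]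
            exact Finset.prod_le_prod' fun i hi => (h3 i (Finset.mem_of_mem_erase hi)).le
          · rw [hH]
            simp only [if_neg h3, zero_mul, zero_le]
      _ = 2 ^ B.card * (θ ^ (B.card - 1) *
          expect P fun m => expect D fun y => ∑' c, g i₀ c u m y) := by
          congr 1
          simp only [expect_const_mul, ENNReal.tsum_mul_left]
          congr 1
          rw [← expect_tsum]
          congr 1
          funext m
          rw [expect_tsum]
      _ ≤ 2 ^ B.card * (θ ^ (B.card - 1) * 1) := by
          gcongr
          exact expect_le_of_mem fun m _ => expect_le_of_mem fun y _ => hsum i₀ u m y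
      _ = _ := by rw [mul_one]
  refine (Finset.sum_le_sum fun u _ => h2 u).trans ?_
  rw [Finset.sum_const, nsmul_eq_mul]
  apply le_of_eq
  ring

/-- The bit strings of length at most `m`. -/
def shortBits : ℕ → Finset (List Bool)
  | 0 => {[]}
  | m + 1 => insert [] ((shortBits m).image (List.cons true) ∪ (shortBits m).image (List.cons false))

theorem mem_shortBits {m : ℕ} {u : List Bool} (h : u.length ≤ m) : u ∈ shortBits m := by
  induction m generalizing u with
  | zero => simp [shortBits, List.eq_nil_of_length_eq_zero (Nat.le_zero.1 h)]
  | succ m ih =>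
    rcases u with _ | ⟨b, u⟩
    · simp [shortBits]
    · have := ih (u := u) (by simpa using h)
      cases b <;> simp [shortBits, this]

theorem card_shortBits_le (m : ℕ) : (shortBits m).card + 1 ≤ 2 ^ (m + 1) := by
  induction m with
  | zero => simp [shortBits]
  | succ m ih =>
    have h1 := Finset.card_insert_le ([] : List Bool)
      ((shortBits m).image (List.cons true) ∪ (shortBits m).image (List.cons false))
    have h2 := Finset.card_union_le ((shortBits m).image (List.cons true))
      ((shortBits m).image (List.cons false))
    have h3 := Finset.card_image_le (s := shortBits m) (f := List.cons true)
    have h4 := Finset.card_image_le (s := shortBits m) (f := List.cons false)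
    rw [shortBits, pow_succ]
    omega

/-! ### Users that hardly read each other's messages -/

/-- In a weighted directed graph on `k` vertices in which all out-degrees are at most `T`, some set of
`r ≤ k / (768 * T)` vertices spans edges of small total weight. The set is chosen greedily among the
vertices of in-degree at most `2 * T`. -/
theorem exists_sparse_subset (k r : ℕ) (T : ℝ) (hT : 1 ≤ T) (hr : 768 * r * T ≤ k)
    (W : ℕ → ℕ → ℝ) (hW : ∀ i j, 0 ≤ W i j)
    (hrow : ∀ i < k, ∑ j ∈ Finset.range k, W i j ≤ T) :
    ∃ L ⊆ Finset.range k, L.card = r ∧ ∑ i ∈ L, ∑ j ∈ L.erase i, W i j ≤ r / 64 := by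
  classical
  set S := (Finset.range k).filter fun j => ∑ i ∈ Finset.range k, W i j ≤ 2 * T with hS
  have hScard : (k : ℝ) ≤ 2 * S.card := by
    have h1 : ∑ j ∈ Finset.range k, ∑ i ∈ Finset.range k, W i j ≤ k * T := by
      rw [Finset.sum_comm]
      refine (Finset.sum_le_sum fun i hi => hrow i (Finset.mem_range.1 hi)).trans ?_
      simp
    have h2 : ((Finset.range k).filter fun j => ¬ ∑ i ∈ Finset.range k, W i j ≤ 2 * T).card *
        (2 * T) ≤ ∑ j ∈ Finset.range k, ∑ i ∈ Finset.range k, W i j := by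
      rw [← nsmul_eq_mul]
      refine (Finset.card_nsmul_le_sum _ (fun j => ∑ i ∈ Finset.range k, W i j) _ fun j hj => ?_).trans
        (Finset.sum_le_sum_of_subset_of_nonneg (Finset.filter_subset _ _) fun j _ _ =>
          Finset.sum_nonneg fun i _ => hW i j)
      exact (not_le.1 (Finset.mem_filter.1 hj).2).le
    have h3 := Finset.card_filter_add_card_filter_not (s := Finset.range k)
      (fun j => ∑ i ∈ Finset.range k, W i j ≤ 2 * T)
    rw [Finset.card_range] at h3
    have h4 : (S.card : ℝ) + ((Finset.range k).filter fun j =>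
      ¬ ∑ i ∈ Finset.range k, W i j ≤ 2 * T).card = k := by exact_mod_cast h3
    nlinarith
  suffices h : ∀ t ≤ r, ∃ L ⊆ S, L.card = t ∧ ∑ i ∈ L, ∑ j ∈ L.erase i, W i j ≤ t / 64 by
    obtain ⟨L, h1, h2⟩ := h r le_rfl
    exact ⟨L, h1.trans (Finset.filter_subset _ _), h2⟩
  intro t
  induction t with
  | zero => exact fun _ => ⟨∅, by simp, by simp, by simp⟩
  | succ t ih =>
    intro ht
    obtain ⟨L, hLS, hLc, hLw⟩ := ih (by omega)
    have htr : ((t : ℝ) + 1) ≤ r := by exact_mod_cast ht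
    have hcard : (k : ℝ) / 4 ≤ (S \ L).card := by
      have h1 : (S.card : ℝ) = (S \ L).card + t := by
        rw [← hLc]
        exact_mod_cast (Finset.card_sdiff_add_card_eq_card hLS).symm
      nlinarith
    -- the total weight between `L` and the candidates is small
    have h1 : ∑ j ∈ S \ L, (∑ i ∈ L, W i j + ∑ i ∈ L, W j i) ≤ t * (3 * T) := by
      rw [Finset.sum_add_distrib, Finset.sum_comm, Finset.sum_comm (s := S \ L),
        ← Finset.sum_add_distrib, ← hLc, ← nsmul_eq_mul]
      refine Finset.sum_le_card_nsmul _ _ _ fun i hi => ?_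
      have hi' := Finset.mem_filter.1 (hLS hi)
      have hsub : S \ L ⊆ Finset.range k :=
        Finset.sdiff_subset.trans (Finset.filter_subset _ _)
      have h2 := Finset.sum_le_sum_of_subset_of_nonneg hsub (f := fun j => W i j)
        fun j _ _ => hW i j
      have h3 := Finset.sum_le_sum_of_subset_of_nonneg hsub (f := fun j => W j i)
        fun j _ _ => hW j i
      have h4 := hrow i (Finset.mem_range.1 hi'.1)
      linarith [hi'.2]
    obtain ⟨j, hj, hjw⟩ : ∃ j ∈ S \ L, ∑ i ∈ L, W i j + ∑ i ∈ L, W j i ≤ 1 / 64 := by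
      by_contra! hcon
      have h2 : (S \ L).card • (1 / 64 : ℝ) ≤
          ∑ j ∈ S \ L, (∑ i ∈ L, W i j + ∑ i ∈ L, W j i) :=
        Finset.card_nsmul_le_sum _ _ _ fun j hj => (hcon j hj).le
      rw [nsmul_eq_mul] at h2
      nlinarith
    have hjL : j ∉ L := (Finset.mem_sdiff.1 hj).2
    refine ⟨insert j L, Finset.insert_subset (Finset.mem_sdiff.1 hj).1 hLS, by
      rw [Finset.card_insert_of_notMem hjL, hLc], ?_⟩
    have h2 : ∑ i ∈ L, ∑ j' ∈ (insert j L).erase i, W i j' =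
        ∑ i ∈ L, W i j + ∑ i ∈ L, ∑ j' ∈ L.erase i, W i j' := by
      rw [← Finset.sum_add_distrib]
      refine Finset.sum_congr rfl fun i hi => ?_
      have hij : j ≠ i := fun h => hjL (h ▸ hi)
      rw [Finset.erase_insert_of_ne hij, Finset.sum_insert fun h =>
        hjL (Finset.mem_of_mem_erase h)]
    rw [Finset.sum_insert hjL, h2, Finset.erase_insert hjL]
    push_cast
    linarith

/-! ### An index at which the filter has a false positive -/

open Classical in
/-- Markov's inequality for the number of indices with a bad event. For an index `i`, the numbers
`op i` and `s i` are success probabilities that are close to one on average, `g i` is at least `s i`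
up to the weights `w i j`, and `a i` is the quantity that has to be large for one of the indices. -/
theorem exists_index_of_filter_bound {Ω : Type*} (p : PMF Ω) (L : Finset ℕ) (b : ℕ) (hb : 1 ≤ b)
    (hL : L.card = 4 * b) (good : Ω → Prop) (op s g a : ℕ → Ω → ℝ≥0∞) (w : ℕ → ℕ → Ω → ℝ≥0∞)
    (θ δ Q : ℝ≥0∞) (hs1 : ∀ i ω, s i ω ≤ 1) (hθ : θ ≠ ⊤) (hδθ : 4 * δ ≤ θ)
    (hop : ∀ i ∈ L, (expect p fun ω => 1 - op i ω) ≤ 64⁻¹)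
    (hs : ∀ i ∈ L, (expect p fun ω => 1 - s i ω) ≤ 64⁻¹)
    (hgood : (expect p fun ω => if good ω then 0 else 1) ≤ 64⁻¹)
    (hsg : ∀ ω ∈ p.support, good ω → ∀ i ∈ L, s i ω ≤ g i ω + ∑ j ∈ L.erase i, w i j ω)
    (hw : ∑ i ∈ L, ∑ j ∈ L.erase i, (expect p fun ω => if good ω then w i j ω else 0) ≤
      L.card * 64⁻¹)
    (hfilter : ∀ B ⊆ L, B.card = b → (expect p fun ω =>
      if good ω ∧ ∀ i ∈ B, a i ω < θ ∧ 2⁻¹ ≤ g i ω then 1 else 0) ≤ Q)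
    (hQ : 2 ^ (4 * b) * Q ≤ 64⁻¹) :
    ∃ i ∈ L, θ * 8⁻¹ ≤ expect p fun ω => if good ω then op i ω * (a i ω - 2 * δ) else 0 := by
  set x : ℕ → Ω → ℝ≥0∞ := fun i ω => if good ω ∧ 2⁻¹ ≤ op i ω ∧ θ ≤ a i ω then 1 else 0 with hx
  have two_half : (2 : ℝ≥0∞) * 2⁻¹ = 1 := ENNReal.mul_inv_cancel (by simp) (by simp)
  -- every index is accounted for by one of the terms on the right
  have key : ∀ ω ∈ p.support, (L.card : ℝ≥0∞) ≤ ∑ i ∈ L, x i ω + 2 * ∑ i ∈ L, (1 - op i ω) +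
      L.card * (if good ω then 0 else 1) + 2 * ∑ i ∈ L, (1 - s i ω) +
      2 * ∑ i ∈ L, ∑ j ∈ L.erase i, (if good ω then w i j ω else 0) + b +
      L.card * ∑ B ∈ L.powersetCard b,
        (if good ω ∧ ∀ i ∈ B, a i ω < θ ∧ 2⁻¹ ≤ g i ω then 1 else 0) := by
    intro ω hω
    by_cases hgω : good ω
    swap
    · simp only [if_neg hgω, mul_one]
      calc (L.card : ℝ≥0∞) ≤ ∑ i ∈ L, x i ω + 2 * ∑ i ∈ L, (1 - op i ω) + L.card := le_add_self
        _ ≤ _ := by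
          simp only [add_assoc]
          gcongr
          exact le_self_add
    set G := L.filter fun i => a i ω < θ ∧ 2⁻¹ ≤ g i ω with hG
    by_cases hGb : b ≤ G.card
    · obtain ⟨B, hBG, hBc⟩ := Finset.exists_subset_card_eq hGb
      have h1 : (1 : ℝ≥0∞) ≤ ∑ B ∈ L.powersetCard b,
          (if good ω ∧ ∀ i ∈ B, a i ω < θ ∧ 2⁻¹ ≤ g i ω then 1 else 0) := by
        refine le_trans ?_ (Finset.single_le_sum (fun _ _ => zero_le)
          (Finset.mem_powersetCard.2 ⟨hBG.trans (Finset.filter_subset _ _), hBc⟩))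
        rw [if_pos ⟨hgω, fun i hi => (Finset.mem_filter.1 (hBG hi)).2⟩]
      calc (L.card : ℝ≥0∞) = L.card * 1 := (mul_one _).symm
        _ ≤ L.card * ∑ B ∈ L.powersetCard b,
          (if good ω ∧ ∀ i ∈ B, a i ω < θ ∧ 2⁻¹ ≤ g i ω then 1 else 0) := by gcongr
        _ ≤ _ := le_add_self
    · have h1 : ∀ i ∈ L, (1 : ℝ≥0∞) ≤ x i ω + 2 * (1 - op i ω) + 2 * (1 - s i ω) +
          2 * (∑ j ∈ L.erase i, if good ω then w i j ω else 0) + if i ∈ G then 1 else 0 := by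
        intro i hi
        by_cases h2 : 2⁻¹ ≤ op i ω
        swap
        · have h3 : 2⁻¹ ≤ 1 - op i ω := by
            refine ENNReal.le_sub_of_add_le_left (ne_top_of_lt (not_le.1 h2)) ?_
            calc op i ω + 2⁻¹ ≤ 2⁻¹ + 2⁻¹ := by gcongr; exact (not_le.1 h2).le
              _ = 1 := ENNReal.inv_two_add_inv_two
          calc (1 : ℝ≥0∞) = 2 * 2⁻¹ := two_half.symm
            _ ≤ 2 * (1 - op i ω) := by gcongr
            _ ≤ x i ω + 2 * (1 - op i ω) := le_add_self
            _ ≤ _ := by simp only [add_assoc]; gcongr; exact le_self_add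
        by_cases h3 : 2⁻¹ ≤ g i ω
        swap
        · have h4 : 2⁻¹ ≤ (1 - s i ω) + ∑ j ∈ L.erase i, if good ω then w i j ω else 0 := by
            by_contra h5
            have h6 : (1 : ℝ≥0∞) ≤ g i ω +
                ((1 - s i ω) + ∑ j ∈ L.erase i, if good ω then w i j ω else 0) := by
              simp only [if_pos hgω]
              calc (1 : ℝ≥0∞) = (1 - s i ω) + s i ω := (tsub_add_cancel_of_le (hs1 i ω)).symm
                _ ≤ (1 - s i ω) + (g i ω + ∑ j ∈ L.erase i, w i j ω) := by
                  gcongr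
                  exact hsg ω hω hgω i hi
                _ = _ := by ring
            have h7 := ENNReal.add_lt_add (not_le.1 h3) (not_le.1 h5)
            rw [ENNReal.inv_two_add_inv_two] at h7
            exact absurd h6 (not_le.2 h7)
          calc (1 : ℝ≥0∞) = 2 * 2⁻¹ := two_half.symm
            _ ≤ 2 * ((1 - s i ω) + ∑ j ∈ L.erase i, if good ω then w i j ω else 0) := by gcongr
            _ = 2 * (1 - s i ω) + 2 * ∑ j ∈ L.erase i, (if good ω then w i j ω else 0) :=
              mul_add _ _ _
            _ ≤ (x i ω + 2 * (1 - op i ω)) + (2 * (1 - s i ω) +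
              2 * ∑ j ∈ L.erase i, (if good ω then w i j ω else 0)) := le_add_self
            _ ≤ _ := by simp only [add_assoc]; gcongr; exact le_self_add
        by_cases h4 : θ ≤ a i ω
        · have h5 : x i ω = 1 := if_pos ⟨hgω, h2, h4⟩
          rw [h5]
          simp only [add_assoc]
          exact le_self_add
        · have h5 : i ∈ G := Finset.mem_filter.2 ⟨hi, not_le.1 h4, h3⟩
          rw [if_pos h5]
          exact le_add_self
      calc (L.card : ℝ≥0∞) = ∑ i ∈ L, 1 := by simp
        _ ≤ _ := Finset.sum_le_sum h1
        _ = ∑ i ∈ L, x i ω + 2 * ∑ i ∈ L, (1 - op i ω) + 2 * ∑ i ∈ L, (1 - s i ω) +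
            2 * ∑ i ∈ L, ∑ j ∈ L.erase i, (if good ω then w i j ω else 0) + G.card := by
          simp only [Finset.sum_add_distrib, Finset.mul_sum, Finset.sum_ite_mem, Finset.sum_const,
            nsmul_eq_mul, mul_one]
          rw [Finset.inter_eq_right.2 (Finset.filter_subset _ _)]
        _ ≤ ∑ i ∈ L, x i ω + 2 * ∑ i ∈ L, (1 - op i ω) + 2 * ∑ i ∈ L, (1 - s i ω) +
            2 * ∑ i ∈ L, ∑ j ∈ L.erase i, (if good ω then w i j ω else 0) + b := by
          gcongr
          exact (not_le.1 hGb).le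
        _ ≤ _ := by
          rw [if_pos hgω, mul_zero, add_zero]
          exact le_self_add
  have hX := expect_mono_of_mem key
  rw [expect_const] at hX
  simp only [expect_add, expect_const_mul, expect_sum, expect_const] at hX
  set X := ∑ i ∈ L, expect p (x i) with hXdef
  have hpow : ∑ B ∈ L.powersetCard b, (expect p fun ω =>
      if good ω ∧ ∀ i ∈ B, a i ω < θ ∧ 2⁻¹ ≤ g i ω then (1 : ℝ≥0∞) else 0) ≤ 64⁻¹ := by
    refine le_trans (Finset.sum_le_card_nsmul _ _ Q fun B hB => ?_) (le_trans ?_ hQ)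
    · exact hfilter B (Finset.mem_powersetCard.1 hB).1 (Finset.mem_powersetCard.1 hB).2
    · rw [nsmul_eq_mul, Finset.card_powersetCard, hL]
      gcongr
      exact_mod_cast Nat.choose_le_two_pow _ _
  have hX' : (L.card : ℝ≥0∞) ≤ X + 2 * (L.card * 64⁻¹) + L.card * 64⁻¹ + 2 * (L.card * 64⁻¹) +
      2 * (L.card * 64⁻¹) + b + L.card * 64⁻¹ := by
    refine hX.trans ?_
    gcongr
    · exact (Finset.sum_le_card_nsmul _ _ _ hop).trans (by rw [nsmul_eq_mul])
    · exact (Finset.sum_le_card_nsmul _ _ _ hs).trans (by rw [nsmul_eq_mul])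
  have hXtop : X ≠ ⊤ := by
    refine ENNReal.sum_ne_top.2 fun i _ => ?_
    refine ((expect_le_of_mem (c := 1) fun ω _ => ?_).trans_lt ENNReal.one_lt_top).ne
    rw [hx]
    dsimp only
    split_ifs <;> simp
  have hX2 : 2 * (b : ℝ≥0∞) ≤ X := by
    rw [hL] at hX'
    clear_value X
    lift X to NNReal using hXtop
    have h64 : (64⁻¹ : ℝ≥0∞) = ((64⁻¹ : NNReal) : ℝ≥0∞) := by
      rw [ENNReal.coe_inv (by norm_num)]
      rfl
    rw [h64] at hX'
    norm_cast at hX' ⊢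
    have h2 : ((4 * b : ℕ) : ℝ) ≤ X + 2 * ((4 * b : ℕ) * 64⁻¹) + (4 * b : ℕ) * 64⁻¹ +
      2 * ((4 * b : ℕ) * 64⁻¹) + 2 * ((4 * b : ℕ) * 64⁻¹) + b + (4 * b : ℕ) * 64⁻¹ := by
      exact_mod_cast hX'
    rw [← NNReal.coe_le_coe]
    push_cast at h2 ⊢
    linarith
  -- on average over the indices in `L`, the success probability is large enough
  have hpoint : ∀ i ω, x i ω * (θ * 4⁻¹) ≤ if good ω then op i ω * (a i ω - 2 * δ) else 0 := by
    intro i ω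
    by_cases h1 : good ω ∧ 2⁻¹ ≤ op i ω ∧ θ ≤ a i ω
    · have h2 : x i ω = 1 := if_pos h1
      rw [h2, one_mul, if_pos h1.1]
      have h4 : (4⁻¹ : ℝ≥0∞) = 2⁻¹ * 2⁻¹ := by
        rw [← ENNReal.mul_inv (by simp) (by simp)]
        norm_num
      have h3 : θ * 2⁻¹ ≤ a i ω - 2 * δ := by
        have h5 : 2 * δ ≤ θ * 2⁻¹ := by
          calc 2 * δ = (2 * 2⁻¹) * (2 * δ) := by rw [two_half, one_mul]
            _ = (4 * δ) * 2⁻¹ := by ring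
            _ ≤ θ * 2⁻¹ := by gcongr
        refine ENNReal.le_sub_of_add_le_right
          (ne_top_of_le_ne_top (ENNReal.mul_ne_top hθ (by simp)) h5) ?_
        calc θ * 2⁻¹ + 2 * δ ≤ θ * 2⁻¹ + θ * 2⁻¹ := by gcongr
          _ = θ := by rw [← mul_add, ENNReal.inv_two_add_inv_two, mul_one]
          _ ≤ a i ω := h1.2.2
      calc θ * 4⁻¹ = 2⁻¹ * (θ * 2⁻¹) := by rw [h4]; ring
        _ ≤ _ := by gcongr; exact h1.2.1
    · have h2 : x i ω = 0 := if_neg h1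
      rw [h2, zero_mul]
      exact zero_le
  have hne : L.Nonempty := Finset.card_pos.1 (by omega)
  obtain ⟨i, hi, hmax⟩ := Finset.exists_max_image L
    (fun i => expect p fun ω => if good ω then op i ω * (a i ω - 2 * δ) else 0) hne
  refine ⟨i, hi, ?_⟩
  set E := expect p fun ω => if good ω then op i ω * (a i ω - 2 * δ) else 0 with hE
  have hsum : (b : ℝ≥0∞) * 4 * (θ * 8⁻¹) ≤ b * 4 * E := by
    calc (b : ℝ≥0∞) * 4 * (θ * 8⁻¹) = 2 * b * (θ * 4⁻¹) := by
          have h4 : (4⁻¹ : ℝ≥0∞) = 2 * 8⁻¹ := by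
            rw [show (8 : ℝ≥0∞) = 2 * 4 by norm_num, ENNReal.mul_inv (by simp) (by simp),
              ← mul_assoc, two_half, one_mul]
          rw [h4]
          ring
      _ ≤ X * (θ * 4⁻¹) := by gcongr
      _ = ∑ i ∈ L, expect p fun ω => x i ω * (θ * 4⁻¹) := by
          rw [hXdef, Finset.sum_mul]
          exact Finset.sum_congr rfl fun i _ => (expect_mul_const _ _ _).symm
      _ ≤ ∑ i ∈ L, expect p fun ω => if good ω then op i ω * (a i ω - 2 * δ) else 0 :=
          Finset.sum_le_sum fun i _ => expect_mono fun ω => hpoint i ω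
      _ ≤ L.card • E := Finset.sum_le_card_nsmul _ _ _ hmax
      _ = b * 4 * E := by
          rw [nsmul_eq_mul, hL]
          push_cast
          ring
  have hb0 : (b : ℝ≥0∞) ≠ 0 := by exact_mod_cast (by omega : b ≠ 0)
  exact (ENNReal.mul_le_mul_iff_right (by simpa using hb0)
    (ENNReal.mul_ne_top (ENNReal.natCast_ne_top b) (by simp))).1 hsum

/-! ### Executions of the scheme, and the success probability of the attack -/

/-- The vector `old` with the first `k` messages replaced by those in `fresh`. -/
def splice (k : ℕ) (old fresh : List Val) : List Val :=
  (List.range old.length).map fun j => if j < k then fresh.getD j nil else old.getD j nil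

theorem length_splice (k : ℕ) (old fresh : List Val) : (splice k old fresh).length = old.length := by
  simp [splice]

theorem getD_splice {k : ℕ} {old : List Val} (hk : k ≤ old.length) (fresh : List Val) (j : ℕ) :
    (splice k old fresh).getD j nil = if j < k then fresh.getD j nil else old.getD j nil := by
  by_cases hj : j < old.length
  · simp [splice, List.getD_eq_getElem?_getD, hj]
  · have : ¬ j < k := by omega
    simp [splice, List.getD_eq_getElem?_getD, hj, this]

theorem replaceFirst_eq_splice {t : ℕ} {old : List Val} (ht : ∀ x ∈ old, x.size ≤ t) (k : ℕ)
    (fresh : List Val) : replaceFirst t k old fresh = splice k old fresh := by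
  refine List.map_congr_left fun j hj => ?_
  rw [List.mem_range] at hj
  by_cases hjk : j < k
  swap
  · rw [if_neg hjk, if_neg fun h => hjk h.1]
  rw [if_pos hjk]
  by_cases hd : differ t (old.getD j nil) (fresh.getD j nil)
  · rw [if_pos ⟨hjk, hd⟩]
  · rw [if_neg fun h => hd h.2]
    by_contra hne
    refine hd (differ_of_ne hne (ht _ ?_))
    simp [List.getD_eq_getElem?_getD, hj]

namespace DynamicVC

variable (vc : DynamicVC) (S : Prog) (lam n k : ℕ)

/-- The distribution of messages given by the sampler `S`. -/
noncomputable def messageDist (pp : Val) : PMF Val := S.dist (ofList [ofNat lam, ofNat n, pp])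

/-- Vectors of `n` independent messages. -/
noncomputable def vectorDist (pp : Val) : PMF (List Val) :=
  sampleList (fun _ => messageDist S lam n pp) (List.replicate n nil)

/-- What happens in an honest commitment to a vector and a subsequent update of the first `k`
messages to the corresponding ones in the vector `fresh`. -/
structure Execution where
  pp : Val
  old : List Val
  com : Val
  aux : Val
  fresh : List Val
  newCom : Val
  info : List Bool
  newAux : Val

/-- The execution for random vectors of messages. -/
noncomputable def execution : PMF Execution :=
  (vc.keyGenDist lam n).bind fun pp =>
  (vectorDist S lam n pp).bind fun old =>
  (vc.commitDist pp old).bind fun c =>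
  (vectorDist S lam n pp).bind fun fresh =>
  (vc.updateDist pp c.1 old (splice k old fresh) c.2).bind fun r =>
  PMF.pure ⟨pp, old, c.1, c.2, fresh, r.1, r.2.1, r.2.2⟩

theorem expect_execution (F : Execution → ℝ≥0∞) :
    expect (vc.execution S lam n k) F =
      expect (vc.keyGenDist lam n) fun pp =>
      expect (vectorDist S lam n pp) fun old =>
      expect (vc.commitDist pp old) fun c =>
      expect (vectorDist S lam n pp) fun fresh =>
      expect (vc.updateDist pp c.1 old (splice k old fresh) c.2) fun r =>
      F ⟨pp, old, c.1, c.2, fresh, r.1, r.2.1, r.2.2⟩ := by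
  simp only [execution, expect_bind, expect_pure]

variable {S lam n k} in
theorem mem_support_execution {ω : Execution} (h : ω ∈ (vc.execution S lam n k).support) :
    ω.pp ∈ (vc.keyGenDist lam n).support ∧ ω.old ∈ (vectorDist S lam n ω.pp).support ∧
    (ω.com, ω.aux) ∈ (vc.commitDist ω.pp ω.old).support ∧
    ω.fresh ∈ (vectorDist S lam n ω.pp).support ∧
    (ω.newCom, ω.info, ω.newAux) ∈
      (vc.updateDist ω.pp ω.com ω.old (splice k ω.old ω.fresh) ω.aux).support := by
  simp only [execution, PMF.mem_support_bind_iff, PMF.mem_support_pure_iff] at h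
  obtain ⟨pp, h1, old, h2, c, h3, fresh, h4, r, h5, rfl⟩ := h
  exact ⟨h1, h2, h3, h4, h5⟩

/-- The probability that the new commitment can be opened honestly at index `i`. -/
noncomputable def openSuccess (i : ℕ) (ω : Execution) : ℝ≥0∞ :=
  expect (vc.openDist ω.pp ((splice k ω.old ω.fresh).getD i nil) i ω.newAux) fun π =>
    vc.verifyDist ω.pp ω.newCom ((splice k ω.old ω.fresh).getD i nil) i π True

open Classical in
/-- The probability that user `i` updates the proof successfully. -/
noncomputable def updateSuccess (i : ℕ) (ω : Execution) : ℝ≥0∞ :=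
  expect (vc.openDist ω.pp (ω.old.getD i nil) i ω.aux) fun π =>
  expect (vc.proofUpdateRun lam ω.pp ω.com π i ω.old (splice k ω.old ω.fresh) ω.info) fun o =>
    if o.val.head = ω.newCom then
      vc.verifyDist ω.pp ω.newCom ((splice k ω.old ω.fresh).getD i nil) i o.val.tail True
    else 0

/-- The probability that user `i` gets a valid proof for `y` when the memory contains `y` in place of the
true new message at index `i`. -/
noncomputable def fakeSuccess (i : ℕ) (ω : Execution) (y : Val) : ℝ≥0∞ :=
  expect (vc.openDist ω.pp (ω.old.getD i nil) i ω.aux) fun π =>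
  expect (vc.proofUpdateRun lam ω.pp ω.com π i ω.old (splice k ω.old (ω.fresh.set i y)) ω.info)
    fun o => vc.verifyDist ω.pp ω.newCom y i o.val.tail True

/-- The probability that the attack succeeds, given an execution and a correct guess of `k`. -/
noncomputable def attackSuccess (i : ℕ) (ω : Execution) : ℝ≥0∞ :=
  vc.openSuccess k i ω * expect (messageDist S lam n ω.pp) fun y =>
    if y = ω.fresh.getD i nil then 0 else vc.fakeSuccess lam k i ω y

theorem toList_ofNat (n : ℕ) : (ofNat n).toList = List.replicate n nil := by
  simp [ofNat]

/-- The output of the attack, in terms of the algorithms of the scheme. -/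
theorem expect_attack (q : Polynomial ℕ) (pp : Val) (i : ℕ) (F : Val → ℝ≥0∞) :
    expect (vc.attack S q (ofList [ofNat lam, ofNat n, pp, ofNat i])) F =
      expect (guess (ofNat n)) fun k =>
      expect (vectorDist S lam n pp) fun old =>
      expect (vectorDist S lam n pp) fun fresh =>
      expect (vc.commitDist pp old) fun c =>
      expect (vc.updateDist pp c.1 old
        (replaceFirst (q.eval (lam + n)) k.len old fresh) c.2) fun r =>
      expect (vc.openDist pp (old.getD i nil) i c.2) fun π =>
      expect (messageDist S lam n pp) fun y =>
      expect (vc.proofUpdateRun lam pp c.1 π i old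
        (replaceFirst (q.eval (lam + n)) k.len old (fresh.set i y)) r.2.1) fun o =>
      expect (vc.openDist pp ((replaceFirst (q.eval (lam + n)) k.len old fresh).getD i nil) i
        r.2.2) fun π' =>
      F (ofList [r.1, (replaceFirst (q.eval (lam + n)) k.len old fresh).getD i nil,
        (replaceFirst (q.eval (lam + n)) k.len old (fresh.set i y)).getD i nil, π',
        o.val.tail]) := by
  have h1 : (ofList [ofNat lam, ofNat n, pp, ofNat i]).head = ofNat lam := rfl
  have h2 : (ofList [ofNat lam, ofNat n, pp, ofNat i]).tail.head = ofNat n := rfl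
  have h3 : (ofList [ofNat lam, ofNat n, pp, ofNat i]).tail.tail.head = pp := rfl
  have h4 : (ofList [ofNat lam, ofNat n, pp, ofNat i]).tail.tail.tail.head = ofNat i := rfl
  simp only [attack, h1, h2, h3, h4, expect_bind, expect_map, expect_pure, len_ofNat, nth_ofList,
    toList_ofList, toList_ofNat, commitDist, updateDist, openDist, Prog.value, description,
    describedMem_eq, proofUpdateRun, vectorDist, messageDist]

end DynamicVC

/-! ### The attack as a position-binding adversary -/

theorem expect_and (p p' : PMF Prop) {c : Prop} (hc : c)
    [∀ b b' : Prop, Decidable (b ∧ b' ∧ c)] :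
    (expect p fun b => expect p' fun b' => if b ∧ b' ∧ c then 1 else 0) = p True * p' True := by
  classical
  rw [expect_apply_true p, ← expect_mul_const]
  congr 1
  funext b
  by_cases hb : b
  · simp only [hb, hc, true_and, and_true, if_true, one_mul]
    rw [← expect_apply_true]
  · simp [hb, expect_const]

namespace DynamicVC

variable (vc : DynamicVC) (S : Prog) (lam n k : ℕ)

variable {S lam n} in
theorem length_of_mem_vectorDist {pp : Val} {v : List Val}
    (hv : v ∈ (vectorDist S lam n pp).support) : v.length = n := by
  simpa using length_of_mem_sampleList hv

variable {S lam n} in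
theorem mem_of_mem_vectorDist {pp : Val} {v : List Val}
    (hv : v ∈ (vectorDist S lam n pp).support) {x : Val} (hx : x ∈ v) :
    x ∈ (messageDist S lam n pp).support :=
  mem_support_of_mem_sampleList hv x hx

theorem getD_mem {v : List Val} {i : ℕ} (hi : i < v.length) : v.getD i nil ∈ v := by
  simp [List.getD_eq_getElem?_getD, hi]

variable {S lam n k} in
/-- An adversary that runs the attack wins whenever its guess of `k` is correct and the attack
succeeds. -/
theorem attackSuccess_le_positionBindingGame {A : Prog} {q : Polynomial ℕ}
    (hA : ∀ x, A.dist x = vc.attack S q x) (hkn : k ≤ n) {i : ℕ} (hi : i < k)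
    (hS : ∀ pp ∈ (vc.keyGenDist lam n).support, ∀ x ∈ (messageDist S lam n pp).support,
      x ∈ vc.messages pp ∧ x.size ≤ q.eval (lam + n)) :
    guess (ofNat n) (ofNat k) * expect (vc.execution S lam n k) (vc.attackSuccess S lam n k i) ≤
      vc.positionBindingGame A lam n i True := by
  classical
  rw [expect_apply_true, positionBindingGame]
  simp only [hA, expect_bind, expect_attack, expect_pure, toList_ofList]
  rw [expect_execution, ← expect_const_mul]
  refine expect_mono_of_mem fun pp hpp => ?_
  refine le_trans ?_ (mul_le_expect _ _ (ofNat k))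
  gcongr
  simp only [len_ofNat]
  refine expect_mono_of_mem fun old hold => ?_
  rw [expect_comm]
  refine expect_mono_of_mem fun fresh hfresh => ?_
  refine expect_mono_of_mem fun c hc => ?_
  have hlen := length_of_mem_vectorDist hold
  have hlen' := length_of_mem_vectorDist hfresh
  have hsize : ∀ x ∈ old, x.size ≤ q.eval (lam + n) :=
    fun x hx => (hS pp hpp x (mem_of_mem_vectorDist hold hx)).2
  simp only [replaceFirst_eq_splice hsize]
  refine expect_mono_of_mem fun r hr => ?_
  rw [attackSuccess, ← expect_const_mul, expect_comm]
  refine expect_mono_of_mem fun y hy => ?_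
  have h1 : (splice k old fresh).getD i nil = fresh.getD i nil := by
    rw [getD_splice (by omega), if_pos hi]
  have h2 : (splice k old (fresh.set i y)).getD i nil = y := by
    rw [getD_splice (by omega), if_pos hi]
    simp [List.getD_eq_getElem?_getD, show i < fresh.length by omega]
  by_cases hyi : y = fresh.getD i nil
  · simp [hyi]
  rw [if_neg hyi, fakeSuccess, ← expect_const_mul]
  refine expect_mono fun π => ?_
  rw [← expect_const_mul]
  refine expect_mono fun o => ?_
  rw [openSuccess, ← expect_mul_const]
  refine expect_mono fun π' => ?_
  simp only [h1, h2, List.getD_cons_zero, List.getD_cons_succ]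
  rw [expect_and]
  exact ⟨fun h => hyi h.symm, (hS pp hpp _ (mem_of_mem_vectorDist hfresh
    (getD_mem (by omega)))).1, (hS pp hpp y hy).1⟩

/-! ### Honest executions succeed -/

variable {n} in
theorem isVector_of_mem_vectorDist {pp : Val} {v : List Val}
    (hS : ∀ x ∈ (messageDist S lam n pp).support, x ∈ vc.messages pp)
    (hv : v ∈ (vectorDist S lam n pp).support) : vc.IsVector n pp v :=
  ⟨length_of_mem_vectorDist hv, fun _ hx => hS _ (mem_of_mem_vectorDist hv hx)⟩

variable {n k} in
theorem isVector_splice {pp : Val} {old fresh : List Val} (hkn : k ≤ n)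
    (hold : vc.IsVector n pp old) (hfresh : vc.IsVector n pp fresh) :
    vc.IsVector n pp (splice k old fresh) := by
  refine ⟨by rw [length_splice, hold.1], fun x hx => ?_⟩
  simp only [splice, List.mem_map, List.mem_range] at hx
  obtain ⟨j, hj, rfl⟩ := hx
  split_ifs with h
  · exact hfresh.2 _ (getD_mem (by rw [hfresh.1]; omega))
  · exact hold.2 _ (getD_mem hj)

variable {S lam n k} in
/-- A bound for the failure probability for random vectors, from one for all vectors. -/
theorem expect_execution_one_sub_le (hkn : k ≤ n) {ε : ℝ≥0∞} {F : Execution → ℝ≥0∞}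
    (hF : ∀ ω, F ω ≤ 1)
    (hS : ∀ pp ∈ (vc.keyGenDist lam n).support, ∀ x ∈ (messageDist S lam n pp).support,
      x ∈ vc.messages pp)
    (h : ∀ pp ∈ (vc.keyGenDist lam n).support, ∀ old fresh, vc.IsVector n pp old →
      vc.IsVector n pp (splice k old fresh) →
      1 - ε ≤ expect (vc.commitDist pp old) fun c =>
        expect (vc.updateDist pp c.1 old (splice k old fresh) c.2) fun r =>
        F ⟨pp, old, c.1, c.2, fresh, r.1, r.2.1, r.2.2⟩) :
    (expect (vc.execution S lam n k) fun ω => 1 - F ω) ≤ ε := by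
  rw [expect_one_sub hF, tsub_le_iff_left, ← tsub_le_iff_right, expect_execution]
  refine le_expect_of_mem fun pp hpp => le_expect_of_mem fun old hold => ?_
  rw [expect_comm]
  refine le_expect_of_mem fun fresh hfresh => ?_
  have h1 := vc.isVector_of_mem_vectorDist S lam (hS pp hpp) hold
  have h2 := vc.isVector_of_mem_vectorDist S lam (hS pp hpp) hfresh
  exact h pp hpp old fresh h1 (vc.isVector_splice hkn h1 h2)

theorem openSuccess_le_one (i : ℕ) (ω : Execution) : vc.openSuccess k i ω ≤ 1 :=
  expect_le_of_mem fun _ _ => PMF.coe_le_one _ _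

theorem updateSuccess_le_one (i : ℕ) (ω : Execution) : vc.updateSuccess lam k i ω ≤ 1 := by
  refine expect_le_of_mem fun π _ => expect_le_of_mem fun o _ => ?_
  split_ifs
  exacts [PMF.coe_le_one _ _, zero_le]

/-- The probability that the correctness experiment with a single step succeeds. -/
theorem expect_correctnessGame (pp : Val) (i : ℕ) (old new : List Val) (reopen : Bool) :
    ((vc.start pp i old).bind fun s =>
      vc.correctnessGame lam pp i old s [(reopen, new)]) True =
    expect (vc.start pp i old) fun s => expect (vc.step lam pp i old s reopen new) fun s' =>
      open Classical in if s'.userCom = s'.com then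
        vc.verifyDist pp s'.com (new.getD i nil) i s'.proof True else 0 := by
  classical
  simp only [expect_apply_true (PMF.bind _ _), expect_bind, correctnessGame, expect_map]
  congr 1
  funext s
  congr 1
  funext s'
  split_ifs with h
  · simp only [h, and_true]
    rw [← expect_apply_true]
  · simp [h, expect_const]

/-- The failure probability `ε` of a single update bounds that of `ProofUpdate` and of `Open`. -/
theorem expect_one_sub_success_le {ε : ℝ} (hkn : k ≤ n) {i : ℕ}
    (hS : ∀ pp ∈ (vc.keyGenDist lam n).support, ∀ x ∈ (messageDist S lam n pp).support,
      x ∈ vc.messages pp)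
    (hcorrect : ∀ pp ∈ (vc.keyGenDist lam n).support, ∀ v, vc.IsVector n pp v →
      ∀ (reopen : Bool) (new : List Val), vc.IsVector n pp new →
      1 - ε ≤ prob ((vc.start pp i v).bind fun s =>
        vc.correctnessGame lam pp i v s [(reopen, new)])) :
    (expect (vc.execution S lam n k) fun ω => 1 - vc.updateSuccess lam k i ω) ≤ ENNReal.ofReal ε ∧
    (expect (vc.execution S lam n k) fun ω => 1 - vc.openSuccess k i ω) ≤ ENNReal.ofReal ε := by
  have key : ∀ pp ∈ (vc.keyGenDist lam n).support, ∀ v, vc.IsVector n pp v →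
      ∀ (reopen : Bool) (new : List Val), vc.IsVector n pp new →
      1 - ENNReal.ofReal ε ≤ ((vc.start pp i v).bind fun s =>
        vc.correctnessGame lam pp i v s [(reopen, new)]) True := by
    intro pp hpp v hv reopen new hnew
    have h := hcorrect pp hpp v hv reopen new hnew
    rw [tsub_le_iff_right]
    have h1 : ((vc.start pp i v).bind fun s =>
        vc.correctnessGame lam pp i v s [(reopen, new)]) True = ENNReal.ofReal (prob
        ((vc.start pp i v).bind fun s => vc.correctnessGame lam pp i v s [(reopen, new)])) :=
      (ENNReal.ofReal_toReal (PMF.apply_ne_top _ _)).symm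
    rw [h1]
    calc (1 : ℝ≥0∞) = ENNReal.ofReal 1 := by simp
      _ ≤ ENNReal.ofReal (_ + ε) := ENNReal.ofReal_le_ofReal (by linarith)
      _ ≤ _ := ENNReal.ofReal_add_le
  constructor
  · refine vc.expect_execution_one_sub_le hkn (vc.updateSuccess_le_one lam k i) hS
      fun pp hpp old fresh h1 h2 => (key pp hpp old h1 false _ h2).trans_eq ?_
    rw [expect_correctnessGame]
    simp only [start, step, updateSuccess, expect_bind, expect_pure, Bool.false_eq_true, if_false]
    congr 1
    funext c
    rw [expect_comm]
  · refine vc.expect_execution_one_sub_le hkn (vc.openSuccess_le_one k i) hS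
      fun pp hpp old fresh h1 h2 => (key pp hpp old h1 true _ h2).trans_eq ?_
    rw [expect_correctnessGame]
    simp only [start, step, openSuccess, expect_bind, expect_pure, if_true, expect_const]

/-! ### Fresh messages differ from the old ones -/

/-- The fresh messages at the first `k` indices differ from the old ones. -/
def Execution.Good (k : ℕ) (ω : Execution) : Prop :=
  ∀ j < k, ω.fresh.getD j nil ≠ ω.old.getD j nil

open Classical in
variable {S lam n k} in
theorem expect_not_good_le (hkn : k ≤ n) {δ : ℝ≥0∞}
    (hδ : ∀ pp ∈ (vc.keyGenDist lam n).support, ∀ x, messageDist S lam n pp x ≤ δ) :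
    (expect (vc.execution S lam n k) fun ω => if ω.Good k then 0 else 1) ≤ k * δ := by
  rw [expect_execution]
  refine expect_le_of_mem fun pp hpp => expect_le_of_mem fun old _ => expect_le_of_mem fun c _ => ?_
  calc _ ≤ expect (vectorDist S lam n pp) fun fresh =>
        ∑ j ∈ Finset.range k, if fresh.getD j nil = old.getD j nil then 1 else 0 := by
        refine expect_mono fun fresh => expect_le_of_mem fun r _ => ?_
        split_ifs with h
        · exact zero_le
        · simp only [Execution.Good, not_forall, not_not] at h
          obtain ⟨j, hj, h⟩ := h
          have := Finset.single_le_sum (s := Finset.range k)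
            (f := fun j => if fresh.getD j nil = old.getD j nil then (1 : ℝ≥0∞) else 0)
            (fun _ _ => zero_le) (Finset.mem_range.2 hj)
          exact (if_pos h).ge.trans this
    _ ≤ ∑ j ∈ Finset.range k, δ := by
        rw [expect_sum]
        refine Finset.sum_le_sum fun j hj => ?_
        exact expect_sampleList_getD_eq_le (hδ pp hpp) _ (by
          rw [Finset.mem_range] at hj; simp; omega) _
    _ = _ := by simp

end DynamicVC

/-! ### Users that do not read each other's new messages -/

/-- With the address `a`, one accesses the new message at index `j`, or the change with number `j`. -/
def Reads (a : Val) (j : ℕ) : Prop := (a.head.len = 1 ∨ a.head.len = 2) ∧ a.tail.len = j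

open Classical in
/-- Every access reads at most one message. -/
theorem sum_reads_le_length (s : Finset ℕ) (l : List Val) :
    (∑ j ∈ s, if ∃ a ∈ l, Reads a j then (1 : ℝ≥0∞) else 0) ≤ l.length := by
  rw [Finset.sum_boole]
  have h1 : (s.filter fun j => ∃ a ∈ l, Reads a j) ⊆ (l.map fun a => a.tail.len).toFinset := by
    intro j hj
    obtain ⟨a, ha, -, h⟩ := (Finset.mem_filter.1 hj).2
    simp only [List.mem_toFinset, List.mem_map]
    exact ⟨a, ha, h⟩
  have h2 := (Finset.card_le_card h1).trans (List.toFinset_card_le _)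
  rw [List.length_map] at h2
  exact_mod_cast h2

theorem changed_splice {k : ℕ} {old fresh : List Val} (hk : k ≤ old.length)
    (h : ∀ j < k, fresh.getD j nil ≠ old.getD j nil) :
    changed old (splice k old fresh) = List.range k := by
  obtain ⟨d, hd⟩ := Nat.exists_eq_add_of_le hk
  rw [changed, hd, List.range_add, List.filter_append, List.filter_eq_self.2, List.filter_eq_nil_iff.2,
    List.append_nil]
  · intro j hj
    obtain ⟨j, -, rfl⟩ := List.mem_map.1 hj
    rw [getD_splice hk]
    simp
  · intro j hj
    rw [List.mem_range] at hj
    rw [getD_splice hk, if_pos hj]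
    exact decide_eq_true (h j hj).symm

/-- The memory from which a proof is updated when the list of changes is that for the indices below
`k`, whether or not the messages at these indices differ. -/
def rangeMem (lam k : ℕ) (old new : List Val) (u : List Bool) (address : Val) : Val :=
  match address.head.len with
  | 0 => old.getD address.tail.len nil
  | 1 => new.getD address.tail.len nil
  | 2 =>
    if address.tail.len < k then ofList [ofNat address.tail.len, old.getD address.tail.len nil,
      new.getD address.tail.len nil]
    else nil
  | _ => ofBits ((u.drop (lam * address.tail.len)).take lam)

theorem updateMem_eq_rangeMem {k : ℕ} {old new : List Val} (h : changed old new = List.range k)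
    (lam : ℕ) (u : List Bool) : updateMem lam old new u = rangeMem lam k old new u := by
  funext a
  rw [updateMem, rangeMem, h]
  generalize a.head.len = t
  rcases t with _ | _ | _ | t
  · rfl
  · rfl
  · by_cases hk : a.tail.len < k <;> simp [hk]
  · rfl

theorem rangeMem_splice_congr {k : ℕ} {old m m' : List Val} (hk : k ≤ old.length) (lam : ℕ)
    (u : List Bool) {a : Val} (h : ∀ j, Reads a j → m.getD j nil = m'.getD j nil) :
    rangeMem lam k old (splice k old m) u a = rangeMem lam k old (splice k old m') u a := by
  rw [rangeMem, rangeMem]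
  split
  · rfl
  · next h1 =>
    rw [getD_splice hk, getD_splice hk, h _ ⟨Or.inl h1, rfl⟩]
  · next h2 =>
    rw [getD_splice hk, getD_splice hk, h _ ⟨Or.inr h2, rfl⟩]
  · rfl

/-- The vector `m` without its entries at the indices in `L`. -/
def blank (L : Finset ℕ) (m : List Val) : List Val :=
  (List.range m.length).map fun j => if j ∈ L then nil else m.getD j nil

theorem blank_set {L : Finset ℕ} {j : ℕ} (hj : j ∈ L) (m : List Val) (y : Val) :
    blank L (m.set j y) = blank L m := by
  rw [blank, blank, List.length_set]
  refine List.map_congr_left fun x _ => ?_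
  by_cases hx : x ∈ L
  · rw [if_pos hx, if_pos hx]
  · rw [if_neg hx, if_neg hx]
    have : j ≠ x := by rintro rfl; exact hx hj
    simp [List.getD_eq_getElem?_getD, List.getElem?_set_ne this]

theorem getD_blank_set {L : Finset ℕ} {m : List Val} {i j : ℕ} (hj : j ∈ L → j = i) (y : Val) :
    ((blank L m).set i y).getD j nil = (m.set i y).getD j nil := by
  have hlen : (blank L m).length = m.length := by simp [blank]
  simp only [List.getD_eq_getElem?_getD]
  by_cases hij : i = j
  · subst hij
    by_cases hi : i < m.length
    · rw [List.getElem?_set_self (by omega), List.getElem?_set_self hi]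
    · rw [List.getElem?_eq_none (by simp; omega), List.getElem?_eq_none (by simp; omega)]
  · rw [List.getElem?_set_ne hij, List.getElem?_set_ne hij]
    have hjL : j ∉ L := fun h => hij (hj h).symm
    by_cases hi : j < m.length
    · simp [blank, hi, hjL]
    · rw [List.getElem?_eq_none (by omega), List.getElem?_eq_none (by omega)]

namespace DynamicVC

variable (vc : DynamicVC) (S : Prog) (lam n k : ℕ)

/-- The input of `ProofUpdate`. -/
def proofUpdateInput (pp com π y : Val) (i : ℕ) : Val := ofList [pp, com, π, y, ofNat i]

open Classical in
/-- Success of user `i`, who obtains the value and the trace `w` for the new message `y`, without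
reading the messages at the other indices in `L`: the new commitment is `c`, and the proof is
accepted. -/
noncomputable def obliviousVerify (L : Finset ℕ) (pp : Val) (i : ℕ) (c y : Val)
    (w : Val × List Val) : ℝ≥0∞ :=
  if (∀ a ∈ w.2, ∀ j ∈ L, j ≠ i → ¬ Reads a j) ∧ w.1.head = c then
    vc.verifyDist pp c y i w.1.tail True
  else 0

/-- The probability that user `i` arrives at the new commitment `c` and a proof that is accepted for the
new message `y`, without reading the messages at the other indices in `L`, when the update information
is `u` and the fresh messages are those in `m`. It does not depend on the entries of `m` at the
indices in `L`. -/
noncomputable def obliviousSuccess (L : Finset ℕ) (pp : Val) (old : List Val) (com aux : Val)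
    (i : ℕ) (c : Val) (u : List Bool) (m : List Val) (y : Val) : ℝ≥0∞ :=
  expect (vc.openDist pp (old.getD i nil) i aux) fun π =>
  expect (vc.proofUpdate.trace (rangeMem lam k old (splice k old ((blank L m).set i y)) u)
    (proofUpdateInput pp com π y i)) (vc.obliviousVerify L pp i c y)

theorem obliviousVerify_le_one (L : Finset ℕ) (pp : Val) (i : ℕ) (c y : Val)
    (w : Val × List Val) : vc.obliviousVerify L pp i c y w ≤ 1 := by
  rw [obliviousVerify]
  split_ifs
  exacts [PMF.coe_le_one _ _, zero_le]

theorem obliviousSuccess_le_one (L : Finset ℕ) (pp : Val) (old : List Val) (com aux : Val)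
    (i : ℕ) (c : Val) (u : List Bool) (m : List Val) (y : Val) :
    vc.obliviousSuccess lam k L pp old com aux i c u m y ≤ 1 :=
  expect_le_of_mem fun _ _ => expect_le_of_mem fun _ _ => vc.obliviousVerify_le_one ..

/-- The user arrives at one commitment only. -/
theorem tsum_obliviousSuccess_le_one (L : Finset ℕ) (pp : Val) (old : List Val) (com aux : Val)
    (i : ℕ) (u : List Bool) (m : List Val) (y : Val) :
    ∑' c, vc.obliviousSuccess lam k L pp old com aux i c u m y ≤ 1 := by
  simp only [obliviousSuccess, ← expect_tsum]
  refine expect_le_of_mem fun π _ => expect_le_of_mem fun w _ => ?_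
  rw [tsum_eq_single w.1.head]
  · exact vc.obliviousVerify_le_one ..
  · intro c hc
    rw [obliviousVerify, if_neg fun h => hc h.2.symm]

theorem obliviousSuccess_set (L : Finset ℕ) (pp : Val) (old : List Val) (com aux : Val)
    (i : ℕ) (c : Val) (u : List Bool) {j : ℕ} (hj : j ∈ L) (m : List Val) (y v : Val) :
    vc.obliviousSuccess lam k L pp old com aux i c u (m.set j y) v =
      vc.obliviousSuccess lam k L pp old com aux i c u m v := by
  rw [obliviousSuccess, obliviousSuccess, blank_set hj]

variable {lam k} in
/-- A user who does not read the messages at the indices in `L` cannot tell whether they are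
blank. -/
theorem obliviousSuccess_eq {L : Finset ℕ} {pp : Val} {old : List Val} {com aux : Val}
    {i : ℕ} {c : Val} {u : List Bool} {m : List Val} {y : Val} (hk : k ≤ old.length)
    (hm : ∀ j < k, (m.set i y).getD j nil ≠ old.getD j nil) :
    vc.obliviousSuccess lam k L pp old com aux i c u m y =
      expect (vc.openDist pp (old.getD i nil) i aux) fun π =>
      expect (vc.proofUpdate.trace (updateMem lam old (splice k old (m.set i y)) u)
        (proofUpdateInput pp com π y i)) (vc.obliviousVerify L pp i c y) := by
  rw [obliviousSuccess, updateMem_eq_rangeMem (changed_splice hk hm)]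
  congr 1
  funext π
  refine AgreeOn.expect_eq (agreeOn_trace (G := fun a => ∀ j ∈ L, j ≠ i → ¬ Reads a j)
    (fun a ha => rangeMem_splice_congr hk lam u fun j hj => ?_) _ _) fun w hw => ?_
  · exact getD_blank_set (fun hjL => by_contra fun hne => ha j hjL hne hj) y
  · rw [obliviousVerify, if_neg fun h => hw h.1]

/-- The value and the trace of the update of a proof by user `i`. -/
noncomputable def proofUpdateTrace (lam k i : ℕ) (ω : Execution) (π : Val) :
    PMF (Val × List Val) :=
  vc.proofUpdate.trace (updateMem lam ω.old (splice k ω.old ω.fresh) ω.info)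
    (proofUpdateInput ω.pp ω.com π (ω.fresh.getD i nil) i)

open Classical in
/-- The probability that user `i` reads the new message at index `j`. -/
noncomputable def readProb (i j : ℕ) (ω : Execution) : ℝ≥0∞ :=
  expect (vc.openDist ω.pp (ω.old.getD i nil) i ω.aux) fun π =>
  expect (vc.proofUpdateTrace lam k i ω π) fun w => if ∃ a ∈ w.2, Reads a j then 1 else 0

theorem readProb_le_one (i j : ℕ) (ω : Execution) : vc.readProb lam k i j ω ≤ 1 := by
  refine expect_le_of_mem fun π _ => expect_le_of_mem fun w _ => ?_
  split_ifs <;> simp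

/-- `obliviousSuccess` in an execution. -/
noncomputable def obliviousSuccessIn (L : Finset ℕ) (i : ℕ) (ω : Execution) (y : Val) : ℝ≥0∞ :=
  vc.obliviousSuccess lam k L ω.pp ω.old ω.com ω.aux i ω.newCom ω.info ω.fresh y

variable {lam k} in
/-- A user who updates the proof successfully does so without reading the messages at the other
indices in `L`, or reads one of them. -/
theorem updateSuccess_le {L : Finset ℕ} {i : ℕ} {ω : Execution} (hk : k ≤ ω.old.length)
    (hi : i < k) (hω : ω.Good k) :
    vc.updateSuccess lam k i ω ≤ vc.obliviousSuccessIn lam k L i ω (ω.fresh.getD i nil) +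
      ∑ j ∈ L.erase i, vc.readProb lam k i j ω := by
  classical
  have hset : ω.fresh.set i (ω.fresh.getD i nil) = ω.fresh := by
    by_cases h : i < ω.fresh.length
    · simp [List.getD_eq_getElem?_getD, h]
    · exact List.set_eq_of_length_le (by omega)
  have hnew : (splice k ω.old ω.fresh).getD i nil = ω.fresh.getD i nil := by
    rw [getD_splice hk, if_pos hi]
  rw [obliviousSuccessIn, vc.obliviousSuccess_eq hk (by rwa [hset]), hset]
  simp only [readProb]
  rw [← expect_sum, ← expect_add]
  refine expect_mono fun π => ?_
  simp only [proofUpdateRun, hnew]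
  rw [expect_run_eq_expect_trace _ _ _ fun v _ => if v.head = ω.newCom then
    vc.verifyDist ω.pp ω.newCom (ω.fresh.getD i nil) i v.tail True else 0, ← expect_sum,
    proofUpdateTrace, proofUpdateInput, ← expect_add]
  refine expect_mono fun w => ?_
  by_cases hw : ∀ a ∈ w.2, ∀ j ∈ L, j ≠ i → ¬ Reads a j
  · refine le_trans (le_of_eq ?_) le_self_add
    by_cases hc : w.1.head = ω.newCom
    · rw [obliviousVerify, if_pos hc, if_pos ⟨hw, hc⟩]
    · rw [obliviousVerify, if_neg hc, if_neg fun h => hc h.2]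
  · push Not at hw
    obtain ⟨a, ha, j, hj, hji, hr⟩ := hw
    have h1 : (1 : ℝ≥0∞) ≤ ∑ j ∈ L.erase i, if ∃ a ∈ w.2, Reads a j then 1 else 0 :=
      (if_pos (⟨a, ha, hr⟩ : ∃ a ∈ w.2, Reads a j)).ge.trans (Finset.single_le_sum
        (f := fun j => if ∃ a ∈ w.2, Reads a j then (1 : ℝ≥0∞) else 0)
        (fun _ _ => zero_le) (Finset.mem_erase.2 ⟨hji, hj⟩))
    refine le_trans ?_ (h1.trans le_add_self)
    split_ifs
    exacts [PMF.coe_le_one _ _, zero_le]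

variable {lam k} in
/-- If the user succeeds for a message `y` without reading the other messages in `L`, then also when
these have been chosen independently of `y`. -/
theorem obliviousSuccessIn_le_fakeSuccess {L : Finset ℕ} {i : ℕ} {ω : Execution} {y : Val}
    (hk : k ≤ ω.old.length) (hk' : k ≤ ω.fresh.length) (hi : i < k) (hω : ω.Good k)
    (hy : y ≠ ω.old.getD i nil) :
    vc.obliviousSuccessIn lam k L i ω y ≤ vc.fakeSuccess lam k i ω y := by
  have hget : (ω.fresh.set i y).getD i nil = y := by
    simp [List.getD_eq_getElem?_getD, show i < ω.fresh.length by omega]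
  rw [obliviousSuccessIn, vc.obliviousSuccess_eq hk]
  · refine expect_mono fun π => ?_
    simp only [proofUpdateRun]
    rw [expect_run_eq_expect_trace _ _ _ fun v _ => vc.verifyDist ω.pp ω.newCom y i v.tail True,
      getD_splice hk, if_pos hi, hget, proofUpdateInput]
    refine expect_mono fun w => ?_
    rw [obliviousVerify]
    split_ifs
    exacts [le_rfl, zero_le]
  · intro j hj
    by_cases hij : i = j
    · rw [← hij, hget]; exact hy
    · have := hω j hj
      simpa [List.getD_eq_getElem?_getD, List.getElem?_set_ne hij] using this

variable {S lam n k} in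
/-- The attack succeeds about as often as the new commitment can be opened honestly and user `i`
succeeds for a random message `y` without reading the other messages in `L`. The loss `2 * δ` is for the
cases that `y` is the new message at index `i`, which is no attack, or the old one, for which the
list of changes would be shorter. -/
theorem le_attackSuccess {L : Finset ℕ} {i : ℕ} {ω : Execution} {δ : ℝ≥0∞}
    (hδ : ∀ x, messageDist S lam n ω.pp x ≤ δ)
    (hk : k ≤ ω.old.length) (hk' : k ≤ ω.fresh.length) (hi : i < k) (hω : ω.Good k) :
    vc.openSuccess k i ω * (expect (messageDist S lam n ω.pp) (vc.obliviousSuccessIn lam k L i ω) -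
      2 * δ) ≤ vc.attackSuccess S lam n k i ω := by
  classical
  rw [attackSuccess]
  gcongr
  rw [tsub_le_iff_right]
  calc _ ≤ expect (messageDist S lam n ω.pp) fun y =>
        (if y = ω.fresh.getD i nil then 0 else vc.fakeSuccess lam k i ω y) +
        ((if y = ω.fresh.getD i nil then 1 else 0) + if y = ω.old.getD i nil then 1 else 0) := by
        refine expect_mono fun y => ?_
        have h1 : vc.obliviousSuccessIn lam k L i ω y ≤ 1 := vc.obliviousSuccess_le_one ..
        by_cases hy : y = ω.old.getD i nil
        · rw [if_pos hy]
          exact h1.trans (le_add_self.trans le_add_self)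
        by_cases hy' : y = ω.fresh.getD i nil
        · rw [if_pos hy', if_pos hy']
          exact h1.trans (le_self_add.trans le_add_self)
        · rw [if_neg hy']
          exact (vc.obliviousSuccessIn_le_fakeSuccess hk hk' hi hω hy).trans le_self_add
    _ ≤ _ := by
        rw [expect_add, expect_add, two_mul]
        exact add_le_add le_rfl (add_le_add ((expect_ite_eq _ _).trans_le (hδ _))
          ((expect_ite_eq _ _).trans_le (hδ _)))

/-! ### Executions as batches of updates -/

variable {S lam n k} in
theorem exists_batch (hkn : k ≤ n)
    (hS : ∀ pp ∈ (vc.keyGenDist lam n).support, ∀ x ∈ (messageDist S lam n pp).support,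
      x ∈ vc.messages pp)
    {ω : Execution} (hω : ω ∈ (vc.execution S lam n k).support) (hgood : ω.Good k) :
    ∃ b : vc.Batch n lam k, b.pp = ω.pp ∧ b.old = ω.old ∧ b.new = splice k ω.old ω.fresh ∧
      b.com = ω.com ∧ b.aux = ω.aux ∧ b.info = ω.info := by
  obtain ⟨h1, h2, h3, h4, h5⟩ := vc.mem_support_execution hω
  have h6 := vc.isVector_of_mem_vectorDist S lam (hS _ h1) h2
  have h7 := vc.isVector_of_mem_vectorDist S lam (hS _ h1) h4
  refine ⟨⟨ω.pp, ω.old, splice k ω.old ω.fresh, ω.com, ω.aux, ω.newCom, ω.info, ω.newAux, h1, h6,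
    vc.isVector_splice hkn h6 h7, ?_, h3, h5⟩, rfl, rfl, rfl, rfl, rfl, rfl⟩
  rw [changed_splice (by rw [h6.1]; exact hkn) hgood, List.length_range]

variable {S lam n k} in
/-- The running time bounds the number of messages that a user reads. -/
theorem sum_readProb_le (hkn : k ≤ n)
    (hS : ∀ pp ∈ (vc.keyGenDist lam n).support, ∀ x ∈ (messageDist S lam n pp).support,
      x ∈ vc.messages pp)
    {T : ℝ} (hT : vc.ProofUpdateTimeLE n lam k T)
    {ω : Execution} (hω : ω ∈ (vc.execution S lam n k).support) (hgood : ω.Good k) {i : ℕ}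
    (hi : i < k) : ∑ j ∈ Finset.range k, vc.readProb lam k i j ω ≤ ENNReal.ofReal T := by
  classical
  obtain ⟨b, hpp, hold, hnew, hcom, haux, hinfo⟩ := vc.exists_batch hkn hS hω hgood
  have hlen : k ≤ ω.old.length := by rw [← hold, b.old_vector.1]; exact hkn
  have h := hT b i (by omega)
  rw [hpp, hold, hnew, hcom, haux, hinfo] at h
  simp only [readProb]
  rw [← expect_sum]
  refine expect_le_of_mem fun π hπ => ?_
  rw [← expect_sum]
  refine expect_le_of_mem fun w hw => ?_
  refine (sum_reads_le_length _ _).trans ?_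
  rw [← ENNReal.ofReal_natCast]
  refine ENNReal.ofReal_le_ofReal (length_le_of_mem_support_trace (fun o ho => h π hπ o ?_) w hw)
  rw [proofUpdateRun, getD_splice hlen, if_pos hi]
  exact ho

end DynamicVC

/-! ### Short update information makes the attack succeed -/

namespace DynamicVC

variable (vc : DynamicVC) {S : Prog} {lam n k : ℕ}

/-- In a random execution, hardly ever do many users in `L` succeed obliviously with the new
message although each of them would fail with most other messages: the update information would
be a succinct description of a set of messages that is both sparse and contains the new ones. -/
theorem expect_filter_le (hkn : k ≤ n) {L B : Finset ℕ} (hL : L ⊆ Finset.range k) (hBL : B ⊆ L)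
    (hB : B.Nonempty) {m : ℕ} (θ : ℝ≥0∞)
    (hinfo : ∀ ω ∈ (vc.execution S lam n k).support, ω.Good k → ω.info.length ≤ m) :
    open Classical in
    (expect (vc.execution S lam n k) fun ω => if ω.Good k ∧ ∀ i ∈ B,
      expect (messageDist S lam n ω.pp) (vc.obliviousSuccessIn lam k L i ω) < θ ∧
      2⁻¹ ≤ vc.obliviousSuccessIn lam k L i ω (ω.fresh.getD i nil) then 1 else 0) ≤
    2 ^ B.card * (shortBits m).card * θ ^ (B.card - 1) := by
  classical
  rw [expect_execution]
  refine expect_le_of_mem fun pp hpp => expect_le_of_mem fun old hold =>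
    expect_le_of_mem fun c hc => ?_
  refine le_trans ?_ (filter_bound (messageDist S lam n pp) (List.replicate n nil) L B hBL
    (fun i hi => ?_)
    (fun m => (vc.updateDist pp c.1 old (splice k old m) c.2).map fun r => (r.1, r.2.1))
    (fun i c' u m y => vc.obliviousSuccess lam k L pp old c.1 c.2 i c' u m y)
    (fun i c' u j hj m y v => vc.obliviousSuccess_set lam k L pp old c.1 c.2 i c' u hj m y v)
    (fun i u m y => vc.tsum_obliviousSuccess_le_one lam k L pp old c.1 c.2 i u m y)
    (shortBits m) θ hB)
  · refine expect_mono_of_mem fun fresh hfresh => ?_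
    rw [expect_map]
    refine expect_mono_of_mem fun r hr => ?_
    split_ifs with h1 h2 h2
    · exact le_rfl
    · refine absurd ⟨mem_shortBits (hinfo
        ⟨pp, old, c.1, c.2, fresh, r.1, r.2.1, r.2.2⟩ ?_ h1.1), h1.2⟩ h2
      simp only [execution, PMF.mem_support_bind_iff, PMF.mem_support_pure_iff]
      exact ⟨pp, hpp, old, hold, c, hc, fresh, hfresh, r, hr, rfl⟩
    · exact zero_le
    · exact le_rfl
  · have := Finset.mem_range.1 (hL hi)
    rw [List.length_replicate]
    omega

/-- If updates are fast and their information is short, then the attack succeeds at some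
index. -/
theorem exists_le_expect_attackSuccess (hkn : k ≤ n) {b m : ℕ} {T ε : ℝ} {δ θ : ℝ≥0∞}
    (hb : 1 ≤ b) (hT1 : 1 ≤ T) (hbT : 768 * ((4 * b : ℕ) : ℝ) * T ≤ k) (hε : ε ≤ 1 / 64)
    (hθ : θ ≠ ⊤) (hδθ : 4 * δ ≤ θ) (hkδ : k * δ ≤ 64⁻¹)
    (hQ : 2 ^ (4 * b) * (2 ^ b * (shortBits m).card * θ ^ (b - 1)) ≤ 64⁻¹)
    (hS : ∀ pp ∈ (vc.keyGenDist lam n).support, ∀ x ∈ (messageDist S lam n pp).support,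
      x ∈ vc.messages pp)
    (hδ : ∀ pp ∈ (vc.keyGenDist lam n).support, ∀ x, messageDist S lam n pp x ≤ δ)
    (hcorrect : ∀ pp ∈ (vc.keyGenDist lam n).support, ∀ i < n, ∀ v, vc.IsVector n pp v →
      ∀ (reopen : Bool) (new : List Val), vc.IsVector n pp new →
      1 - ε ≤ prob ((vc.start pp i v).bind fun s =>
        vc.correctnessGame lam pp i v s [(reopen, new)]))
    (hT : vc.ProofUpdateTimeLE n lam k T)
    (hinfo : ∀ B : vc.Batch n lam k, B.info.length ≤ m) :
    ∃ i < k, θ * 8⁻¹ ≤ expect (vc.execution S lam n k) (vc.attackSuccess S lam n k i) := by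
  classical
  set p := vc.execution S lam n k with hp
  set E : ℕ → ℕ → ℝ≥0∞ := fun i j =>
    expect p fun ω => if ω.Good k then vc.readProb lam k i j ω else 0 with hE
  have hE1 : ∀ i j, E i j ≠ ⊤ := fun i j => by
    refine ((expect_le_of_mem fun ω _ => ?_).trans_lt ENNReal.one_lt_top).ne
    split_ifs
    exacts [vc.readProb_le_one .., zero_le]
  have hrow : ∀ i < k, ∑ j ∈ Finset.range k, (E i j).toReal ≤ T := by
    intro i hi
    rw [← ENNReal.toReal_sum fun j _ => hE1 i j]
    refine ENNReal.toReal_le_of_le_ofReal (by linarith) ?_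
    simp only [hE]
    rw [← expect_sum]
    refine expect_le_of_mem fun ω hω => ?_
    by_cases hg : ω.Good k
    · simp only [if_pos hg]
      exact vc.sum_readProb_le hkn hS hT hω hg hi
    · simp [hg]
  obtain ⟨L, hLk, hLcard, hLsum⟩ := exists_sparse_subset k (4 * b) T hT1 hbT
    (fun i j => (E i j).toReal) (fun _ _ => ENNReal.toReal_nonneg) hrow
  have hlt : ∀ i ∈ L, i < k := fun i hi => Finset.mem_range.1 (hLk hi)
  have hε' : ENNReal.ofReal ε ≤ 64⁻¹ := by
    refine (ENNReal.ofReal_le_ofReal hε).trans_eq ?_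
    rw [one_div, ENNReal.ofReal_inv_of_pos (by norm_num)]
    norm_num
  have hsucc : ∀ i ∈ L, _ := fun i hi => vc.expect_one_sub_success_le S lam n k hkn (i := i) hS
    fun pp hpp v hv => hcorrect pp hpp i ((hlt i hi).trans_le hkn) v hv
  have hlen : ∀ ω ∈ p.support, ω.old.length = n ∧ ω.fresh.length = n := fun ω hω =>
    have h := vc.mem_support_execution hω
    ⟨length_of_mem_vectorDist h.2.1, length_of_mem_vectorDist h.2.2.2.1⟩
  have hw : ∑ i ∈ L, ∑ j ∈ L.erase i, E i j ≤ L.card * 64⁻¹ := by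
    calc ∑ i ∈ L, ∑ j ∈ L.erase i, E i j
        = ENNReal.ofReal (∑ i ∈ L, ∑ j ∈ L.erase i, (E i j).toReal) := by
          rw [ENNReal.ofReal_sum_of_nonneg fun i _ =>
            Finset.sum_nonneg fun j _ => ENNReal.toReal_nonneg]
          refine Finset.sum_congr rfl fun i _ => ?_
          rw [ENNReal.ofReal_sum_of_nonneg fun j _ => ENNReal.toReal_nonneg]
          exact Finset.sum_congr rfl fun j _ => (ENNReal.ofReal_toReal (hE1 i j)).symm
      _ ≤ ENNReal.ofReal ((4 * b : ℕ) / 64) := ENNReal.ofReal_le_ofReal hLsum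
      _ = _ := by
          rw [hLcard, div_eq_mul_inv, ENNReal.ofReal_mul (by positivity),
            ENNReal.ofReal_inv_of_pos (by norm_num), ENNReal.ofReal_natCast]
          norm_num
  have hfilter : ∀ B ⊆ L, B.card = b → (expect p fun ω => if ω.Good k ∧ ∀ i ∈ B,
      expect (messageDist S lam n ω.pp) (vc.obliviousSuccessIn lam k L i ω) < θ ∧
      2⁻¹ ≤ vc.obliviousSuccessIn lam k L i ω (ω.fresh.getD i nil) then 1 else 0) ≤
      2 ^ b * (shortBits m).card * θ ^ (b - 1) := by
    intro B hBL hBcard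
    have h := vc.expect_filter_le (S := S) (lam := lam) hkn hLk hBL (Finset.card_pos.1 (by omega))
      (m := m) θ fun ω hω hg => by
        obtain ⟨batch, -, -, -, -, -, h⟩ := vc.exists_batch hkn hS hω hg
        rw [← h]
        exact hinfo batch
    rwa [hBcard] at h
  obtain ⟨i, hi, h⟩ := exists_index_of_filter_bound p L b hb hLcard (fun ω => ω.Good k)
    (vc.openSuccess k) (vc.updateSuccess lam k)
    (fun i ω => vc.obliviousSuccessIn lam k L i ω (ω.fresh.getD i nil))
    (fun i ω => expect (messageDist S lam n ω.pp) (vc.obliviousSuccessIn lam k L i ω))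
    (vc.readProb lam k) θ δ (2 ^ b * (shortBits m).card * θ ^ (b - 1))
    (vc.updateSuccess_le_one lam k) hθ hδθ
    (fun i hi => (hsucc i hi).2.trans hε') (fun i hi => (hsucc i hi).1.trans hε')
    ((vc.expect_not_good_le hkn hδ).trans hkδ)
    (fun ω hω hg i hi => vc.updateSuccess_le (by rw [(hlen ω hω).1]; exact hkn) (hlt i hi) hg)
    hw hfilter hQ
  refine ⟨i, hlt i hi, h.trans (expect_mono_of_mem fun ω hω => ?_)⟩
  by_cases hg : ω.Good k
  · rw [if_pos hg]
    exact vc.le_attackSuccess (hδ _ (vc.mem_support_execution hω).1)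
      (by rw [(hlen ω hω).1]; exact hkn) (by rw [(hlen ω hω).2]; exact hkn) (hlt i hi) hg
  · simp [hg]

end DynamicVC

/-! ### Asymptotics -/

theorem eventually_eval_lt_exp (P : Polynomial ℕ) {c : ℝ} (hc : 0 < c) :
    ∀ᶠ x : ℕ in atTop, ((P.eval x : ℕ) : ℝ) < Real.exp (c * x) := by
  set R : Polynomial ℝ := (P.map (Nat.castRingHom ℝ)).comp (Polynomial.C c⁻¹ * Polynomial.X)
  have h1 := (Polynomial.tendsto_div_exp_atTop R).comp
    ((tendsto_natCast_atTop_atTop (R := ℝ)).const_mul_atTop hc)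
  filter_upwards [h1.eventually (gt_mem_nhds one_pos)] with x hx
  rw [Function.comp_apply, div_lt_one (Real.exp_pos _)] at hx
  refine lt_of_eq_of_lt ?_ hx
  simp only [R, Polynomial.eval_comp, Polynomial.eval_mul, Polynomial.eval_C, Polynomial.eval_X]
  rw [inv_mul_cancel_left₀ hc.ne', Polynomial.eval_natCast_map]
  simp

theorem Negligible.eventually_le {f : ℕ → ℝ} (h : Negligible f) {a : ℝ} (ha : 0 < a) :
    ∀ᶠ x in atTop, f x ≤ a := by
  have h0 := h 0
  simp only [pow_zero, one_mul] at h0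
  filter_upwards [h0.eventually (gt_mem_nhds ha)] with x hx using le_of_lt hx

/-- The sampled messages have polynomial size. -/
theorem DynamicVC.exists_size_messageDist_le (vc : DynamicVC) {S : Prog} (hS : S.IsPPT) :
    ∃ q : Polynomial ℕ, ∀ lam n, ∀ pp ∈ (vc.keyGenDist lam n).support,
      ∀ x ∈ (DynamicVC.messageDist S lam n pp).support, x.size ≤ q.eval (lam + n) := by
  obtain ⟨q₁, h₁⟩ := vc.keyGen_ppt
  obtain ⟨q₂, h₂⟩ := hS
  refine ⟨q₂.comp (2 * Polynomial.X + 6 + q₁.comp (2 * Polynomial.X + 6)), fun lam n pp hpp x hx => ?_⟩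
  refine (Prog.IsPPT.size_dist_le h₂ _ x hx).trans ?_
  have h : pp.size ≤ q₁.eval (2 * (lam + n) + 6) := (Prog.IsPPT.size_dist_le h₁ _ pp hpp).trans
    (eval_monotone q₁ (show _ ≤ 2 * (lam + n) + 6 by
      simp only [ofList, size, size_ofNat]; omega))
  simp only [Polynomial.eval_comp, Polynomial.eval_add, Polynomial.eval_mul, Polynomial.eval_X,
    Polynomial.eval_ofNat]
  refine eval_monotone q₂ ?_
  simp only [ofList, size, size_ofNat]
  omega

theorem DynamicVC.ProofUpdateTimeLE.mono {vc : DynamicVC} {n lam k : ℕ} {T T' : ℝ} (hT : T ≤ T')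
    (h : vc.ProofUpdateTimeLE n lam k T) : vc.ProofUpdateTimeLE n lam k T' :=
  fun b i hi π hπ o ho => (h b i hi π hπ o ho).trans hT

/-- The description of `5 * b` bits, information of `m` bits and `b - 1` successes of probability
`e^{-x}` leave a total probability of at most `1 / 64`. -/
theorem two_pow_mul_exp_le {b m : ℕ} {x : ℝ} (hx : 0 ≤ x) (hb : 2 ≤ b)
    (h : 5 * b + m + 7 ≤ x * b / 2) :
    (2 : ℝ≥0∞) ^ (4 * b) * (2 ^ b * (shortBits m).card * ENNReal.ofReal (Real.exp (-x)) ^ (b - 1)) ≤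
      64⁻¹ := by
  have hcard : ((shortBits m).card : ℝ≥0∞) ≤ 2 ^ (m + 1) := by
    exact_mod_cast (Nat.le_succ _).trans (card_shortBits_le m)
  have hreal : (2 : ℝ) ^ (5 * b + m + 7) * Real.exp (-x) ^ (b - 1) ≤ 1 := by
    have h1 : (2 : ℝ) ^ (5 * b + m + 7) ≤ Real.exp (5 * b + m + 7) := by
      have h2 : (2 : ℝ) ≤ Real.exp 1 := by
        have := Real.add_one_le_exp (1 : ℝ); linarith
      calc (2 : ℝ) ^ (5 * b + m + 7) ≤ Real.exp 1 ^ (5 * b + m + 7) := by gcongr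
        _ = _ := by rw [← Real.exp_nat_mul]; push_cast; rw [mul_one]
    rw [← Real.exp_nat_mul, Nat.cast_sub (by omega)]
    calc _ ≤ Real.exp (5 * b + m + 7) * Real.exp ((b - (1 : ℕ)) * -x) := by gcongr
      _ = Real.exp (5 * b + m + 7 + (b - (1 : ℕ)) * -x) := (Real.exp_add _ _).symm
      _ ≤ 1 := by
        rw [Real.exp_le_one_iff]
        have : (2 : ℝ) ≤ b := by exact_mod_cast hb
        push_cast
        nlinarith
  have h64 : (2 : ℝ≥0∞) ^ 6 = 64 := by norm_num
  rw [← one_div, ENNReal.le_div_iff_mul_le (by simp) (by simp), ← h64]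
  calc _ ≤ (2 : ℝ≥0∞) ^ (4 * b) * (2 ^ b * 2 ^ (m + 1) *
        ENNReal.ofReal (Real.exp (-x)) ^ (b - 1)) * 2 ^ 6 := by gcongr
    _ = ENNReal.ofReal ((2 : ℝ) ^ (5 * b + m + 7) * Real.exp (-x) ^ (b - 1)) := by
        rw [ENNReal.ofReal_mul (by positivity), ENNReal.ofReal_pow (by positivity),
          ENNReal.ofReal_pow (by positivity), ENNReal.ofReal_ofNat]
        ring
    _ ≤ 1 := by
        rw [← ENNReal.ofReal_one]
        exact ENNReal.ofReal_le_ofReal hreal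

/-! ### The lower bound -/

namespace DynamicVC

variable (vc : DynamicVC)

/-- The lower bound for a fixed `lam`. The hypotheses `hE` to `hη` hold for all large `lam`; `η` is
smaller than the exponents `c₀` of the message space and `c₁` of position binding. -/
theorem updateInfoGE_of_eventually {S A : Prog} {q : Polynomial ℕ} {lam n k : ℕ}
    {ε c₀ c₁ η ν t : ℝ} (hA : ∀ x, A.dist x = vc.attack S q x)
    (hSq : ∀ pp ∈ (vc.keyGenDist lam n).support, ∀ x ∈ (messageDist S lam n pp).support,
      x.size ≤ q.eval (lam + n))
    (hS : ∀ pp ∈ (vc.keyGenDist lam n).support, ∀ x ∈ (messageDist S lam n pp).support,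
      x ∈ vc.messages pp ∧ (messageDist S lam n pp x).toReal ≤ Real.exp (-(c₀ * lam)))
    (hbind : ∀ i < n, prob (vc.positionBindingGame A lam n i) ≤ Real.exp (-(c₁ * lam)))
    (hcorrect : ∀ pp ∈ (vc.keyGenDist lam n).support, ∀ i < n, ∀ v, vc.IsVector n pp v →
      ∀ (reopen : Bool) (new : List Val), vc.IsVector n pp new →
      1 - ε ≤ prob ((vc.start pp i v).bind fun s =>
        vc.correctnessGame lam pp i v s [(reopen, new)]))
    (hε : ε ≤ 1 / 64) (hn₀ : (64 * n : ℝ) ≤ Real.exp (c₀ * lam))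
    (hn₁ : (64 * n ^ 2 : ℝ) < Real.exp ((c₁ - η) * lam)) (h4 : 4 ≤ Real.exp ((c₀ - η) * lam))
    (hη0 : 0 < η) (hη : 64 ≤ η * lam) (hkn : k ≤ n) (ht : 1 ≤ t) (hν : ν ∈ Set.Ioo (0 : ℝ) 1)
    (hk : 6144 * t ≤ (k : ℝ) ^ ν)
    (hT : vc.ProofUpdateTimeLE n lam k (t * (k : ℝ) ^ (1 - ν))) :
    vc.UpdateInfoGE n lam k (η / 49152 * (k : ℝ) ^ ν / t * lam) := by
  by_contra hinfo
  have hk1 : 1 ≤ k := by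
    rw [Nat.one_le_iff_ne_zero]
    rintro rfl
    rw [Nat.cast_zero, Real.zero_rpow hν.1.ne'] at hk
    linarith
  have hkR : (1 : ℝ) ≤ k := by exact_mod_cast hk1
  have ht0 : 0 < t := by linarith
  -- a set of `4 * b` users that hardly read each other's messages exists for this value of `b`
  set X : ℝ := (k : ℝ) ^ ν / (3072 * t) with hX
  have hX2 : 2 ≤ X := by
    rw [hX, le_div_iff₀ (by positivity)]; linarith
  set b := ⌊X⌋₊ with hb
  have hbX : (b : ℝ) ≤ X := Nat.floor_le (by linarith)
  have hXb : X ≤ 2 * b := by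
    have := Nat.lt_floor_add_one X
    rw [← hb] at this
    linarith
  have hb2 : 2 ≤ b := Nat.le_floor (by exact_mod_cast hX2)
  have hkν : (k : ℝ) ^ ν = X * (3072 * t) := by rw [hX]; field_simp
  set B : ℝ := η / 49152 * (k : ℝ) ^ ν / t * lam with hB
  have hBb : B ≤ η * lam * b / 8 := by
    have h1 : B = η * lam * X / 16 := by rw [hB, hkν]; field_simp; ring
    rw [h1]
    have := mul_le_mul_of_nonneg_left hXb (show 0 ≤ η * lam by linarith)
    linarith
  have hB0 : 0 ≤ B := by positivity
  set m := ⌊B⌋₊ with hm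
  have hmB : (m : ℝ) ≤ B := Nat.floor_le hB0
  have hinfo' : ∀ batch : vc.Batch n lam k, batch.info.length ≤ m := by
    intro batch
    refine Nat.le_floor (le_of_not_ge fun h => hinfo ⟨batch, h⟩)
  set θ := ENNReal.ofReal (Real.exp (-(η * lam))) with hθ
  set δ := ENNReal.ofReal (Real.exp (-(c₀ * lam))) with hδ
  have hδθ : 4 * δ ≤ θ := by
    rw [hδ, hθ, show (4 : ℝ≥0∞) = ENNReal.ofReal 4 by simp, ← ENNReal.ofReal_mul (by norm_num)]
    refine ENNReal.ofReal_le_ofReal ?_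
    calc 4 * Real.exp (-(c₀ * lam)) ≤ Real.exp ((c₀ - η) * lam) * Real.exp (-(c₀ * lam)) := by gcongr
      _ = _ := by rw [← Real.exp_add]; congr 1; ring
  have hkδ : k * δ ≤ 64⁻¹ := by
    rw [← one_div, ENNReal.le_div_iff_mul_le (by simp) (by simp), hδ, ← ENNReal.ofReal_natCast,
      show (64 : ℝ≥0∞) = ENNReal.ofReal 64 by simp, ← ENNReal.ofReal_mul (by positivity),
      ← ENNReal.ofReal_mul (by positivity), ← ENNReal.ofReal_one]
    refine ENNReal.ofReal_le_ofReal ?_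
    have hkn' : (k : ℝ) ≤ n := by exact_mod_cast hkn
    calc (k : ℝ) * Real.exp (-(c₀ * lam)) * 64 = 64 * k * Real.exp (-(c₀ * lam)) := by ring
      _ ≤ Real.exp (c₀ * lam) * Real.exp (-(c₀ * lam)) := by
        gcongr
        linarith
      _ = 1 := by rw [← Real.exp_add, add_neg_cancel, Real.exp_zero]
  have hQ := two_pow_mul_exp_le (b := b) (m := m) (x := η * lam) (by linarith) hb2 (by
    have h2 : (2 : ℝ) ≤ b := by exact_mod_cast hb2
    nlinarith)
  have hbT : 768 * ((4 * b : ℕ) : ℝ) * (t * (k : ℝ) ^ (1 - ν)) ≤ k := by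
    have h1 : (k : ℝ) ^ ν * (k : ℝ) ^ (1 - ν) = k := by
      rw [← Real.rpow_add (by linarith), add_sub_cancel, Real.rpow_one]
    calc 768 * ((4 * b : ℕ) : ℝ) * (t * (k : ℝ) ^ (1 - ν))
        = b * (3072 * t) * (k : ℝ) ^ (1 - ν) := by push_cast; ring
      _ ≤ X * (3072 * t) * (k : ℝ) ^ (1 - ν) := by gcongr
      _ = k := by rw [← hkν, h1]
  have hT1 : 1 ≤ t * (k : ℝ) ^ (1 - ν) :=
    one_le_mul_of_one_le_of_one_le ht (Real.one_le_rpow hkR (by linarith [hν.2]))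
  have hmsg : ∀ pp ∈ (vc.keyGenDist lam n).support, ∀ x, messageDist S lam n pp x ≤ δ := by
    intro pp hpp x
    by_cases hx : x ∈ (messageDist S lam n pp).support
    · rw [hδ]
      exact (ENNReal.le_ofReal_iff_toReal_le (PMF.apply_ne_top _ _) (Real.exp_pos _).le).2
        (hS pp hpp x hx).2
    · rw [PMF.mem_support_iff, not_not] at hx
      rw [hx]
      exact zero_le
  obtain ⟨i, hi, h⟩ := vc.exists_le_expect_attackSuccess hkn (by omega) hT1 hbT hε
    ENNReal.ofReal_ne_top hδθ hkδ hQ (fun pp hpp x hx => (hS pp hpp x hx).1) hmsg hcorrect hT hinfo'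
  have hgame := vc.attackSuccess_le_positionBindingGame hA hkn hi
    fun pp hpp x hx => ⟨(hS pp hpp x hx).1, hSq pp hpp x hx⟩
  have hlower : ((8 * n ^ 2 : ℕ) : ℝ≥0∞)⁻¹ * (θ * 8⁻¹) ≤ vc.positionBindingGame A lam n i True :=
    (mul_le_mul' (guess_ge hk1 hkn) h).trans hgame
  have hreal := (ENNReal.toReal_mono (PMF.apply_ne_top _ _) hlower).trans
    (hbind i (hi.trans_le hkn))
  rw [ENNReal.toReal_mul, ENNReal.toReal_mul, ENNReal.toReal_inv, ENNReal.toReal_inv, hθ,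
    ENNReal.toReal_ofReal (Real.exp_pos _).le, ENNReal.toReal_natCast] at hreal
  have hnR : (1 : ℝ) ≤ n := hkR.trans (by exact_mod_cast hkn)
  have h1 : Real.exp (-(η * lam)) ≤ 64 * n ^ 2 * Real.exp (-(c₁ * lam)) := by
    calc Real.exp (-(η * lam))
        = 64 * n ^ 2 * (((8 * n ^ 2 : ℕ) : ℝ)⁻¹ * (Real.exp (-(η * lam)) * (8 : ℝ≥0∞).toReal⁻¹)) := by
          push_cast
          rw [ENNReal.toReal_ofNat]
          field_simp
          norm_num
      _ ≤ _ := by gcongr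
  have h2 : 64 * n ^ 2 * Real.exp (-(c₁ * lam)) < Real.exp (-(η * lam)) := by
    calc 64 * (n : ℝ) ^ 2 * Real.exp (-(c₁ * lam))
        < Real.exp ((c₁ - η) * lam) * Real.exp (-(c₁ * lam)) := by gcongr
      _ = _ := by rw [← Real.exp_add]; congr 1; ring
  linarith

/-- The lower bound on the update information, with a factor `τ lam` in the running time. -/
theorem exists_updateInfoGE {N : ℕ → ℕ} (hN : ∃ P : Polynomial ℕ, ∀ lam, N lam ≤ P.eval lam)
    (hcorrect : vc.Correct N) (hmessages : vc.LargeMessageSpace N)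
    (hposition : vc.ExpPositionBinding N) {ν : ℝ} (hν : ν ∈ Set.Ioo (0 : ℝ) 1) {τ : ℕ → ℝ}
    (hτ : ∀ lam, 1 ≤ τ lam)
    (hT : ∃ k₁ lam₁ : ℕ, ∀ lam ≥ lam₁, ∀ k ≥ k₁, k ≤ N lam →
      vc.ProofUpdateTimeLE (N lam) lam k (τ lam * (k : ℝ) ^ (1 - ν))) :
    ∃ c : ℝ, 0 < c ∧ ∃ (K : ℝ) (lam₀ : ℕ), ∀ lam ≥ lam₀, ∀ k : ℕ, k ≤ N lam →
      K * τ lam ≤ (k : ℝ) ^ ν →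
      vc.UpdateInfoGE (N lam) lam k (c * (k : ℝ) ^ ν / τ lam * lam) := by
  obtain ⟨P, hP⟩ := hN
  obtain ⟨S, hSppt, c₀, hc₀, hS⟩ := hmessages
  obtain ⟨q, hq⟩ := vc.exists_size_messageDist_le hSppt
  obtain ⟨A, hAppt, hA⟩ := vc.samplable_attack hSppt q
  obtain ⟨c₁, hc₁, hbind⟩ := hposition A hAppt
  obtain ⟨ε, hε, hcorr⟩ := hcorrect 1
  obtain ⟨k₁, lam₁, hT⟩ := hT
  obtain ⟨η, hη, hη₀, hη₁⟩ : ∃ η : ℝ, 0 < η ∧ η < c₀ ∧ η < c₁ := by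
    obtain ⟨η, h1, h2⟩ := exists_between (lt_min hc₀ hc₁)
    exact ⟨η, h1, h2.trans_le (min_le_left _ _), h2.trans_le (min_le_right _ _)⟩
  have hlin : ∀ᶠ lam : ℕ in atTop, 64 ≤ η * lam :=
    ((tendsto_natCast_atTop_atTop (R := ℝ)).const_mul_atTop hη).eventually_ge_atTop 64
  obtain ⟨lam₀, hlam₀⟩ := eventually_atTop.1 ((hS.and hbind).and
    ((hε.eventually_le (show (0 : ℝ) < 1 / 64 by norm_num)).and
    (((eventually_eval_lt_exp (64 * P) hc₀).and
    (eventually_eval_lt_exp (64 * P ^ 2) (sub_pos.2 hη₁))).and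
    ((eventually_eval_lt_exp 4 (sub_pos.2 hη₀)).and hlin))))
  refine ⟨η / 49152, by positivity, max 6144 ((k₁ : ℝ) ^ ν), max lam₀ lam₁,
    fun lam hlam k hk hK => ?_⟩
  obtain ⟨⟨hS, hbind⟩, hε, ⟨hn₀, hn₁⟩, h4, hlin⟩ := hlam₀ lam (le_of_max_le_left hlam)
  have hPR : (N lam : ℝ) ≤ (P.eval lam : ℕ) := by exact_mod_cast hP lam
  simp only [Polynomial.eval_mul, Polynomial.eval_pow, Polynomial.eval_ofNat, Nat.cast_mul,
    Nat.cast_pow, Nat.cast_ofNat] at hn₀ hn₁ h4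
  refine vc.updateInfoGE_of_eventually (t := τ lam) hA (hq lam (N lam)) hS hbind
    (fun pp hpp i hi v hv reopen new hnew => hcorr lam pp hpp i hi v hv _ (by simp) (by simpa))
    hε ?_ ?_ h4.le hη hlin hk (hτ lam) hν ?_ (hT lam (le_of_max_le_right hlam) k ?_ hk)
  · exact le_trans (by gcongr) hn₀.le
  · exact lt_of_le_of_lt (by gcongr) hn₁
  · exact (mul_le_mul_of_nonneg_right (le_max_left _ _) (by linarith [hτ lam])).trans hK
  · by_contra hlt
    push Not at hlt
    have h1 : (k : ℝ) ^ ν < (k₁ : ℝ) ^ ν :=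
      Real.rpow_lt_rpow (Nat.cast_nonneg k) (by exact_mod_cast hlt) hν.1
    have h2 : (k₁ : ℝ) ^ ν ≤ max 6144 ((k₁ : ℝ) ^ ν) * τ lam :=
      (le_max_right _ _).trans (le_mul_of_one_le_right (by positivity) (hτ lam))
    linarith

end DynamicVC

end VecCom

open VecCom in
/-- Sublinear proof updates force long update information: the first part is the bound with
constants, the second one keeps track of a factor `τ lam` hidden in the running time. -/
theorem theorem3 (vc : DynamicVC) (N : ℕ → ℕ)
    (hN : ∃ P : Polynomial ℕ, ∀ lam, N lam ≤ P.eval lam)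
    (hcorrect : vc.Correct N)
    (hmessages : vc.LargeMessageSpace N)
    (hproof : vc.ProofBinding N)
    (hposition : vc.ExpPositionBinding N)
    (ν : ℝ) (hν : ν ∈ Set.Ioo (0 : ℝ) 1) :
    ((∃ (α : ℝ) (k₁ lam₁ : ℕ), ∀ lam ≥ lam₁, ∀ k ≥ k₁, k ≤ N lam →
        vc.ProofUpdateTimeLE (N lam) lam k (α * (k : ℝ) ^ (1 - ν))) →
      ∃ c : ℝ, 0 < c ∧ ∃ k₀ lam₀ : ℕ, ∀ lam ≥ lam₀, ∀ k ≥ k₀, k ≤ N lam →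
        vc.UpdateInfoGE (N lam) lam k (c * (k : ℝ) ^ ν * lam)) ∧
    (∀ τ : ℕ → ℝ, (∀ lam, 1 ≤ τ lam) →
      (∃ k₁ lam₁ : ℕ, ∀ lam ≥ lam₁, ∀ k ≥ k₁, k ≤ N lam →
        vc.ProofUpdateTimeLE (N lam) lam k (τ lam * (k : ℝ) ^ (1 - ν))) →
      ∃ c : ℝ, 0 < c ∧ ∃ (K : ℝ) (lam₀ : ℕ), ∀ lam ≥ lam₀, ∀ k : ℕ, k ≤ N lam →
        K * τ lam ≤ (k : ℝ) ^ ν →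
        vc.UpdateInfoGE (N lam) lam k (c * (k : ℝ) ^ ν / τ lam * lam)) := by
  refine ⟨?_, fun τ hτ hT => vc.exists_updateInfoGE hN hcorrect hmessages hposition hν hτ hT⟩
  rintro ⟨α, k₁, lam₁, hT⟩
  have hα : 0 < max α 1 := lt_max_of_lt_right one_pos
  obtain ⟨c, hc, K, lam₀, h⟩ := vc.exists_updateInfoGE hN hcorrect hmessages hposition hν
    (τ := fun _ => max α 1) (fun _ => le_max_right _ _) ⟨k₁, lam₁, fun lam hlam k hk hkN =>
      (hT lam hlam k hk hkN).mono (by gcongr; exact le_max_left _ _)⟩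
  obtain ⟨k₀, hk₀⟩ := eventually_atTop.1 (((tendsto_rpow_atTop hν.1).comp
    (tendsto_natCast_atTop_atTop (R := ℝ))).eventually_ge_atTop (K * max α 1))
  refine ⟨c / max α 1, by positivity, k₀, lam₀, fun lam hlam k hk hkN => ?_⟩
  rw [div_mul_eq_mul_div]
  exact h lam hlam k hkN (hk₀ k hk)
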